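/- Work with finite-dimensional complex representations of the symmetric groups $S_n$. Let $h_n$, $p_n$, $s_\lambda$ be the complete homogeneous, power-sum and Schur symmetric functions, $p_\lambda=\prod_i p_{\lambda_i}$, let $f[g]$ denote plethysm, and let $\mathrm{ch}(V)=\frac1{n!}\sum_{\sigma\in S_n}\chi_V(\sigma)\,p_{\mathrm{type}(\sigma)}$ be the Frobenius characteristic of an $S_n$-module $V$. For $n\ge 1$ let $2^{k_n}$ be the highest power of $2$ dividing $n$, let $C_n\subseteq S_n$ be the cyclic group generated by an $n$-cycle, and let $Lie^{(2)}_n$ be the $S_n$-module induced from the character of $C_n$ that sends the generator to $\exp(\frac{2\pi i}{n}2^{k_n})$. Put $Lie^{(2)}=\sum_{n\ge1}\mathrm{ch}(Lie^{(2)}_n)$. For all $n\ge 0$ and $0\le r\le n$ there is an $S_n$-module $V\!h_r(n)$ whose Frobenius characteristic is the degree $n$ term $h_{n-r}[Lie^{(2)}]|_{\deg n}$. Given such modules, let $V\!h_{odd}(n)$ and $V\!h_{even}(n)$ be the direct sums of the $V\!h_r(n)$, $0\le r\le n$, over odd $r$ and over even $r$ respectively, and let $V\!h(n)=V\!h_{odd}(n)\oplus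 V\!h_{even}(n)$. Then the following hold. 1. For $n\ge2$, $V\!h_{odd}(n)\cong V\!h_{even}(n)$ as $S_n$-modules, and $$\mathrm{ch}\,V\!h_{odd}(n)=\mathrm{ch}\,V\!h_{even}(n)=\frac12\sum_{\lambda\vdash n,\ \text{all }\lambda_i\text{ powers of }2}p_\lambda .$$ 2. For $n\ge 0$, $$\mathrm{ch}\,V\!h(n)=\sum_{\lambda\vdash n,\ \text{all }\lambda_i\text{ powers of }2}p_\lambda .$$ 3. For $n\ge2$, with $\mathrm{sgn}$ the sign representation of $S_n$ and $\ell(\lambda)$ the number of parts of $\lambda$, $$\mathrm{ch}\bigl(V\!h_{odd}(n)\oplus(\mathrm{sgn}\otimes V\!h_{odd}(n))\bigr)=\sum_{\lambda\vdash n,\ n-\ell(\lambda)\text{ even},\ \text{all }\lambda_i\text{ powers of }2}p_\lambda .$$ 4. For $n\ge 0$, $V\!h(2n+1)\cong V\!h(2n)\uparrow_{S_{2n}}^{S_{2n+1}}$ as $S_{2n+1}$-modules. Moreover, the symmetric functions on the right-hand sides in 1, 2 and 3 (for the stated $n$) are Schur-positive with integer coefficients: each is a linear combination of the $s_\lambda$,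 $\lambda\vdash n$, with nonnegative integer coefficients. Here $1=2^0$ counts as a power of $2$. -/

import Mathlib

open scoped DirectSum

universe u

noncomputable section

/-! ### Symmetric functions with complex coefficients

The ring of symmetric functions over `ℂ` is the polynomial ring in the power sums
`p₁, p₂, …`, where `p_k` has degree `k`; formal infinite sums of symmetric functions of
increasing degrees are power series in the `p_k`. -/

/-- The ring of symmetric functions over `ℂ`; the variable `X k` is the power sum `p_k`. -/
abbrev SymmFun : Type := MvPolynomial ℕ+ ℂ

/-- Formal (possibly infinite) sums of symmetric functions. -/
abbrev SymmSeries : Type := MvPowerSeries ℕ+ ℂ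

/-- `p_ν = ∏ p_{ν_i}`. (The parts of a partition are positive.) -/
def powerSumPart {n : ℕ} (ν : n.Partition) : SymmFun :=
  (ν.parts.map fun k => (MvPolynomial.X k.toPNat' : SymmFun)).prod

/-- The Frobenius characteristic `(1/n!) ∑_{σ ∈ S_n} χ(σ) p_{type σ}` of a (finite-dimensional)
representation of `S_n` with character `χ`. -/
def frobeniusChar {n : ℕ} {W : Type u} [AddCommGroup W] [Module ℂ W]
    (ρ : Representation ℂ (Equiv.Perm (Fin n)) W) : SymmFun :=
  ((n.factorial : ℂ)⁻¹) •
    ∑ σ : Equiv.Perm (Fin n), LinearMap.trace ℂ W (ρ σ) • powerSumPart σ.partition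

/-- The complete homogeneous symmetric function `h_n`, the characteristic of the trivial
representation of `S_n`, that is `h_n = ∑_{ν ⊢ n} p_ν / z_ν`. -/
def completeHomog (n : ℕ) : SymmFun :=
  frobeniusChar (Representation.trivial ℂ (Equiv.Perm (Fin n)) ℂ)

/-- `h_m` for an integer `m`, with `h_m = 0` for `m < 0`. -/
def completeHomogInt (m : ℤ) : SymmFun :=
  if m < 0 then 0 else completeHomog m.toNat

/-- The parts `ν₁ ≥ ν₂ ≥ …` of a partition, as a list. -/
def sortedParts {n : ℕ} (ν : n.Partition) : List ℕ := ν.parts.sort (· ≥ ·)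

/-- The Schur function `s_ν = det (h_{ν_i - i + j})` (Jacobi–Trudi). -/
def schurFun {n : ℕ} (ν : n.Partition) : SymmFun :=
  Matrix.det (Matrix.of fun i j : Fin (sortedParts ν).length =>
    completeHomogInt (((sortedParts ν).get i : ℤ) - (i : ℤ) + (j : ℤ)))

/-- A symmetric function, homogeneous of degree `n`, is Schur-positive with integer coefficients
if it is a combination of the `s_ν`, `ν ⊢ n`, with nonnegative integer coefficients. -/
def IsSchurPositive (n : ℕ) (f : SymmFun) : Prop :=
  ∃ c : n.Partition → ℕ, f = ∑ ν : n.Partition, (c ν : ℂ) • schurFun ν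

/-! ### Plethysm -/

instance tendstoCofinite_pnat_mul (k : ℕ+) :
    Filter.TendstoCofinite (fun i : ℕ+ => k * i) :=
  Filter.tendstoCofinite_of_injective fun _ _ h => mul_left_cancel h

/-- `p_k[g]`: every `p_i` in `g` is replaced by `p_{k i}`. -/
def adams (k : ℕ+) : SymmSeries →ₐ[ℂ] SymmSeries :=
  MvPowerSeries.rename fun i : ℕ+ => k * i

/-- The plethysm `f[g]`: the algebra homomorphism in `f` with `p_k[g]` as above. -/
def plethysm (f : SymmFun) (g : SymmSeries) : SymmSeries :=
  MvPolynomial.aeval (fun k => adams k g) f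

/-- The term of degree `n` of a formal sum of symmetric functions, where `p_k` has degree `k`. -/
def degreeTerm (n : ℕ) (g : SymmSeries) : SymmSeries :=
  fun m => if Finsupp.weight (fun k : ℕ+ => (k : ℕ)) m = n then MvPowerSeries.coeff m g else 0

/-! ### The modules `Lie_n^{(2)}` -/

/-- The one-dimensional representation given by a multiplicative character. -/
def linearCharRep {G : Type*} [Group G] (χ : G →* ℂ) : Representation ℂ G ℂ where
  toFun g := χ g • LinearMap.id
  map_one' := by simp; rfl
  map_mul' g h := by ext; simp [mul_comm]

theorem finRotate_pow_self (n : ℕ) : finRotate n ^ n = 1 := by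
  rcases n with _ | _ | n
  · simp
  · exact (inferInstance : Subsingleton (Equiv.Perm (Fin 1))).elim _ _
  · have h := (isCycle_finRotate (n := n)).orderOf
    rw [support_finRotate, Finset.card_univ, Fintype.card_fin] at h
    exact orderOf_dvd_iff_pow_eq_one.mp (dvd_of_eq h)

/-- The embedding of the cyclic group `C_n` in `S_n` that sends the generator to the standard
`n`-cycle. -/
def cyclicToPerm (n : ℕ) : Multiplicative (ZMod n) →* Equiv.Perm (Fin n) :=
  AddMonoidHom.toMultiplicativeLeft (ZMod.lift n ⟨zmultiplesHom (Additive (Equiv.Perm (Fin n)))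
    (Additive.ofMul (finRotate n)), by
      simp [← ofMul_pow, finRotate_pow_self]⟩)

/-- The character of `C_n` that sends the generator to `exp((2πi/n) 2^k)`, where `2^k` is the
highest power of `2` dividing `n`. -/
def lieTwoCharacter (n : ℕ) [NeZero n] : Multiplicative (ZMod n) →* ℂ :=
  ((ZMod.stdAddChar (N := n)).mulShift ((2 ^ padicValNat 2 n : ℕ) : ZMod n)).toMonoidHom

/-- The `S_n`-module `Lie_n^{(2)}`, induced from that character. -/
def lieTwoRep (n : ℕ) [NeZero n] :=
  Representation.ind (cyclicToPerm n) (linearCharRep (lieTwoCharacter n))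

/-- The formal sum `Lie^{(2)} = ∑_{n ≥ 1} ch Lie_n^{(2)}`. -/
def lieTwoSeries : SymmSeries :=
  fun m => ∑ᶠ n : ℕ+, MvPolynomial.coeff m (frobeniusChar (lieTwoRep n))

/-- The degree `n` term of `h_{n-r}[Lie^{(2)}]`, for `0 ≤ r ≤ n`. -/
def vhChar (n : ℕ) (r : Fin (n + 1)) : SymmSeries :=
  degreeTerm n (plethysm (completeHomog (n - (r : ℕ))) lieTwoSeries)

/-! ### Modules with prescribed characteristic -/

/-- The sign representation of `S_n`. -/
def signRep (n : ℕ) : Representation ℂ (Equiv.Perm (Fin n)) ℂ :=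
  linearCharRep ((Int.castRingHom ℂ : ℤ →* ℂ).comp
    ((Units.coeHom ℤ).comp Equiv.Perm.sign))

/-- The standard embedding of `S_m` in `S_{m+1}`, as the stabiliser of the last point. -/
def permSucc (m : ℕ) : Equiv.Perm (Fin m) →* Equiv.Perm (Fin (m + 1)) :=
  Equiv.Perm.viaEmbeddingHom Fin.castSuccEmb

section Family

variable {n : ℕ} {W : Fin (n + 1) → Type u} [∀ r, AddCommGroup (W r)] [∀ r, Module ℂ (W r)]

/-- The family `ρ₀, …, ρ_n` of finite-dimensional `S_n`-modules is `Vh_0(n), …, Vh_n(n)`: the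
Frobenius characteristic of `ρ_r` is the degree `n` term of `h_{n-r}[Lie^{(2)}]`. -/
def IsVhFamily (ρ : ∀ r, Representation ℂ (Equiv.Perm (Fin n)) (W r)) : Prop :=
  ∀ r, FiniteDimensional ℂ (W r) ∧ (frobeniusChar (ρ r) : SymmSeries) = vhChar n r

/-- The direct sum of the modules of odd index. -/
def vhOdd (ρ : ∀ r, Representation ℂ (Equiv.Perm (Fin n)) (W r)) :
    Representation ℂ (Equiv.Perm (Fin n)) (⨁ r : {r : Fin (n + 1) // Odd (r : ℕ)}, W r) :=
  Representation.directSum fun r : {r : Fin (n + 1) // Odd (r : ℕ)} => ρ r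

/-- The direct sum of the modules of even index. -/
def vhEven (ρ : ∀ r, Representation ℂ (Equiv.Perm (Fin n)) (W r)) :
    Representation ℂ (Equiv.Perm (Fin n)) (⨁ r : {r : Fin (n + 1) // Even (r : ℕ)}, W r) :=
  Representation.directSum fun r : {r : Fin (n + 1) // Even (r : ℕ)} => ρ r

/-- `Vh(n) = Vh_odd(n) ⊕ Vh_even(n)`. -/
def vhTotal (ρ : ∀ r, Representation ℂ (Equiv.Perm (Fin n)) (W r)) :=
  (vhOdd ρ).prod (vhEven ρ)

end Family

/-- All parts are powers of `2` (with `1 = 2 ^ 0` included). -/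
def PartsPowTwo {n : ℕ} (ν : n.Partition) : Prop := ∀ i ∈ ν.parts, ∃ a : ℕ, i = 2 ^ a

open Classical in
/-- The sum of `p_ν` over the partitions `ν` of `n` all of whose parts are powers of `2`. -/
def sumPowTwo (n : ℕ) : SymmFun :=
  ∑ ν : n.Partition with PartsPowTwo ν, powerSumPart ν

open Classical in
/-- The same sum restricted to the partitions with `n - ℓ(ν)` even. -/
def sumPowTwoEven (n : ℕ) : SymmFun :=
  ∑ ν : n.Partition with PartsPowTwo ν ∧ Even (n - ν.parts.card), powerSumPart ν

end

/-!
Put `H(ε) = ∑_m ε^m h_m[Lie^{(2)}]`. Induction of cyclic characters turns the coefficients of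
`Lie^{(2)}` into Ramanujan sums, and Newton's identities give `D H(ε) = S(ε) H(ε)` for the Euler
derivation `D` (which multiplies degree `n` by `n`), where `S(ε)` is explicit for `ε = ±1`.
Comparing with the solutions of this equation, which are determined by their constant terms, yields
`H(1) = ∏_a (1 - p_{2^a})⁻¹` and `H(-1) = 1 - p_1`: the first is the sum over all `r`, the second
the difference between even and odd `r`.

The plethysm `h_m[Lie^{(2)}]` is the characteristic of a polynomial functor, a symmetric power of
images of cyclic projectors on tensor powers, written as a multiplicative map on matrices. Its
restriction to permutation matrices and multilinear words is the module `Vh_r(n)`.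

Schur positivity holds for the characteristic of any module. By the bialternant formula the Schur
coefficients of a characteristic are integers. For an irreducible module their squares sum to `1`
and the leading one is positive, so the characteristic is a single Schur function.
-/

noncomputable section

/-! ### Cycle types and twisted traces -/

section CycleMonomial

open Equiv Equiv.Perm

variable {ι κ : Type*} [Fintype ι] [DecidableEq ι] [Fintype κ] [DecidableEq κ]

/-- The power sum product `p_{type σ}` of a permutation of an arbitrary finite type. -/
def cycleMonomial (σ : Perm ι) : SymmFun := powerSumPart σ.partition

theorem cycleMonomial_eq_prod_cycleType (σ : Perm ι) :
    cycleMonomial σ = (σ.cycleType.map fun k => (MvPolynomial.X k.toPNat' : SymmFun)).prod *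
      MvPolynomial.X 1 ^ (Fintype.card ι - σ.cycleType.sum) := by
  rw [cycleMonomial, powerSumPart, parts_partition, Multiset.map_add, Multiset.prod_add,
    Multiset.map_replicate, Multiset.prod_replicate, sum_cycleType]
  rfl

theorem cycleType_permCongr (e : ι ≃ κ) (σ : Perm ι) :
    (e.permCongr σ).cycleType = σ.cycleType := by
  have h : e.permCongr σ = σ.extendDomain (e.trans (Equiv.Set.univ κ).symm) := by
    ext x
    rw [extendDomain_apply_subtype _ _ (Set.mem_univ x)]
    simp
  rw [h, cycleType_extendDomain]

theorem cycleMonomial_permCongr (e : ι ≃ κ) (σ : Perm ι) :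
    cycleMonomial (e.permCongr σ) = cycleMonomial σ := by
  rw [cycleMonomial_eq_prod_cycleType, cycleMonomial_eq_prod_cycleType, cycleType_permCongr,
    Fintype.card_congr e]

theorem cycleType_sumCongr_one (σ : Perm ι) :
    (Perm.sumCongr σ (1 : Perm κ)).cycleType = σ.cycleType := by
  have h : Perm.sumCongr σ (1 : Perm κ) =
      σ.extendDomain (Equiv.ofInjective (Sum.inl : ι → ι ⊕ κ) Sum.inl_injective) := by
    ext x
    rcases x with x | x
    · exact (extendDomain_apply_image σ (Equiv.ofInjective Sum.inl Sum.inl_injective) x).symm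
    · rw [extendDomain_apply_not_subtype _ _ (by simp)]
      rfl
  rw [h, cycleType_extendDomain]

theorem cycleType_one_sumCongr (τ : Perm κ) :
    (Perm.sumCongr (1 : Perm ι) τ).cycleType = τ.cycleType := by
  have h : Perm.sumCongr (1 : Perm ι) τ = (sumComm κ ι).permCongr (Perm.sumCongr τ 1) := by
    ext (x | x) <;> simp
  rw [h, cycleType_permCongr, cycleType_sumCongr_one]

theorem cycleType_sumCongr (σ : Perm ι) (τ : Perm κ) :
    (Perm.sumCongr σ τ).cycleType = σ.cycleType + τ.cycleType := by
  have hmul : Perm.sumCongr σ τ = Perm.sumCongr σ 1 * Perm.sumCongr 1 τ := by simp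
  have hdisj : Disjoint (Perm.sumCongr σ (1 : Perm κ)) (Perm.sumCongr 1 τ) := by
    rintro (x | x) <;> simp
  rw [hmul, hdisj.cycleType_mul, cycleType_sumCongr_one, cycleType_one_sumCongr]

theorem cycleMonomial_sumCongr (σ : Perm ι) (τ : Perm κ) :
    cycleMonomial (Perm.sumCongr σ τ) = cycleMonomial σ * cycleMonomial τ := by
  have h : Fintype.card (ι ⊕ κ) - (σ.cycleType + τ.cycleType).sum =
      (Fintype.card ι - σ.cycleType.sum) + (Fintype.card κ - τ.cycleType.sum) := by
    have := sum_cycleType_le σ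
    have := sum_cycleType_le τ
    rw [Fintype.card_sum, Multiset.sum_add]
    omega
  simp only [cycleMonomial_eq_prod_cycleType]
  rw [cycleType_sumCongr, h, Multiset.map_add, Multiset.prod_add, pow_add]
  ring

theorem cycleMonomial_finRotate (n : ℕ) :
    cycleMonomial (finRotate (n + 1)) = MvPolynomial.X n.succPNat := by
  rcases n with _ | n
  · rw [cycleMonomial_eq_prod_cycleType,
      show finRotate (0 + 1) = 1 from (inferInstance : Subsingleton (Perm (Fin 1))).elim _ _]
    simp only [cycleType_one, Multiset.map_zero, Multiset.prod_zero, Multiset.sum_zero, one_mul]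
    exact pow_one _
  · rw [cycleMonomial_eq_prod_cycleType, cycleType_finRotate, Multiset.map_singleton,
      Multiset.prod_singleton, Multiset.sum_singleton, Fintype.card_fin, Nat.sub_self, pow_zero,
      mul_one]
    rfl

theorem cycleMonomial_of_isConj {σ τ : Perm ι} (h : IsConj σ τ) :
    cycleMonomial σ = cycleMonomial τ := by
  rw [cycleMonomial, cycleMonomial, partition_eq_of_isConj.mp h]

/-- The trace of `A ⊗ ⋯ ⊗ A` composed with the permutation `σ` of the tensor factors. -/
def twistedTrace {Ω R : Type*} [Fintype Ω] [CommSemiring R] (A : Matrix Ω Ω R) (σ : Perm ι) : R :=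
  ∑ f : ι → Ω, ∏ i, A (f i) (f (σ i))

section Trace

variable {Ω R : Type*} [Fintype Ω] [CommSemiring R] (A : Matrix Ω Ω R)

theorem twistedTrace_permCongr (e : ι ≃ κ) (σ : Perm ι) :
    twistedTrace A (e.permCongr σ) = twistedTrace A σ := by
  refine Fintype.sum_equiv (Equiv.arrowCongr e.symm (Equiv.refl Ω)) _ _ fun f => ?_
  exact Fintype.prod_equiv e.symm _ _ fun i => by simp

theorem twistedTrace_sumCongr (σ : Perm ι) (τ : Perm κ) :
    twistedTrace A (Perm.sumCongr σ τ) = twistedTrace A σ * twistedTrace A τ := by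
  rw [twistedTrace, twistedTrace, twistedTrace, Finset.sum_mul_sum, ← Finset.sum_product',
    Finset.univ_product_univ]
  refine Fintype.sum_equiv (Equiv.sumArrowEquivProdArrow ι κ Ω) _ _ fun f => ?_
  rw [Fintype.prod_sum_type]
  rfl

theorem sum_path_eq_pow_mulVec [DecidableEq Ω] (n : ℕ) (v : Ω → R) (x : Ω) :
    ∑ f : Fin (n + 1) → Ω, (if f 0 = x then 1 else 0) *
      ((∏ i : Fin n, A (f i.castSucc) (f i.succ)) * v (f (Fin.last n))) =
      ((A ^ n).mulVec v) x := by
  induction n generalizing x with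
  | zero =>
    rw [Fintype.sum_equiv (Equiv.funUnique (Fin 1) Ω) _
      (fun y => (if y = x then 1 else 0) * v y) (fun f => by simp)]
    simp
  | succ n ih =>
    rw [← (Fin.consEquiv fun _ => Ω).sum_comp, Fintype.sum_prod_type]
    have h : ∀ (y : Ω) (g : Fin (n + 1) → Ω),
        (if (Fin.consEquiv fun _ => Ω) (y, g) 0 = x then (1 : R) else 0) *
        ((∏ i : Fin (n + 1), A ((Fin.consEquiv fun _ => Ω) (y, g) i.castSucc)
          ((Fin.consEquiv fun _ => Ω) (y, g) i.succ)) *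
            v ((Fin.consEquiv fun _ => Ω) (y, g) (Fin.last (n + 1)))) =
        (if y = x then 1 else 0) * (A y (g 0) *
          ((∏ i : Fin n, A (g i.castSucc) (g i.succ)) * v (g (Fin.last n)))) := by
      intro y g
      rw [Fin.prod_univ_succ, ← Fin.succ_last]
      simp only [Fin.consEquiv_apply, Fin.cons_zero, Fin.cons_succ, Fin.castSucc_zero,
        ← Fin.succ_castSucc, mul_assoc]
    simp_rw [h, ← Finset.mul_sum, ite_mul, one_mul, zero_mul]
    rw [Finset.sum_ite_eq' Finset.univ x, if_pos (Finset.mem_univ x), pow_succ',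
      ← Matrix.mulVec_mulVec, Matrix.mulVec, dotProduct]
    simp_rw [← ih, Finset.mul_sum]
    rw [Finset.sum_comm]
    refine Finset.sum_congr rfl fun g _ => ?_
    simp

theorem twistedTrace_finRotate [DecidableEq Ω] (n : ℕ) :
    twistedTrace A (finRotate (n + 1)) = (A ^ (n + 1)).trace := by
  have h : ∀ x, (A ^ (n + 1)) x x = ((A ^ n).mulVec fun y => A y x) x := fun x => by
    rw [pow_succ]; rfl
  simp_rw [Matrix.trace, Matrix.diag, h, ← sum_path_eq_pow_mulVec, twistedTrace]
  rw [Finset.sum_comm]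
  refine Finset.sum_congr rfl fun f _ => ?_
  rw [Finset.sum_eq_single (f 0) (fun x _ hx => by rw [if_neg (Ne.symm hx), zero_mul])
    (fun h => absurd (Finset.mem_univ _) h), if_pos rfl, one_mul, Fin.prod_univ_castSucc,
    finRotate_last]
  congr 1
  refine Finset.prod_congr rfl fun i _ => ?_
  rw [finRotate_apply, Fin.coeSucc_eq_succ]

omit [Fintype ι] [DecidableEq ι] in
theorem exists_injective_semiconj_finRotate [Finite ι] (σ : Perm ι) (a : ι) :
    ∃ (n : ℕ) (g : Fin (n + 1) → ι), Function.Injective g ∧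
      Function.Semiconj g (finRotate (n + 1)) σ := by
  have hper : a ∈ Function.periodicPts σ := Function.mk_mem_periodicPts (orderOf_pos σ) <| by
    rw [Function.IsPeriodicPt, Function.IsFixedPt, ← coe_pow, pow_orderOf_eq_one, one_apply]
  obtain ⟨n, hn⟩ : ∃ n, Function.minimalPeriod σ a = n + 1 :=
    Nat.exists_eq_succ_of_ne_zero (Function.minimalPeriod_pos_of_mem_periodicPts hper).ne'
  have hlt (i : Fin (n + 1)) : (i : ℕ) ∈ Set.Iio (Function.minimalPeriod σ a) :=
    hn.symm ▸ i.isLt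
  refine ⟨n, fun i => σ^[i] a, fun i j hij =>
    Fin.ext (Function.iterate_injOn_Iio_minimalPeriod (hlt i) (hlt j) hij), fun i => ?_⟩
  change σ^[(finRotate (n + 1) i : ℕ)] a = σ (σ^[(i : ℕ)] a)
  rw [← Function.iterate_succ_apply' σ, ← Function.iterate_mod_minimalPeriod_eq (n := _ + 1), hn,
    finRotate_apply, Fin.val_add, Fin.val_one', Nat.add_mod_mod]

omit [Fintype ι] [DecidableEq ι] [Fintype κ] [DecidableEq κ] in
theorem permCongr_sumCongr_subtypePerm (ρ : Perm κ) (σ : Perm ι) {g : κ → ι}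
    (hg : Function.Semiconj g ρ σ) (hσ : ∀ x, σ x ∉ Set.range g ↔ x ∉ Set.range g)
    (hbij : Function.Bijective (Sum.elim g (Subtype.val : {x // x ∉ Set.range g} → ι))) :
    (Equiv.ofBijective _ hbij).permCongr (Perm.sumCongr ρ (σ.subtypePerm hσ)) = σ := by
  ext x
  obtain ⟨z, rfl⟩ := (Equiv.ofBijective _ hbij).surjective x
  rw [permCongr_apply, Equiv.symm_apply_apply]
  rcases z with i | y
  · exact hg i
  · rfl

omit [Fintype ι] [DecidableEq ι] in
theorem exists_permCongr_eq_sumCongr_finRotate [Finite ι] [Nonempty ι] (σ : Perm ι) :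
    ∃ (p : ι → Prop) (n : ℕ) (τ : Perm {x // p x}) (e : Fin (n + 1) ⊕ {x // p x} ≃ ι),
      e.permCongr (Perm.sumCongr (finRotate (n + 1)) τ) = σ := by
  obtain ⟨n, g, hinj, hg⟩ := exists_injective_semiconj_finRotate σ (Classical.arbitrary ι)
  have hσ (x : ι) : σ x ∉ Set.range g ↔ x ∉ Set.range g := by
    refine not_congr ⟨?_, ?_⟩
    · rintro ⟨i, hi⟩
      exact ⟨(finRotate (n + 1)).symm i, σ.injective (by rw [← hg, apply_symm_apply, hi])⟩
    · rintro ⟨i, rfl⟩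
      exact ⟨_, hg i⟩
  have hbij : Function.Bijective (Sum.elim g (Subtype.val : {x // x ∉ Set.range g} → ι)) := by
    refine ⟨hinj.sumElim Subtype.val_injective fun i x h => x.2 ⟨i, h⟩, fun x => ?_⟩
    by_cases hx : x ∈ Set.range g
    · obtain ⟨i, rfl⟩ := hx
      exact ⟨Sum.inl i, rfl⟩
    · exact ⟨Sum.inr ⟨x, hx⟩, rfl⟩
  exact ⟨fun x => x ∉ Set.range g, n, σ.subtypePerm hσ, Equiv.ofBijective _ hbij,
    permCongr_sumCongr_subtypePerm _ σ hg hσ hbij⟩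

theorem twistedTrace_eq_aeval_cycleMonomial [DecidableEq Ω] [Algebra ℂ R] (σ : Perm ι) :
    twistedTrace A σ =
      MvPolynomial.aeval (fun k : ℕ+ => (A ^ (k : ℕ)).trace) (cycleMonomial σ) := by
  induction hN : Fintype.card ι using Nat.strong_induction_on generalizing ι with
  | _ N ih =>
    classical
    rcases isEmpty_or_nonempty ι with hι | hι
    · rw [cycleMonomial_eq_prod_cycleType, twistedTrace]
      simp [Subsingleton.elim σ 1]
    · obtain ⟨p, n, τ, e, rfl⟩ := exists_permCongr_eq_sumCongr_finRotate σ
      have hcard := Fintype.card_congr e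
      rw [Fintype.card_sum, Fintype.card_fin] at hcard
      rw [twistedTrace_permCongr, cycleMonomial_permCongr, twistedTrace_sumCongr,
        cycleMonomial_sumCongr, map_mul, twistedTrace_finRotate, cycleMonomial_finRotate,
        ih (Fintype.card {x // p x}) (by omega) τ rfl, MvPolynomial.aeval_X, Nat.succPNat_coe]

end Trace

end CycleMonomial

section PartExp

/-- The degree of a monomial in the power sums, where `p_k` has degree `k`. -/
abbrev psDegree : (ℕ+ →₀ ℕ) →+ ℕ := Finsupp.weight fun k : ℕ+ => (k : ℕ)

/-- The exponent of the monomial `p_ν`. -/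
def partExp {n : ℕ} (ν : n.Partition) : ℕ+ →₀ ℕ :=
  Multiset.toFinsupp (ν.parts.map Nat.toPNat')

theorem powerSumPart_eq_monomial {n : ℕ} (ν : n.Partition) :
    powerSumPart ν = MvPolynomial.monomial (partExp ν) 1 := by
  have h : ∀ s : Multiset ℕ+, (s.map fun k => (MvPolynomial.X k : SymmFun)).prod =
      MvPolynomial.monomial (Multiset.toFinsupp s) 1 := by
    intro s
    induction s using Multiset.induction_on with
    | empty => simp
    | cons a s ih =>
      rw [Multiset.map_cons, Multiset.prod_cons, ih, ← Multiset.singleton_add, map_add,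
        Multiset.toFinsupp_singleton, MvPolynomial.X, MvPolynomial.monomial_mul, one_mul]
  rw [powerSumPart, partExp, ← h, Multiset.map_map]
  rfl

theorem partExp_apply {n : ℕ} (ν : n.Partition) (k : ℕ+) :
    partExp ν k = ν.parts.count (k : ℕ) := by
  rw [partExp, Multiset.toFinsupp_apply, ← Multiset.count_map_eq_count' _ _ PNat.coe_injective,
    Multiset.map_map]
  congr 1
  conv_rhs => rw [← Multiset.map_id ν.parts]
  refine Multiset.map_congr rfl fun x hx => ?_
  simp [Nat.toPNat'_coe, ν.parts_pos hx]

theorem partExp_injective {n : ℕ} : Function.Injective (partExp : n.Partition → ℕ+ →₀ ℕ) := by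
  intro ν μ h
  refine Nat.Partition.ext (Multiset.ext.mpr fun a => ?_)
  rcases Nat.eq_zero_or_pos a with rfl | ha
  · rw [Multiset.count_eq_zero_of_notMem fun h => (ν.parts_pos h).ne rfl,
      Multiset.count_eq_zero_of_notMem fun h => (μ.parts_pos h).ne rfl]
  · obtain ⟨k, rfl⟩ : ∃ k : ℕ+, (k : ℕ) = a := ⟨⟨a, ha⟩, rfl⟩
    rw [← partExp_apply, ← partExp_apply, h]

theorem psDegree_toFinsupp (s : Multiset ℕ+) :
    psDegree (Multiset.toFinsupp s) = (s.map fun k : ℕ+ => (k : ℕ)).sum := by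
  induction s using Multiset.induction_on with
  | empty => simp
  | cons a s ih =>
    rw [← Multiset.singleton_add, map_add, map_add, ih, Multiset.toFinsupp_singleton,
      Finsupp.weight_single]
    simp

theorem psDegree_eq_zero_iff {w : ℕ+ →₀ ℕ} : psDegree w = 0 ↔ w = 0 := by
  refine ⟨fun h => Finsupp.ext fun k => ?_, fun h => by rw [h, map_zero]⟩
  exact Nat.le_zero.mp (h ▸ Finsupp.le_weight (fun k : ℕ+ => (k : ℕ)) k.pos.ne' w)

theorem psDegree_eq_sum_range {w : ℕ+ →₀ ℕ} {n : ℕ} (hw : psDegree w ≤ n) :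
    psDegree w = ∑ i ∈ Finset.range n, w i.succPNat * (i + 1) := by
  rw [psDegree, Finsupp.weight_apply, Finsupp.sum]
  refine Finset.sum_of_injOn PNat.natPred PNat.natPred_injective.injOn (fun k hk => ?_)
    (fun i _ hi => ?_) (fun k _ => by simp)
  · have hk' : (k : ℕ) ≤ psDegree w :=
      Finsupp.le_weight_of_ne_zero' _ (Finsupp.mem_support_iff.mp hk)
    have := PNat.natPred_add_one k
    rw [Finset.mem_coe, Finset.mem_range]
    omega
  · have hwi : w i.succPNat = 0 := Finsupp.notMem_support_iff.mp fun h =>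
      hi ⟨i.succPNat, h, Nat.natPred_succPNat i⟩
    rw [hwi, zero_mul]

theorem psDegree_partExp {n : ℕ} (ν : n.Partition) :
    psDegree (partExp ν) = n := by
  rw [partExp, psDegree_toFinsupp, Multiset.map_map]
  conv_rhs => rw [← ν.parts_sum, ← Multiset.map_id ν.parts]
  congr 1
  refine Multiset.map_congr rfl fun x hx => ?_
  simp [Nat.toPNat'_coe, ν.parts_pos hx]

theorem exists_partExp_eq {n : ℕ} {m : ℕ+ →₀ ℕ}
    (hm : psDegree m = n) : ∃ ν : n.Partition, partExp ν = m := by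
  refine ⟨⟨(Finsupp.toMultiset m).map fun k : ℕ+ => (k : ℕ), ?_, ?_⟩, ?_⟩
  · intro i hi
    obtain ⟨k, -, rfl⟩ := Multiset.mem_map.mp hi
    exact k.pos
  · rw [← psDegree_toFinsupp, Finsupp.toMultiset_toFinsupp, hm]
  · ext k
    rw [partExp_apply]
    change Multiset.count (k : ℕ) (Multiset.map _ _) = _
    rw [Multiset.count_map_eq_count' _ _ PNat.coe_injective, Finsupp.count_toMultiset]

end PartExp

/-! ### Frobenius characteristics of class functions -/

section ClassFunction

open Equiv

/-- The Frobenius characteristic `(1/n!) ∑_σ φ(σ) p_{type σ}` of an arbitrary function `φ` on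
`S_n`, so that it can be applied to characters without naming a representation. -/
def charSum {n : ℕ} (φ : Perm (Fin n) → ℂ) : SymmFun :=
  ((n.factorial : ℂ)⁻¹) • ∑ σ, φ σ • cycleMonomial σ

theorem frobeniusChar_eq_charSum {n : ℕ} {W : Type*} [AddCommGroup W] [Module ℂ W]
    (ρ : Representation ℂ (Perm (Fin n)) W) : frobeniusChar ρ = charSum ρ.character := rfl

theorem charSum_add {n : ℕ} (φ ψ : Perm (Fin n) → ℂ) :
    charSum (φ + ψ) = charSum φ + charSum ψ := by
  simp [charSum, add_smul, Finset.sum_add_distrib]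

theorem charSum_smul {n : ℕ} (c : ℂ) (φ : Perm (Fin n) → ℂ) :
    charSum (fun σ => c * φ σ) = c • charSum φ := by
  simp_rw [charSum, mul_smul, ← Finset.smul_sum]
  rw [smul_comm]

theorem charSum_sum {n : ℕ} {ι : Type*} (s : Finset ι) (φ : ι → Perm (Fin n) → ℂ) :
    charSum (fun σ => ∑ i ∈ s, φ i σ) = ∑ i ∈ s, charSum (φ i) := by
  simp only [charSum, Finset.sum_smul, Finset.smul_sum]
  rw [Finset.sum_comm]

theorem coeff_cycleMonomial {n : ℕ} (σ τ : Perm (Fin n)) :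
    MvPolynomial.coeff (partExp τ.partition) (cycleMonomial σ) =
      open Classical in if IsConj σ τ then 1 else 0 := by
  classical
  rw [cycleMonomial, powerSumPart_eq_monomial, MvPolynomial.coeff_monomial]
  simp only [partExp_injective.eq_iff, Perm.partition_eq_of_isConj]

theorem coeff_charSum_partExp {n : ℕ} {φ : Perm (Fin n) → ℂ}
    (hφ : ∀ σ τ, IsConj σ τ → φ σ = φ τ) (τ : Perm (Fin n)) :
    MvPolynomial.coeff (partExp τ.partition) (charSum φ) =
      (n.factorial : ℂ)⁻¹ *
        (open Classical in ((Finset.univ.filter fun σ => IsConj σ τ).card : ℂ) * φ τ) := by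
  classical
  rw [charSum, MvPolynomial.coeff_smul, MvPolynomial.coeff_sum, smul_eq_mul]
  simp_rw [MvPolynomial.coeff_smul, coeff_cycleMonomial, smul_eq_mul, mul_ite, mul_one, mul_zero]
  rw [← Finset.sum_filter, ← nsmul_eq_mul, ← Finset.sum_const]
  congr 1
  exact Finset.sum_congr rfl fun σ hσ => hφ _ _ (Finset.mem_filter.mp hσ).2

theorem charSum_injective {n : ℕ} {φ ψ : Perm (Fin n) → ℂ}
    (hφ : ∀ σ τ, IsConj σ τ → φ σ = φ τ) (hψ : ∀ σ τ, IsConj σ τ → ψ σ = ψ τ)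
    (h : charSum φ = charSum ψ) : φ = ψ := by
  classical
  ext τ
  have hcoeff := congrArg (MvPolynomial.coeff (partExp τ.partition)) h
  rw [coeff_charSum_partExp hφ, coeff_charSum_partExp hψ] at hcoeff
  have hcard : ((Finset.univ.filter fun σ => IsConj σ τ).card : ℂ) ≠ 0 :=
    Nat.cast_ne_zero.mpr (Finset.card_ne_zero_of_mem
      (Finset.mem_filter.mpr ⟨Finset.mem_univ τ, IsConj.refl τ⟩))
  exact mul_left_cancel₀ hcard
    (mul_left_cancel₀ (inv_ne_zero (Nat.cast_ne_zero.mpr n.factorial_ne_zero)) hcoeff)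

theorem character_eq_of_isConj {G k W : Type*} [Group G] [Field k] [AddCommGroup W] [Module k W]
    (ρ : Representation k G W) (σ τ : G) (h : IsConj σ τ) :
    ρ.character σ = ρ.character τ := by
  obtain ⟨c, rfl⟩ := isConj_iff.mp h
  exact (ρ.char_conj σ c).symm

theorem character_perm_inv {ι k W : Type*} [Finite ι] [Field k] [AddCommGroup W] [Module k W]
    (ρ : Representation k (Perm ι) W) (σ : Perm ι) : ρ.character σ⁻¹ = ρ.character σ := by
  classical
  have := Fintype.ofFinite ι
  exact character_eq_of_isConj ρ _ _ (Perm.isConj_iff_cycleType_eq.mpr (Perm.cycleType_inv σ))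

end ClassFunction

/-! ### Characters of sums, coinvariants and induced representations -/

section Operations

theorem trace_lmap {R ι : Type*} [CommRing R] [Fintype ι] {V : ι → Type*}
    [∀ i, AddCommGroup (V i)] [∀ i, Module R (V i)] [∀ i, Module.Free R (V i)]
    [∀ i, Module.Finite R (V i)] (f : ∀ i, V i →ₗ[R] V i) :
    LinearMap.trace R (⨁ i, V i) (DirectSum.lmap f) = ∑ i, LinearMap.trace R (V i) (f i) := by
  classical
  have : Module.Finite R (⨁ i, V i) :=
    Module.Finite.equiv (DirectSum.linearEquivFunOnFintype R ι V).symm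
  have hsum : DirectSum.lmap f =
      ∑ i, DirectSum.lof R ι V i ∘ₗ (f i ∘ₗ DirectSum.component R ι V i) := by
    ext i x j
    simp only [LinearMap.coe_comp, Function.comp_apply, DirectSum.lmap_lof, LinearMap.coe_sum,
      Finset.sum_apply]
    rw [Finset.sum_eq_single_of_mem i (Finset.mem_univ i) fun b _ hb => by
        rw [DirectSum.component.of, dif_neg (Ne.symm hb), map_zero, map_zero],
      DirectSum.component.lof_self]
  rw [hsum, map_sum]
  refine Finset.sum_congr rfl fun i _ => ?_
  rw [LinearMap.trace_comp_comm', LinearMap.comp_assoc]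
  congr 1
  ext x
  simp

variable {G k W W' : Type*} [Group G] [Field k] [AddCommGroup W] [Module k W] [AddCommGroup W']
  [Module k W'] [FiniteDimensional k W] [FiniteDimensional k W']

theorem character_prod (ρ : Representation k G W) (ρ' : Representation k G W') :
    (ρ.prod ρ').character = ρ.character + ρ'.character :=
  funext fun g => LinearMap.trace_prodMap' (ρ g) (ρ' g)

theorem character_directSum {ι : Type*} [Fintype ι] {V : ι → Type*}
    [∀ i, AddCommGroup (V i)] [∀ i, Module k (V i)] [∀ i, FiniteDimensional k (V i)]
    (ρ : ∀ i, Representation k G (V i)) :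
    (Representation.directSum ρ).character = fun g => ∑ i, (ρ i).character g :=
  funext fun g => trace_lmap fun i => ρ i g

theorem character_linearCharRep (χ : G →* ℂ) (g : G) :
    (linearCharRep χ).character g = χ g := by
  change LinearMap.trace ℂ ℂ (χ g • LinearMap.id) = _
  simp

-- The averaging projection factors through the coinvariants as a section of the quotient map.
theorem trace_coinvariants_map [Fintype G] [NeZero (Fintype.card G : k)] (ρ : Representation k G W)
    (f : ρ.IntertwiningMap ρ) :
    LinearMap.trace k ρ.Coinvariants (Representation.Coinvariants.map ρ ρ f) =
      (Fintype.card G : k)⁻¹ * ∑ g, LinearMap.trace k W (f.toLinearMap ∘ₗ ρ g) := by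
  set P : W →ₗ[k] W := (Fintype.card G : k)⁻¹ • ∑ g, ρ g with hP
  have hPρ : ∀ g, P ∘ₗ ρ g = P := fun g => by
    rw [hP, LinearMap.smul_comp, ← Module.End.mul_eq_comp, Finset.sum_mul]
    congr 1
    exact Fintype.sum_equiv (Equiv.mulRight g) _ _ fun h => by simp
  let s := Representation.Coinvariants.lift ρ P hPρ
  have hmkP : Representation.Coinvariants.mk ρ ∘ₗ P = Representation.Coinvariants.mk ρ := by
    ext x
    simp [hP, ← Nat.cast_smul_eq_nsmul k, smul_smul, NeZero.ne (Fintype.card G : k)]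
  have hs : Representation.Coinvariants.mk ρ ∘ₗ s = LinearMap.id := by
    apply Representation.Coinvariants.hom_ext
    rw [LinearMap.comp_assoc, Representation.Coinvariants.lift_comp_mk, hmkP, LinearMap.id_comp]
  have hmap : Representation.Coinvariants.map ρ ρ f =
      Representation.Coinvariants.mk ρ ∘ₗ (f.toLinearMap ∘ₗ s) := by
    conv_lhs => rw [← LinearMap.comp_id (Representation.Coinvariants.map ρ ρ f), ← hs]
    rfl
  rw [hmap, LinearMap.trace_comp_comm', LinearMap.comp_assoc,
    Representation.Coinvariants.lift_comp_mk, hP, LinearMap.comp_smul, ← Module.End.mul_eq_comp,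
    Finset.mul_sum, map_smul, map_sum, smul_eq_mul]
  rfl

end Operations

section Induced

theorem trace_mapDomainLinearMap {R G : Type*} [CommRing R] [Fintype G]
    [DecidableEq G] (f : G → G) :
    LinearMap.trace R (MonoidAlgebra R G) (MonoidAlgebra.mapDomainLinearMap R R f) =
      ((Finset.univ.filter fun x => f x = x).card : R) := by
  rw [LinearMap.trace_eq_matrix_trace R (MonoidAlgebra.basis G R), Matrix.trace]
  simp [LinearMap.toMatrix_apply, MonoidAlgebra.basis, Finsupp.single_apply,
    MonoidAlgebra.mapDomainLinearMap_single]

theorem character_ind {G H k W : Type*} [Group G] [Group H] [Fintype G] [DecidableEq G]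
    [Fintype H] [Field k] [NeZero (Fintype.card H : k)] [AddCommGroup W] [Module k W]
    [FiniteDimensional k W] (φ : H →* G) (ρ : Representation k H W) (g : G) :
    (Representation.ind φ ρ).character g =
      (Fintype.card H : k)⁻¹ * ∑ h, ((Finset.univ.filter fun x => x * g * x⁻¹ = φ h).card : k) *
        ρ.character h := by
  have : FiniteDimensional k (MonoidAlgebra k G) :=
    (MonoidAlgebra.basis G k).finiteDimensional_of_finite
  refine (trace_coinvariants_map _ _).trans ?_
  congr 1
  refine Finset.sum_congr rfl fun h _ => ?_
  have hmap : ((MonoidAlgebra.mapDomainLinearMap k k fun x => x * g⁻¹).rTensor W) ∘ₗ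
      (Representation.tprod ((Representation.leftRegular k G).comp φ) ρ) h =
      TensorProduct.map (MonoidAlgebra.mapDomainLinearMap k k fun x => φ h * x * g⁻¹) (ρ h) := by
    ext x w
    simp
  refine (congrArg (LinearMap.trace k _) hmap).trans ?_
  rw [LinearMap.trace_tensorProduct', trace_mapDomainLinearMap]
  congr 3
  ext x
  simp only [Finset.mem_filter, Finset.mem_univ, true_and]
  rw [mul_inv_eq_iff_eq_mul, eq_comm, mul_inv_eq_iff_eq_mul]

theorem sum_card_conj_smul_of_class_function {G k M : Type*} [Group G] [Fintype G] [DecidableEq G]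
    [Semiring k] [AddCommMonoid M] [Module k M] (F : G → M)
    (hF : ∀ σ τ, IsConj σ τ → F σ = F τ) (τ : G) :
    ∑ σ, ((Finset.univ.filter fun x => x * σ * x⁻¹ = τ).card : k) • F σ =
      (Fintype.card G : k) • F τ := by
  simp_rw [Finset.card_filter, Nat.cast_sum, Finset.sum_smul]
  rw [Finset.sum_comm]
  have hconj (x : G) : ∑ σ, ((if x * σ * x⁻¹ = τ then 1 else 0 : ℕ) : k) • F σ = F τ := by
    rw [Finset.sum_eq_single_of_mem (x⁻¹ * τ * x) (Finset.mem_univ _) fun σ _ hσ => by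
      rw [if_neg fun h => hσ (by rw [← h]; group), Nat.cast_zero, zero_smul]]
    rw [if_pos (by group), Nat.cast_one, one_smul]
    exact hF _ _ (isConj_iff.mpr ⟨x, by group⟩)
  simp_rw [hconj]
  rw [Finset.sum_const, Finset.card_univ, Nat.cast_smul_eq_nsmul]

theorem frobeniusChar_ind {H W : Type*} [Group H] [Fintype H] [AddCommGroup W] [Module ℂ W]
    [FiniteDimensional ℂ W] {n : ℕ} (φ : H →* Equiv.Perm (Fin n)) (ρ : Representation ℂ H W) :
    frobeniusChar (Representation.ind φ ρ) =
      (Fintype.card H : ℂ)⁻¹ • ∑ h, ρ.character h • cycleMonomial (φ h) := by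
  classical
  have hfact : (n.factorial : ℂ) ≠ 0 := Nat.cast_ne_zero.mpr n.factorial_ne_zero
  have hterm (h : H) : ∑ σ, (((Finset.univ.filter fun x => x * σ * x⁻¹ = φ h).card : ℂ) *
      ρ.character h) • cycleMonomial σ =
      (n.factorial : ℂ) • ρ.character h • cycleMonomial (φ h) := by
    have hcard : Fintype.card (Equiv.Perm (Fin n)) = n.factorial := by
      rw [Fintype.card_perm, Fintype.card_fin]
    simp_rw [mul_comm _ (ρ.character h), mul_smul]
    rw [← Finset.smul_sum,
      sum_card_conj_smul_of_class_function _ (fun _ _ => cycleMonomial_of_isConj), hcard, smul_comm]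
  rw [frobeniusChar_eq_charSum, charSum]
  simp_rw [character_ind, mul_smul, Finset.sum_smul]
  rw [← Finset.smul_sum, Finset.sum_comm]
  simp_rw [hterm]
  rw [← Finset.smul_sum, smul_comm, inv_smul_smul₀ hfact]

end Induced

/-! ### Representations of finite groups are determined by their characters -/

section CharacterEquiv

open Representation

variable {G k V W : Type*} [Group G] [Field k] [AddCommGroup V] [Module k V] [AddCommGroup W]
  [Module k W] {ρ : Representation k G V} {σ : Representation k G W}

theorem isCompl_toSubmodule_of_isCompl {U U' : Subrepresentation ρ} (h : IsCompl U U') :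
    IsCompl U.toSubmodule U'.toSubmodule := by
  refine IsCompl.of_eq ?_ ?_
  · rw [← Subrepresentation.toSubmodule_inf, h.inf_eq_bot]
    rfl
  · rw [← Subrepresentation.toSubmodule_sup, h.sup_eq_top]
    rfl

theorem nonempty_prod_equiv_of_isCompl {U U' : Subrepresentation ρ} (h : IsCompl U U') :
    Nonempty ((U.toRepresentation.prod U'.toRepresentation).Equiv ρ) :=
  ⟨Representation.Equiv.mk
    (Submodule.prodEquivOfIsCompl _ _ (isCompl_toSubmodule_of_isCompl h)) fun g => by
      refine LinearMap.ext fun x => ?_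
      simp [Subrepresentation.toRepresentation]⟩

theorem nonempty_prod_equiv_prod {V' W' : Type*} [AddCommGroup V'] [Module k V'] [AddCommGroup W']
    [Module k W'] {ρ' : Representation k G V'} {σ' : Representation k G W'} (e : ρ.Equiv σ)
    (e' : ρ'.Equiv σ') : Nonempty ((ρ.prod ρ').Equiv (σ.prod σ')) :=
  ⟨Representation.Equiv.mk (e.toLinearEquiv.prodCongr e'.toLinearEquiv) fun g => by
    refine LinearMap.ext fun x => Prod.ext ?_ ?_
    · exact e.toIntertwiningMap.isIntertwining _ _ g x.1
    · exact e'.toIntertwiningMap.isIntertwining _ _ g x.2⟩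

theorem nonempty_equiv_range {f : IntertwiningMap ρ σ} (hf : Function.Injective f) :
    Nonempty (ρ.Equiv f.range.toRepresentation) :=
  ⟨Representation.Equiv.mk (LinearEquiv.ofInjective f.toLinearMap hf) fun g =>
    LinearMap.ext fun x => Subtype.ext (f.isIntertwining _ _ g x)⟩

theorem nontrivial_of_isIrreducible (hρ : IsIrreducible ρ) : Nontrivial V := by
  obtain ⟨a, b, hab⟩ := hρ.exists_pair_ne
  refine not_subsingleton_iff_nontrivial.mp fun _ => ?_
  exact hab (Subrepresentation.toSubmodule_injective (Subsingleton.elim _ _))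

theorem isIrreducible_toRepresentation_of_isAtom {U : Subrepresentation ρ} (hU : IsAtom U) :
    IsIrreducible U.toRepresentation := by
  have hmap := Submodule.map_injective_of_injective U.toSubmodule.injective_subtype
  refine { exists_pair_ne := ⟨⊥, ⊤, fun h => hU.1 ?_⟩, eq_bot_or_eq_top := fun S => ?_ }
  · refine Subrepresentation.toSubmodule_injective ?_
    have h' := congrArg (Submodule.map U.toSubmodule.subtype)
      (congrArg Subrepresentation.toSubmodule h)
    exact (Submodule.map_subtype_top _).symm.trans (h'.symm.trans (Submodule.map_bot _))
  · let T : Subrepresentation ρ := ⟨S.toSubmodule.map U.toSubmodule.subtype, by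
      rintro g _ ⟨x, hx, rfl⟩
      exact ⟨_, S.apply_mem_toSubmodule g hx, rfl⟩⟩
    have hTU : T ≤ U := by
      rintro _ ⟨x, -, rfl⟩
      exact x.2
    refine (hU.le_iff.mp hTU).imp (fun h => ?_) (fun h => ?_) <;>
      refine Subrepresentation.toSubmodule_injective (hmap ?_)
    · exact (congrArg Subrepresentation.toSubmodule h).trans (Submodule.map_bot _).symm
    · exact (congrArg Subrepresentation.toSubmodule h).trans (Submodule.map_subtype_top _).symm

theorem exists_isIrreducible_isCompl [Finite G] [NeZero (Nat.card G : k)] [FiniteDimensional k V]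
    [Nontrivial V] (ρ : Representation k G V) :
    ∃ U U' : Subrepresentation ρ, IsIrreducible U.toRepresentation ∧ IsCompl U U' := by
  have hmono : StrictMono (Subrepresentation.toSubmodule : Subrepresentation ρ → Submodule k V) :=
    fun a b h => h
  have : WellFoundedLT (Subrepresentation ρ) := hmono.wellFoundedLT
  have : IsAtomic (Subrepresentation ρ) := isAtomic_of_orderBot_wellFounded_lt this.wf
  have hne : (⊤ : Subrepresentation ρ) ≠ ⊥ := fun h =>
    top_ne_bot (α := Submodule k V) (congrArg Subrepresentation.toSubmodule h)
  obtain ⟨U, hU, -⟩ :=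
    (IsAtomic.eq_bot_or_exists_atom_le (⊤ : Subrepresentation ρ)).resolve_left hne
  obtain ⟨U', hU'⟩ := exists_isCompl U
  exact ⟨U, U', isIrreducible_toRepresentation_of_isAtom hU, hU'⟩

theorem finrank_eq_of_character_eq [CharZero k] [FiniteDimensional k V] [FiniteDimensional k W]
    (h : ρ.character = σ.character) :
    Module.finrank k V = Module.finrank k W := by
  have hone := congrFun h 1
  rw [char_one, char_one] at hone
  exact_mod_cast hone

theorem exists_intertwiningMap_ne_zero_of_character_eq [Finite G] [CharZero k]
    [FiniteDimensional k V] [FiniteDimensional k W] {U : Type*} [AddCommGroup U] [Module k U]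
    [FiniteDimensional k U] {τ : Representation k G U} (h : ρ.character = σ.character)
    {f : IntertwiningMap τ ρ} (hf : f ≠ 0) : ∃ f' : IntertwiningMap τ σ, f' ≠ 0 := by
  have := Fintype.ofFinite G
  have : Invertible (Nat.card G : k) :=
    invertibleOfNonzero (Nat.cast_ne_zero.mpr Nat.card_pos.ne')
  have hdim : (Module.finrank k (IntertwiningMap τ ρ) : k) =
      Module.finrank k (IntertwiningMap τ σ) := by
    rw [← card_inv_mul_sum_char_mul_char_eq_finrank, ← card_inv_mul_sum_char_mul_char_eq_finrank, h]
  have : Nontrivial (IntertwiningMap τ ρ) := ⟨f, 0, hf⟩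
  have : Module.Finite k (IntertwiningMap τ ρ) :=
    Module.Finite.equiv (invariantsEquivIntertwiningMap τ ρ)
  have hpos : 0 < Module.finrank k (IntertwiningMap τ ρ) := Module.finrank_pos
  rw [Nat.cast_inj.mp hdim] at hpos
  have := Module.nontrivial_of_finrank_pos hpos
  exact exists_ne 0

-- Split off an irreducible summand of `ρ`; it embeds in `σ`, and the complements have equal
-- characters.
theorem nonempty_equiv_of_character_eq [Finite G] [CharZero k] [FiniteDimensional k V]
    [FiniteDimensional k W] (ρ : Representation k G V) (σ : Representation k G W)
    (h : ρ.character = σ.character) : Nonempty (ρ.Equiv σ) := by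
  induction hn : Module.finrank k V using Nat.strong_induction_on generalizing V W with
  | _ n ih =>
    rcases subsingleton_or_nontrivial V with hV | hV
    · have : Subsingleton W := by
        rwa [← Module.finrank_zero_iff (R := k), ← finrank_eq_of_character_eq h,
          Module.finrank_zero_iff]
      exact ⟨Representation.Equiv.mk 0 fun g => Subsingleton.elim _ _⟩
    · have : NeZero (Nat.card G : k) := ⟨Nat.cast_ne_zero.mpr Nat.card_pos.ne'⟩
      obtain ⟨U, U', hU, hUU'⟩ := exists_isIrreducible_isCompl ρ
      have := nontrivial_of_isIrreducible hU
      have hinc : (⟨U.toSubmodule.subtype, fun g => rfl⟩ :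
          IntertwiningMap U.toRepresentation ρ) ≠ 0 := fun h0 => by
        obtain ⟨x, hx⟩ := exists_ne (0 : U.toSubmodule)
        exact hx (Subtype.ext (congrArg (fun f : IntertwiningMap _ ρ => f x) h0))
      obtain ⟨f, hf⟩ := exists_intertwiningMap_ne_zero_of_character_eq h hinc
      obtain ⟨R', hR'⟩ := exists_isCompl f.range
      obtain ⟨eU⟩ := nonempty_equiv_range ((IsIrreducible.injective_or_eq_zero f).resolve_right hf)
      obtain ⟨eV⟩ := nonempty_prod_equiv_of_isCompl hUU'
      obtain ⟨eW⟩ := nonempty_prod_equiv_of_isCompl hR'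
      have hchar : U'.toRepresentation.character = R'.toRepresentation.character := by
        have hsum := (char_iso eV).trans (h.trans (char_iso eW).symm)
        rw [character_prod, character_prod, char_iso eU] at hsum
        exact add_left_cancel hsum
      have hlt : Module.finrank k U'.toSubmodule < n := by
        have hVdim := eV.toLinearEquiv.finrank_eq
        rw [Module.finrank_prod] at hVdim
        have hUdim : 0 < Module.finrank k U.toSubmodule := Module.finrank_pos
        omega
      obtain ⟨eU'⟩ := ih _ hlt U'.toRepresentation R'.toRepresentation hchar rfl
      obtain ⟨e⟩ := nonempty_prod_equiv_prod eU eU'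
      exact ⟨eV.symm.trans (e.trans eW)⟩

theorem nonempty_equiv_of_frobeniusChar_eq {n : ℕ} {V W : Type*} [AddCommGroup V] [Module ℂ V]
    [AddCommGroup W] [Module ℂ W] [FiniteDimensional ℂ V] [FiniteDimensional ℂ W]
    (ρ : Representation ℂ (Equiv.Perm (Fin n)) V) (σ : Representation ℂ (Equiv.Perm (Fin n)) W)
    (h : frobeniusChar ρ = frobeniusChar σ) : Nonempty (ρ.Equiv σ) :=
  nonempty_equiv_of_character_eq ρ σ
    (charSum_injective (character_eq_of_isConj ρ) (character_eq_of_isConj σ) h)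

end CharacterEquiv

/-! ### The complete homogeneous symmetric functions -/

open Finset.HasAntidiagonal (antidiagonal)

section CompleteHomog

open Equiv

/-- The order `z_ν = ∏ k^{m_k} m_k!` of the centralizer of a permutation of cycle type `ν`, where
`m_k` is the multiplicity of `k` in `ν`. -/
def zFactor (w : ℕ+ →₀ ℕ) : ℕ := w.prod fun k e => (k : ℕ) ^ e * e.factorial

theorem zFactor_pos (w : ℕ+ →₀ ℕ) : 0 < zFactor w :=
  Finset.prod_pos fun k _ => Nat.mul_pos (pow_pos k.pos _) (Nat.factorial_pos _)

theorem zFactor_add_single (w : ℕ+ →₀ ℕ) (k : ℕ+) :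
    zFactor (w + Finsupp.single k 1) = zFactor w * (k * (w k + 1)) := by
  rw [zFactor, zFactor, ← Finsupp.mul_prod_erase' w k _ fun i => by simp,
    ← Finsupp.mul_prod_erase' (w + Finsupp.single k 1) k _ fun i => by simp, Finsupp.erase_add,
    Finsupp.erase_single, add_zero, Finsupp.add_apply, Finsupp.single_eq_same, pow_succ,
    Nat.factorial_succ]
  ring

theorem zFactor_partExp {n : ℕ} (ν : n.Partition) :
    zFactor (partExp ν) =
      ∏ k ∈ ν.parts.toFinset, k ^ ν.parts.count k * (ν.parts.count k).factorial := by
  rw [zFactor, Finsupp.prod]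
  refine Finset.prod_nbij (fun k : ℕ+ => (k : ℕ)) ?_ PNat.coe_injective.injOn ?_ ?_
  · intro k hk
    rw [Finsupp.mem_support_iff, partExp_apply] at hk
    simpa [Multiset.count_eq_zero] using hk
  · intro k hk
    rw [Finset.mem_coe, Multiset.mem_toFinset] at hk
    obtain ⟨k, rfl⟩ : ∃ j : ℕ+, (j : ℕ) = k := ⟨⟨k, ν.parts_pos hk⟩, rfl⟩
    refine ⟨k, ?_, rfl⟩
    rw [Finset.mem_coe, Finsupp.mem_support_iff, partExp_apply]
    simpa [Multiset.count_eq_zero] using hk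
  · intro k _
    rw [partExp_apply]

theorem parts_eq_filter_add_replicate {n : ℕ} (ν : n.Partition) :
    ν.parts = ν.parts.filter (2 ≤ ·) + Multiset.replicate (ν.parts.count 1) 1 := by
  ext a
  rw [Multiset.count_add, Multiset.count_filter, Multiset.count_replicate]
  rcases Nat.lt_or_ge a 2 with h | h
  · interval_cases a
    · simpa using fun h => (ν.parts_pos h).ne rfl
    · simp
  · rw [if_pos h, if_neg (by omega), add_zero]

theorem sum_filter_add_count_one {n : ℕ} (ν : n.Partition) :
    (ν.parts.filter (2 ≤ ·)).sum + ν.parts.count 1 = n := by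
  conv_rhs => rw [← ν.parts_sum, parts_eq_filter_add_replicate ν]
  simp

theorem partition_eq_iff_cycleType_eq {ι : Type*} [Fintype ι] [DecidableEq ι] (σ : Perm ι)
    (ν : (Fintype.card ι).Partition) :
    σ.partition = ν ↔ σ.cycleType = ν.parts.filter (2 ≤ ·) := by
  refine ⟨?_, fun h => Nat.Partition.ext ?_⟩
  · rintro rfl
    exact Perm.filter_parts_partition_eq_cycleType.symm
  · rw [Perm.parts_partition, ← Perm.sum_cycleType, h,
      Nat.sub_eq_of_eq_add' (sum_filter_add_count_one ν).symm, ← parts_eq_filter_add_replicate]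

theorem factorial_mul_prod_mul_prod_factorial_eq_zFactor {n : ℕ} (ν : n.Partition) :
    (ν.parts.count 1).factorial * (ν.parts.filter (2 ≤ ·)).prod *
      (∏ k ∈ (ν.parts.filter (2 ≤ ·)).toFinset,
        ((ν.parts.filter (2 ≤ ·)).count k).factorial) = zFactor (partExp ν) := by
  have hsub : ν.parts.toFinset ⊆ insert 1 (ν.parts.filter (2 ≤ ·)).toFinset := fun a ha => by
    have := ν.parts_pos (Multiset.mem_toFinset.mp ha)
    simp only [Finset.mem_insert, Multiset.mem_toFinset, Multiset.mem_filter] at ha ⊢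
    exact (Nat.lt_or_ge 1 a).symm.imp (by omega) fun h => ⟨ha, h⟩
  rw [zFactor_partExp, Finset.prod_multiset_count, mul_assoc, ← Finset.prod_mul_distrib,
    Finset.prod_subset hsub, Finset.prod_insert (by simp), one_pow, one_mul]
  · congr 1
    refine Finset.prod_congr rfl fun k hk => ?_
    rw [Multiset.mem_toFinset, Multiset.mem_filter] at hk
    rw [Multiset.count_filter, if_pos hk.2]
  · intro a _ ha
    rw [Multiset.mem_toFinset] at ha
    rw [Multiset.count_eq_zero_of_notMem ha, pow_zero, Nat.factorial_zero, one_mul]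

theorem card_partition_eq_mul_zFactor {ι : Type*} [Fintype ι] [DecidableEq ι]
    (ν : (Fintype.card ι).Partition) :
    (Finset.univ.filter fun σ : Perm ι => σ.partition = ν).card * zFactor (partExp ν) =
      (Fintype.card ι).factorial := by
  have hsum := sum_filter_add_count_one ν
  simp_rw [partition_eq_iff_cycleType_eq]
  rw [← factorial_mul_prod_mul_prod_factorial_eq_zFactor,
    ← Nat.sub_eq_of_eq_add' hsum.symm, Perm.card_of_cycleType_mul_eq, if_pos]
  exact ⟨by omega, fun a ha => (Multiset.mem_filter.mp ha).2⟩

theorem completeHomog_eq_charSum (n : ℕ) : completeHomog n = charSum fun _ : Perm (Fin n) => 1 := by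
  rw [completeHomog, frobeniusChar_eq_charSum]
  congr 1
  ext σ
  simp [Representation.character]

theorem coeff_completeHomog (n : ℕ) (w : ℕ+ →₀ ℕ) :
    MvPolynomial.coeff w (completeHomog n) =
      if psDegree w = n then (zFactor w : ℂ)⁻¹ else 0 := by
  rw [completeHomog_eq_charSum, charSum, MvPolynomial.coeff_smul, MvPolynomial.coeff_sum]
  simp_rw [one_smul, cycleMonomial, powerSumPart_eq_monomial, MvPolynomial.coeff_monomial]
  split_ifs with hw
  · rw [← Fintype.card_fin n] at hw
    obtain ⟨ν, rfl⟩ := exists_partExp_eq hw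
    have hcard := (card_partition_eq_mul_zFactor ν).trans
      (congrArg Nat.factorial (Fintype.card_fin n))
    have hfact : (n.factorial : ℂ) ≠ 0 := Nat.cast_ne_zero.mpr n.factorial_ne_zero
    have hz : (zFactor (partExp ν) : ℂ) ≠ 0 := Nat.cast_ne_zero.mpr (zFactor_pos _).ne'
    simp_rw [partExp_injective.eq_iff]
    rw [Finset.sum_boole, smul_eq_mul, inv_mul_eq_iff_eq_mul₀ hfact, eq_mul_inv_iff_mul_eq₀ hz]
    exact_mod_cast hcard
  · rw [Finset.sum_eq_zero, smul_zero]
    intro σ _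
    rw [if_neg]
    rintro rfl
    exact hw ((psDegree_partExp σ.partition).trans (Fintype.card_fin n))

theorem completeHomog_zero : completeHomog 0 = 1 := by
  ext w
  rw [coeff_completeHomog, MvPolynomial.coeff_one]
  simp only [psDegree_eq_zero_iff, eq_comm (a := w)]
  split_ifs with hw
  · subst hw
    simp [zFactor]
  · rfl

theorem pderiv_completeHomog_add (n : ℕ) (k : ℕ+) :
    MvPolynomial.pderiv k (completeHomog (n + k)) = (k : ℂ)⁻¹ • completeHomog n := by
  ext w
  rw [MvPolynomial.coeff_pderiv, coeff_completeHomog, MvPolynomial.coeff_smul, coeff_completeHomog,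
    map_add, psDegree, Finsupp.weight_single, smul_eq_mul, one_mul]
  simp only [Nat.add_right_cancel_iff]
  split_ifs
  · rw [zFactor_add_single]
    have hz : (zFactor w : ℂ) ≠ 0 := Nat.cast_ne_zero.mpr (zFactor_pos w).ne'
    have hk : ((k : ℕ) : ℂ) ≠ 0 := Nat.cast_ne_zero.mpr k.pos.ne'
    have hw : (w k : ℂ) + 1 ≠ 0 := by exact_mod_cast (w k).succ_ne_zero
    push_cast
    rw [smul_eq_mul]
    field_simp
  · simp

theorem coeff_X_mul_completeHomog (k : ℕ+) (n : ℕ) (w : ℕ+ →₀ ℕ) :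
    MvPolynomial.coeff w ((MvPolynomial.X k : SymmFun) * completeHomog n) =
      if psDegree w = n + k then ((w k * k : ℕ) : ℂ) * (zFactor w : ℂ)⁻¹ else 0 := by
  rw [MvPolynomial.coeff_X_mul']
  by_cases hk : k ∈ w.support
  · obtain ⟨v, rfl⟩ : ∃ v, w = v + Finsupp.single k 1 :=
      ⟨w - Finsupp.single k 1, (tsub_add_cancel_of_le (Finsupp.single_le_iff.mpr
        (Nat.one_le_iff_ne_zero.mpr (Finsupp.mem_support_iff.mp hk)))).symm⟩
    rw [if_pos hk, coeff_completeHomog, add_tsub_cancel_right, map_add, psDegree,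
      Finsupp.weight_single, one_smul]
    simp only [Nat.add_right_cancel_iff]
    split_ifs
    · have hz : (zFactor v : ℂ) ≠ 0 := Nat.cast_ne_zero.mpr (zFactor_pos v).ne'
      have hk0 : ((k : ℕ) : ℂ) ≠ 0 := Nat.cast_ne_zero.mpr k.pos.ne'
      have hv : (v k : ℂ) + 1 ≠ 0 := by exact_mod_cast (v k).succ_ne_zero
      rw [zFactor_add_single, Finsupp.add_apply, Finsupp.single_eq_same]
      push_cast
      field_simp
    · rfl
  · rw [if_neg hk, Finsupp.notMem_support_iff.mp hk]
    simp

theorem completeHomog_newton (n : ℕ) :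
    ((n : ℂ) + 1) • completeHomog (n + 1) =
      ∑ p ∈ antidiagonal n,
        (MvPolynomial.X p.1.succPNat : SymmFun) * completeHomog p.2 := by
  ext w
  rw [MvPolynomial.coeff_smul, MvPolynomial.coeff_sum, coeff_completeHomog, smul_eq_mul]
  have hcoeff : ∀ p ∈ antidiagonal n, MvPolynomial.coeff w
      ((MvPolynomial.X p.1.succPNat : SymmFun) * completeHomog p.2) =
      if psDegree w = n + 1 then
        ((w p.1.succPNat * (p.1 + 1) : ℕ) : ℂ) * (zFactor w : ℂ)⁻¹ else 0 := fun p hp => by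
    rw [coeff_X_mul_completeHomog, Nat.succPNat_coe,
      ← Finset.HasAntidiagonal.mem_antidiagonal.mp hp, Nat.succ_eq_add_one, ← add_assoc,
      add_comm p.2]
  rw [Finset.sum_congr rfl hcoeff]
  split_ifs with hw
  · rw [← Finset.sum_mul, ← Nat.cast_sum, Finset.Nat.sum_antidiagonal_eq_sum_range_succ_mk,
      ← psDegree_eq_sum_range hw.le, hw, Nat.cast_add_one]
  · rw [mul_zero, Finset.sum_const_zero]

end CompleteHomog

section Newton

variable {R : Type*} [CommRing R] [Algebra ℂ R]

/-- `z` satisfies the Newton identities `n z_n = ∑ a_k z_{n-k}` with power sums `a`; they determine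
`z` as the sequence of values of the complete homogeneous functions at these power sums. -/
def IsNewtonSeq (a : ℕ+ → R) (z : ℕ → R) : Prop :=
  z 0 = 1 ∧ ∀ n : ℕ, ((n : ℂ) + 1) • z (n + 1) = ∑ p ∈ antidiagonal n, a p.1.succPNat * z p.2

theorem isNewtonSeq_aeval (a : ℕ+ → R) :
    IsNewtonSeq a fun n => MvPolynomial.aeval a (completeHomog n) := by
  refine ⟨by simp [completeHomog_zero], fun n => ?_⟩
  simpa using congrArg (MvPolynomial.aeval a) (completeHomog_newton n)

theorem IsNewtonSeq.eq {a : ℕ+ → R} {z z' : ℕ → R} (h : IsNewtonSeq a z) (h' : IsNewtonSeq a z')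
    (n : ℕ) : z n = z' n := by
  induction n using Nat.strong_induction_on with
  | _ n ih =>
    rcases n with _ | n
    · rw [h.1, h'.1]
    · have h0 : ((n : ℂ) + 1) ≠ 0 := by exact_mod_cast n.succ_ne_zero
      refine (IsUnit.mk0 _ h0).smul_left_cancel.mp ?_
      rw [h.2, h'.2]
      refine Finset.sum_congr rfl fun p hp => ?_
      rw [ih p.2 (by have := Finset.HasAntidiagonal.mem_antidiagonal.mp hp; omega)]

theorem isNewtonSeq_iff (a : ℕ+ → R) (z : ℕ → R) :
    IsNewtonSeq a z ↔ z 0 = 1 ∧ PowerSeries.derivative R (PowerSeries.mk z) =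
      PowerSeries.mk (fun n => a n.succPNat) * PowerSeries.mk z := by
  refine and_congr_right fun _ => ?_
  rw [PowerSeries.ext_iff]
  refine forall_congr' fun n => ?_
  rw [PowerSeries.coeff_mul]
  simp only [PowerSeries.coeff_mk, PowerSeries.coeff_derivative]
  rw [Algebra.smul_def, mul_comm]
  simp

theorem IsNewtonSeq.mul {a b : ℕ+ → R} {z y x : ℕ → R} (hz : IsNewtonSeq a z)
    (hy : IsNewtonSeq b y)
    (hx : PowerSeries.mk x = PowerSeries.mk z * PowerSeries.mk y) : IsNewtonSeq (a + b) x := by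
  rw [isNewtonSeq_iff] at *
  refine ⟨?_, ?_⟩
  · have := congrArg (PowerSeries.coeff 0) hx
    rw [PowerSeries.coeff_mul] at this
    simpa [hz.1, hy.1] using this
  · have : PowerSeries.mk (fun n => (a + b) n.succPNat) =
      PowerSeries.mk (fun n => a n.succPNat) + PowerSeries.mk (fun n => b n.succPNat) := by
      ext; simp
    rw [hx, Derivation.leibniz, hz.2, hy.2, this]
    simp only [smul_eq_mul]
    ring

theorem isNewtonSeq_prod {ι : Type*} (s : Finset ι) (a : ι → ℕ+ → R) (z : ι → ℕ → R)
    (h : ∀ i ∈ s, IsNewtonSeq (a i) (z i)) :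
    IsNewtonSeq (∑ i ∈ s, a i) fun n =>
      PowerSeries.coeff n (∏ i ∈ s, PowerSeries.mk (z i)) := by
  classical
  induction s using Finset.induction_on with
  | empty =>
    refine ⟨by simp, fun n => by simp [PowerSeries.coeff_one]⟩
  | insert i s hi ih =>
    rw [Finset.sum_insert hi]
    refine (h i (Finset.mem_insert_self _ _)).mul
      (ih fun j hj => h j (Finset.mem_insert_of_mem hj)) ?_
    rw [Finset.prod_insert hi]
    ext n
    simp only [PowerSeries.coeff_mk, PowerSeries.coeff_mul]

theorem aeval_completeHomog_sum {ι : Type*} (s : Finset ι) (a : ι → ℕ+ → R) (z : ι → ℕ → R)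
    (h : ∀ i ∈ s, IsNewtonSeq (a i) (z i)) (n : ℕ) :
    MvPolynomial.aeval (∑ i ∈ s, a i) (completeHomog n) =
      PowerSeries.coeff n (∏ i ∈ s, PowerSeries.mk (z i)) :=
  (isNewtonSeq_aeval _).eq (isNewtonSeq_prod s a z h) n

theorem isNewtonSeq_mul_pow (p : ℕ+ → R) (z : ℕ → R) (h : IsNewtonSeq p z) (y : R) :
    IsNewtonSeq (fun k => p k * y ^ (k : ℕ)) fun n => z n * y ^ n := by
  refine ⟨by simp [h.1], fun n => ?_⟩
  rw [← smul_mul_assoc, h.2, Finset.sum_mul]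
  refine Finset.sum_congr rfl fun p hp => ?_
  simp only [← Finset.HasAntidiagonal.mem_antidiagonal.mp hp, Nat.succPNat_coe, Nat.succ_eq_add_one]
  ring

theorem isNewtonSeq_one : IsNewtonSeq (fun _ => (1 : R)) fun _ => 1 := by
  refine ⟨rfl, fun n => ?_⟩
  simp [Algebra.smul_def]

end Newton

/-! ### The characteristic of `Lie_n^{(2)}` -/

section LieTwo

open Equiv

theorem eq_of_mem_cycleType_of_forall_pow_apply_eq_iff {ι : Type*} [Fintype ι] [DecidableEq ι]
    {σ : Perm ι} {d : ℕ} (h : ∀ (x : ι) (k : ℕ), (σ ^ k) x = x ↔ d ∣ k) {c : ℕ}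
    (hc : c ∈ σ.cycleType) : c = d := by
  obtain ⟨f, τ, rfl, hdisjoint, hcycle, rfl⟩ := Perm.mem_cycleType_iff.mp hc
  obtain ⟨x, hx⟩ := hcycle.nonempty_support
  have hfx := Perm.mem_support.mp hx
  have pow_eq_one_iff (k : ℕ) : f ^ k = 1 ↔ d ∣ k := by
    have hτx : (τ ^ k) x = x :=
      Perm.pow_apply_eq_self_of_apply_eq_self ((hdisjoint x).resolve_left hfx) k
    rw [← h x k, hdisjoint.commute.mul_pow, hcycle.pow_eq_one_iff' hfx, Perm.mul_apply, hτx]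
  rw [← hcycle.orderOf]
  exact Nat.dvd_antisymm (orderOf_dvd_of_pow_eq_one ((pow_eq_one_iff d).mpr dvd_rfl))
    ((pow_eq_one_iff _).mp (pow_orderOf_eq_one f))

theorem cycleMonomial_of_forall_pow_apply_eq_iff {ι : Type*} [Fintype ι] [DecidableEq ι]
    (σ : Perm ι) (d : ℕ+) (h : ∀ (x : ι) (k : ℕ), (σ ^ k) x = x ↔ (d : ℕ) ∣ k) :
    cycleMonomial σ = MvPolynomial.X d ^ (Fintype.card ι / d) := by
  rw [cycleMonomial_eq_prod_cycleType]
  rcases eq_or_ne d 1 with rfl | hd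
  · obtain rfl : σ = 1 := Equiv.ext fun x => by simpa using (h x 1).mpr (by simp)
    simp
  · have hrep : σ.cycleType = Multiset.replicate _ (d : ℕ) :=
      Multiset.eq_replicate_card.mpr fun c hc => eq_of_mem_cycleType_of_forall_pow_apply_eq_iff h hc
    have hsupport : σ.support = Finset.univ := by
      refine Finset.eq_univ_of_forall fun x => Perm.mem_support.mpr fun hx => hd ?_
      exact PNat.coe_eq_one_iff.mp (Nat.dvd_one.mp ((h x 1).mp (by simpa using hx)))
    have hsum : σ.cycleType.sum = Fintype.card ι := by
      rw [Perm.sum_cycleType, hsupport, Finset.card_univ]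
    have hcard : Multiset.card σ.cycleType = Fintype.card ι / d := by
      rw [← hsum, hrep, Multiset.sum_replicate, smul_eq_mul, Multiset.card_replicate,
        Nat.mul_div_cancel _ d.pos]
    rw [hsum, Nat.sub_self, pow_zero, mul_one, hrep, Multiset.map_replicate,
      Multiset.prod_replicate, hcard, PNat.coe_toPNat']

theorem cyclicToPerm_ofAdd (n : ℕ) [NeZero n] (j : ZMod n) :
    cyclicToPerm n (Multiplicative.ofAdd j) = finRotate n ^ j.val := by
  obtain ⟨k, rfl⟩ : ∃ k : ℕ, (k : ZMod n) = j := ⟨j.val, by simp⟩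
  have hcast : cyclicToPerm n (Multiplicative.ofAdd (k : ZMod n)) = finRotate n ^ k := by
    have hlift := ZMod.lift_coe n ⟨zmultiplesHom (Additive (Perm (Fin n)))
      (Additive.ofMul (finRotate n)), by simp [← ofMul_pow, finRotate_pow_self]⟩ (k : ℤ)
    rw [Int.cast_natCast] at hlift
    refine (congrArg Additive.toMul hlift).trans ?_
    simp [← ofMul_pow]
  rw [hcast, ZMod.val_natCast]
  conv_lhs => rw [← Nat.mod_add_div k n, pow_add, pow_mul, finRotate_pow_self, one_pow, mul_one]

theorem finRotate_pow_apply_eq_self_iff (n : ℕ) (x : Fin n) (k : ℕ) :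
    (finRotate n ^ k) x = x ↔ n ∣ k := by
  rcases n with _ | n
  · exact x.elim0
  · have pow_apply (k : ℕ) : (finRotate (n + 1) ^ k) x = x + Fin.ofNat (n + 1) k := by
      induction k with
      | zero => simp
      | succ k ih =>
        rw [pow_succ', Perm.mul_apply, ih, finRotate_apply, add_assoc]
        congr 1
        ext
        simp [Fin.val_add, Fin.ofNat]
    rw [pow_apply, add_eq_left, Fin.ext_iff]
    simp [Fin.ofNat, Nat.dvd_iff_mod_eq_zero]

theorem cycleMonomial_cyclicToPerm (n : ℕ) [NeZero n] (j : ZMod n) (d : ℕ+)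
    (hd : addOrderOf j = d) :
    cycleMonomial (cyclicToPerm n (Multiplicative.ofAdd j)) = MvPolynomial.X d ^ (n / d) := by
  rw [cycleMonomial_of_forall_pow_apply_eq_iff _ d, Fintype.card_fin]
  intro x k
  rw [cyclicToPerm_ofAdd, ← pow_mul, finRotate_pow_apply_eq_self_iff, ← hd,
    addOrderOf_dvd_iff_nsmul_eq_zero, mul_comm, ← ZMod.natCast_eq_zero_iff]
  simp

section Torsion

variable {A : Type*} [Fintype A] [DecidableEq A]

theorem sum_filter_nsmul_eq_zero [AddGroup A] {M : Type*} [AddCommMonoid M] {m : ℕ} (hm : m ≠ 0)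
    (F : A → M) :
    ∑ j with m • j = 0, F j = ∑ d ∈ m.divisors, ∑ j with addOrderOf j = d, F j := by
  rw [← Finset.sum_fiberwise_of_maps_to (g := addOrderOf) (t := m.divisors)]
  · refine Finset.sum_congr rfl fun d hd => Finset.sum_congr ?_ fun _ _ => rfl
    ext j
    simp only [Finset.mem_filter, Finset.mem_univ, true_and, and_iff_right_iff_imp]
    rintro rfl
    exact addOrderOf_dvd_iff_nsmul_eq_zero.mp (Nat.dvd_of_mem_divisors hd)
  · intro j hj
    rw [Nat.mem_divisors]
    exact ⟨addOrderOf_dvd_iff_nsmul_eq_zero.mpr (Finset.mem_filter.mp hj).2, hm⟩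

theorem card_filter_nsmul_eq_zero [AddGroup A] [IsAddCyclic A] {m : ℕ}
    (hm : m ∣ Fintype.card A) : (Finset.univ.filter fun j : A => m • j = 0).card = m := by
  have hm0 : m ≠ 0 := ne_zero_of_dvd_ne_zero Fintype.card_ne_zero hm
  rw [Finset.card_eq_sum_ones, sum_filter_nsmul_eq_zero hm0]
  conv_rhs => rw [← Nat.sum_totient m]
  refine Finset.sum_congr rfl fun d hd => ?_
  rw [← Finset.card_eq_sum_ones,
    IsAddCyclic.card_addOrderOf_eq_totient ((Nat.dvd_of_mem_divisors hd).trans hm)]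

theorem sum_addChar_filter_nsmul_eq_zero [AddCommGroup A] {R : Type*} [CommRing R] [IsDomain R]
    (ψ : AddChar A R) {m : ℕ} {c : A} (hc : m • c = 0) (hψ : ψ c ≠ 1) :
    ∑ j with m • j = 0, ψ j = 0 := by
  have hshift : ψ c * ∑ j with m • j = 0, ψ j = ∑ j with m • j = 0, ψ j := by
    rw [Finset.mul_sum]
    refine Finset.sum_equiv (Equiv.addLeft c) (fun j => ?_) fun j _ => ?_
    · simp only [Finset.mem_filter, Finset.mem_univ, true_and, Equiv.coe_addLeft, smul_add, hc,
        zero_add]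
    · rw [Equiv.coe_addLeft, AddChar.map_add_eq_mul]
  exact eq_zero_of_mul_eq_self_left hψ hshift

end Torsion

theorem lieTwoCharacter_apply (n : ℕ) [NeZero n] (j : ZMod n) :
    lieTwoCharacter n (Multiplicative.ofAdd j) =
      ZMod.stdAddChar (((2 ^ padicValNat 2 n : ℕ) : ZMod n) * j) := rfl

theorem lieTwoCharacter_eq_one_of_nsmul_eq_zero {n : ℕ} [NeZero n] {m : ℕ}
    (hm : m ∣ 2 ^ padicValNat 2 n) {j : ZMod n} (hj : m • j = 0) :
    lieTwoCharacter n (Multiplicative.ofAdd j) = 1 := by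
  obtain ⟨b, hb⟩ := hm
  rw [lieTwoCharacter_apply, hb, mul_comm m b, Nat.cast_mul, mul_assoc, ← nsmul_eq_mul m j, hj,
    mul_zero, AddChar.map_zero_eq_one]

theorem exists_nsmul_eq_zero_lieTwoCharacter_ne_one {n : ℕ} [NeZero n] {m : ℕ} (hmn : m ∣ n)
    (hm : ¬ m ∣ 2 ^ padicValNat 2 n) :
    ∃ c : ZMod n, m • c = 0 ∧ lieTwoCharacter n (Multiplicative.ofAdd c) ≠ 1 := by
  obtain ⟨c, hc⟩ := hmn
  have hc0 : 0 < c := Nat.pos_of_ne_zero fun h => NeZero.ne n (by rw [hc, h, mul_zero])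
  refine ⟨c, ?_, fun hchar => hm (Nat.dvd_of_mul_dvd_mul_right hc0 ?_)⟩
  · rw [nsmul_eq_mul, ← Nat.cast_mul, ← hc, ZMod.natCast_self]
  · rw [lieTwoCharacter_apply, ← Nat.cast_mul] at hchar
    rw [← hc, ← ZMod.natCast_eq_zero_iff]
    exact ZMod.injective_stdAddChar (hchar.trans (AddChar.map_zero_eq_one _).symm)

/-- The sum of the values at the elements of order `d` of `C_n` of the character inducing
`Lie_n^{(2)}`. -/
def orderSum (n : ℕ) [NeZero n] (d : ℕ) : ℂ :=
  ∑ j : ZMod n with addOrderOf j = d, lieTwoCharacter n (Multiplicative.ofAdd j)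

/-- The function `m ↦ m` on powers of two, extended by zero: the values of the sums of
`lieTwoCharacter` over the elements killed by `m`. -/
def powTwoWeight (m : ℕ) : ℂ := open Classical in if ∃ a : ℕ, m = 2 ^ a then m else 0

theorem sum_divisors_orderSum (n : ℕ) [NeZero n] {m : ℕ} (hmn : m ∣ n) :
    ∑ d ∈ m.divisors, orderSum n d = powTwoWeight m := by
  have hn : n ≠ 0 := NeZero.ne n
  simp only [orderSum]
  rw [← sum_filter_nsmul_eq_zero (ne_zero_of_dvd_ne_zero hn hmn)]
  by_cases h : ∃ a : ℕ, m = 2 ^ a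
  · have hm : m ∣ 2 ^ padicValNat 2 n := by
      obtain ⟨a, rfl⟩ := h
      exact pow_dvd_pow 2 ((padicValNat_dvd_iff_le hn).mp hmn)
    rw [powTwoWeight, if_pos h, Finset.sum_congr rfl fun j hj =>
      lieTwoCharacter_eq_one_of_nsmul_eq_zero hm (Finset.mem_filter.mp hj).2, Finset.sum_const,
      card_filter_nsmul_eq_zero (by rwa [ZMod.card]), nsmul_one]
  · have hm : ¬ m ∣ 2 ^ padicValNat 2 n := fun hdvd => h <| by
      obtain ⟨a, -, ha⟩ := (Nat.dvd_prime_pow Nat.prime_two).mp hdvd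
      exact ⟨a, ha⟩
    obtain ⟨c, hc, hχ⟩ := exists_nsmul_eq_zero_lieTwoCharacter_ne_one hmn hm
    rw [powTwoWeight, if_neg h]
    exact sum_addChar_filter_nsmul_eq_zero
      ((ZMod.stdAddChar (N := n)).mulShift ((2 ^ padicValNat 2 n : ℕ) : ZMod n)) hc hχ

/-- The Möbius inverse of `powTwoWeight`, realised as the sum of the values of `lieTwoCharacter d`
at the generators of `C_d`. -/
def lieCoeff (d : ℕ+) : ℂ := orderSum d d

theorem orderSum_eq_lieCoeff (n : ℕ) [NeZero n] (d : ℕ+) (hdn : (d : ℕ) ∣ n) :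
    orderSum n d = lieCoeff d := by
  induction d using PNat.strongInductionOn generalizing n with
  | _ d ih =>
    have hproper : ∑ i ∈ (d : ℕ).properDivisors, orderSum n i =
        ∑ i ∈ (d : ℕ).properDivisors, orderSum d i := by
      refine Finset.sum_congr rfl fun i hi => ?_
      rw [Nat.mem_properDivisors] at hi
      lift i to ℕ+ using Nat.pos_of_dvd_of_pos hi.1 d.pos
      rw [ih i hi.2 n (hi.1.trans hdn), ih i hi.2 d hi.1]
    have hsums := (sum_divisors_orderSum n hdn).trans (sum_divisors_orderSum (d : ℕ) dvd_rfl).symm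
    rw [← Nat.insert_self_properDivisors d.pos.ne',
      Finset.sum_insert Nat.self_notMem_properDivisors,
      Finset.sum_insert Nat.self_notMem_properDivisors, hproper] at hsums
    exact add_right_cancel hsums

theorem sum_divisors_lieCoeff (m : ℕ+) :
    ∑ d ∈ (m : ℕ).divisors, lieCoeff d.toPNat' = powTwoWeight m := by
  rw [← sum_divisors_orderSum (m : ℕ) dvd_rfl]
  refine Finset.sum_congr rfl fun d hd => ?_
  lift d to ℕ+ using Nat.pos_of_mem_divisors hd
  rw [orderSum_eq_lieCoeff _ _ (Nat.dvd_of_mem_divisors hd), PNat.coe_toPNat']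

theorem frobeniusChar_lieTwoRep (n : ℕ) [NeZero n] :
    frobeniusChar (lieTwoRep n) = (n : ℂ)⁻¹ • ∑ j : ZMod n,
      lieTwoCharacter n (Multiplicative.ofAdd j) •
        cycleMonomial (cyclicToPerm n (Multiplicative.ofAdd j)) := by
  rw [lieTwoRep, frobeniusChar_ind]
  simp_rw [character_linearCharRep]
  rw [Fintype.card_multiplicative, ZMod.card]
  congr 1
  exact Fintype.sum_equiv Multiplicative.toAdd _ _ fun _ => rfl

theorem coeff_frobeniusChar_lieTwoRep (n : ℕ) [NeZero n] (w : ℕ+ →₀ ℕ) :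
    (n : ℂ) * MvPolynomial.coeff w (frobeniusChar (lieTwoRep n)) =
      ∑ j : ZMod n, open Classical in
        if w = Finsupp.single (addOrderOf j).toPNat' (n / addOrderOf j) then
          lieTwoCharacter n (Multiplicative.ofAdd j) else 0 := by
  have hn : (n : ℂ) ≠ 0 := by exact_mod_cast NeZero.ne n
  rw [frobeniusChar_lieTwoRep, MvPolynomial.coeff_smul, MvPolynomial.coeff_sum, smul_eq_mul,
    mul_inv_cancel_left₀ hn]
  refine Finset.sum_congr rfl fun j _ => ?_
  have hord : addOrderOf j = ((addOrderOf j).toPNat' : ℕ) := by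
    rw [Nat.toPNat'_coe, if_pos (addOrderOf_pos j)]
  rw [cycleMonomial_cyclicToPerm n j _ hord, MvPolynomial.coeff_smul, MvPolynomial.coeff_X_pow,
    ← hord, smul_eq_mul, mul_ite, mul_one, mul_zero]
  simp only [eq_comm]

end LieTwo

/-! ### The plethysm `h_m[Lie^{(2)}]` -/

section Filtration

/-- The Euler derivation, multiplying a monomial by its degree. Applied to `∑_m h_m[g]` it turns
Newton's identities into a first order linear differential equation. -/
def eulerDeriv : Derivation ℂ SymmSeries SymmSeries :=
  Derivation.mk'
    { toFun := fun g m => (psDegree m : ℂ) * MvPowerSeries.coeff m g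
      map_add' := fun f g => by
        funext m
        exact (congrArg _ (map_add _ _ _)).trans (mul_add _ _ _)
      map_smul' := fun c g => by
        funext m
        change (psDegree m : ℂ) * MvPowerSeries.coeff m (c • g) =
          c * ((psDegree m : ℂ) * MvPowerSeries.coeff m g)
        rw [MvPowerSeries.coeff_smul]
        ring }
    fun f g => by
      classical
      ext m
      change (psDegree m : ℂ) * MvPowerSeries.coeff m (f * g) = _
      rw [map_add, smul_eq_mul, smul_eq_mul, mul_comm g, MvPowerSeries.coeff_mul,
        MvPowerSeries.coeff_mul, MvPowerSeries.coeff_mul, Finset.mul_sum,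
        ← Finset.sum_add_distrib]
      refine Finset.sum_congr rfl fun p hp => ?_
      rw [← Finset.HasAntidiagonal.mem_antidiagonal.mp hp, map_add]
      change _ = MvPowerSeries.coeff p.1 f * ((psDegree p.2 : ℂ) * MvPowerSeries.coeff p.2 g) +
        (psDegree p.1 : ℂ) * MvPowerSeries.coeff p.1 f * MvPowerSeries.coeff p.2 g
      push_cast
      ring

theorem coeff_eulerDeriv (g : SymmSeries) (m : ℕ+ →₀ ℕ) :
    MvPowerSeries.coeff m (eulerDeriv g) = (psDegree m : ℂ) * MvPowerSeries.coeff m g := rfl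

/-- The ideal of series all of whose terms have degree at least `k`. Congruences modulo these ideals
replace the convergence of infinite sums of symmetric functions. -/
def degreeIdeal (k : ℕ) : Ideal SymmSeries where
  carrier := {g | ∀ m, psDegree m < k → MvPowerSeries.coeff m g = 0}
  add_mem' hf hg m hm := by rw [map_add, hf m hm, hg m hm, add_zero]
  zero_mem' m _ := map_zero _
  smul_mem' f g hg m hm := by
    classical
    rw [smul_eq_mul, MvPowerSeries.coeff_mul]
    refine Finset.sum_eq_zero fun p hp => ?_
    have hdeg := congrArg psDegree (Finset.HasAntidiagonal.mem_antidiagonal.mp hp)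
    rw [map_add] at hdeg
    rw [hg p.2 (by omega), mul_zero]

theorem mul_mem_degreeIdeal {i j : ℕ} {f g : SymmSeries} (hf : f ∈ degreeIdeal i)
    (hg : g ∈ degreeIdeal j) : f * g ∈ degreeIdeal (i + j) := by
  classical
  intro m hm
  rw [MvPowerSeries.coeff_mul]
  refine Finset.sum_eq_zero fun p hp => ?_
  have hdeg := congrArg psDegree (Finset.HasAntidiagonal.mem_antidiagonal.mp hp)
  rw [map_add] at hdeg
  rcases Nat.lt_or_ge (psDegree p.1) i with h | h
  · rw [hf p.1 h, zero_mul]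
  · rw [hg p.2 (by omega), mul_zero]

theorem degreeIdeal_mono {i j : ℕ} (h : i ≤ j) {g : SymmSeries} (hg : g ∈ degreeIdeal j) :
    g ∈ degreeIdeal i := fun m hm => hg m (hm.trans_le h)

theorem eulerDeriv_mem_degreeIdeal {k : ℕ} {g : SymmSeries} (hg : g ∈ degreeIdeal k) :
    eulerDeriv g ∈ degreeIdeal k := fun m hm => by rw [coeff_eulerDeriv, hg m hm, mul_zero]

theorem mem_degreeIdeal_of_eulerDeriv {k : ℕ} {g : SymmSeries} (hg : eulerDeriv g ∈ degreeIdeal k)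
    (hg1 : g ∈ degreeIdeal 1) : g ∈ degreeIdeal k := fun m hm => by
  rcases Nat.eq_zero_or_pos (psDegree m) with h0 | hpos
  · exact hg1 m (by omega)
  · exact (mul_eq_zero.mp (hg m hm)).resolve_left (by exact_mod_cast hpos.ne')

theorem mem_degreeIdeal_one {g : SymmSeries} :
    g ∈ degreeIdeal 1 ↔ MvPowerSeries.constantCoeff g = 0 := by
  refine ⟨fun h => h 0 (by simp), fun h m hm => ?_⟩
  rw [psDegree_eq_zero_iff.mp (Nat.lt_one_iff.mp hm)]
  exact h

theorem sub_mem_degreeIdeal_of_eulerDeriv {N : ℕ} {S X Y : SymmSeries} (hS : S ∈ degreeIdeal 1)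
    (hX : eulerDeriv X - S * X ∈ degreeIdeal (N + 1))
    (hY : eulerDeriv Y - S * Y ∈ degreeIdeal (N + 1)) (hXY : X - Y ∈ degreeIdeal 1) :
    X - Y ∈ degreeIdeal (N + 1) := by
  have hdiff : eulerDeriv (X - Y) - S * (X - Y) ∈ degreeIdeal (N + 1) := by
    have hsub := Ideal.sub_mem _ hX hY
    rw [map_sub]
    convert hsub using 1
    ring
  suffices ∀ k ≤ N, X - Y ∈ degreeIdeal (k + 1) from this N le_rfl
  intro k
  induction k with
  | zero => exact fun _ => hXY
  | succ k ih =>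
    intro hk
    refine mem_degreeIdeal_of_eulerDeriv ?_ hXY
    have hmul : S * (X - Y) ∈ degreeIdeal (k + 1 + 1) := by
      rw [add_comm (k + 1)]
      exact mul_mem_degreeIdeal hS (ih (by omega))
    have hadd := Ideal.add_mem _ (degreeIdeal_mono (by omega) hdiff) hmul
    rwa [sub_add_cancel] at hadd

end Filtration

section Adams

/-- The map `i ↦ k i` on the indices of the power sums, underlying `adams k`. -/
def mulEmb (k : ℕ+) : ℕ+ ↪ ℕ+ := ⟨fun i => k * i, fun _ _ h => mul_left_cancel h⟩

theorem psDegree_embDomain (k : ℕ+) (m : ℕ+ →₀ ℕ) :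
    psDegree (Finsupp.embDomain (mulEmb k) m) = k * psDegree m := by
  rw [psDegree, Finsupp.weight_apply, Finsupp.sum_embDomain, Finsupp.weight_apply, Finsupp.mul_sum]
  refine Finset.sum_congr rfl fun i _ => ?_
  change m i * ((k * i : ℕ+) : ℕ) = k * (m i * i)
  rw [PNat.mul_coe]
  ring

theorem coeff_adams (k : ℕ+) (g : SymmSeries) (m : ℕ+ →₀ ℕ) :
    MvPowerSeries.coeff (Finsupp.embDomain (mulEmb k) m) (adams k g) = MvPowerSeries.coeff m g :=
  MvPowerSeries.coeff_embDomain_rename (mulEmb k) g m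

theorem coeff_adams_eq_zero (k : ℕ+) (g : SymmSeries) (m : ℕ+ →₀ ℕ)
    (h : ∀ v, Finsupp.embDomain (mulEmb k) v ≠ m) : MvPowerSeries.coeff m (adams k g) = 0 := by
  refine MvPowerSeries.coeff_rename_eq_zero _ g ?_
  rintro ⟨v, hv⟩
  apply h v
  rw [Finsupp.embDomain_eq_mapDomain]
  exact hv

theorem adams_mem_degreeIdeal {i : ℕ} (k : ℕ+) {g : SymmSeries} (hg : g ∈ degreeIdeal i) :
    adams k g ∈ degreeIdeal (k * i) := by
  intro m hm
  by_cases h : ∃ v, Finsupp.embDomain (mulEmb k) v = m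
  · obtain ⟨v, rfl⟩ := h
    rw [psDegree_embDomain] at hm
    rw [coeff_adams]
    exact hg v (lt_of_mul_lt_mul_left hm (Nat.zero_le _))
  · exact coeff_adams_eq_zero k g m fun v hv => h ⟨v, hv⟩

theorem eulerDeriv_adams (k : ℕ+) (g : SymmSeries) :
    eulerDeriv (adams k g) = (k : ℂ) • adams k (eulerDeriv g) := by
  ext m
  rw [coeff_eulerDeriv, MvPowerSeries.coeff_smul]
  by_cases h : ∃ v, Finsupp.embDomain (mulEmb k) v = m
  · obtain ⟨v, rfl⟩ := h
    rw [psDegree_embDomain, coeff_adams, coeff_adams, coeff_eulerDeriv]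
    push_cast
    ring
  · push Not at h
    rw [coeff_adams_eq_zero k g m h, coeff_adams_eq_zero k _ m h, mul_zero, mul_zero]

end Adams

section ChainRule

theorem completeHomog_mem_supported (n : ℕ) :
    completeHomog n ∈ MvPolynomial.supported ℂ
      (((Finset.range n).image Nat.succPNat : Finset ℕ+) : Set ℕ+) := by
  rw [completeHomog_eq_charSum, charSum]
  refine Subalgebra.smul_mem _ (Subalgebra.sum_mem _ fun σ _ => Subalgebra.smul_mem _ ?_ _) _
  rw [cycleMonomial, powerSumPart]
  refine Subalgebra.multiset_prod_mem _ fun x hx => ?_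
  obtain ⟨k, hk, rfl⟩ := Multiset.mem_map.mp hx
  have hk0 := σ.partition.parts_pos hk
  have hkn : k ≤ n := by
    have hle := Multiset.le_sum_of_mem hk
    rwa [σ.partition.parts_sum, Fintype.card_fin] at hle
  refine Algebra.subset_adjoin ⟨k.toPNat', ?_, rfl⟩
  rw [Finset.mem_coe, Finset.mem_image]
  refine ⟨k - 1, Finset.mem_range.mpr (by omega), ?_⟩
  apply PNat.coe_injective
  rw [Nat.succPNat_coe, Nat.toPNat'_coe, if_pos hk0]
  omega

theorem derivation_aeval {k R ι : Type*} [CommSemiring k] [CommSemiring R] [Algebra k R]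
    (D : Derivation k R R) (a : ι → R) (s : Finset ι) {f : MvPolynomial ι k}
    (hf : f ∈ MvPolynomial.supported k (s : Set ι)) :
    D (MvPolynomial.aeval a f) =
      ∑ i ∈ s, MvPolynomial.aeval a (MvPolynomial.pderiv i f) * D (a i) := by
  induction hf using Algebra.adjoin_induction with
  | mem x hx =>
    obtain ⟨j, hj, rfl⟩ := hx
    rw [MvPolynomial.aeval_X, Finset.sum_eq_single j]
    · simp
    · intro i _ hi
      rw [MvPolynomial.pderiv_X_of_ne hi.symm]
      simp
    · exact fun h => absurd hj h
  | algebraMap r => simp [MvPolynomial.algebraMap_eq]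
  | add x y _ _ hx hy =>
    simp only [map_add, hx, hy, add_mul, Finset.sum_add_distrib]
  | mul x y _ _ hx hy =>
    rw [map_mul, D.leibniz, hx, hy, smul_eq_mul, smul_eq_mul, Finset.mul_sum, Finset.mul_sum,
      ← Finset.sum_add_distrib]
    refine Finset.sum_congr rfl fun k _ => ?_
    rw [MvPolynomial.pderiv_mul]
    simp only [map_add, map_mul]
    ring

theorem plethysm_completeHomog_zero (g : SymmSeries) : plethysm (completeHomog 0) g = 1 := by
  simp [plethysm, completeHomog_zero]

theorem eulerDeriv_plethysm (n : ℕ) (g : SymmSeries) :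
    eulerDeriv (plethysm (completeHomog (n + 1)) g) =
      ∑ p ∈ antidiagonal n, adams p.1.succPNat (eulerDeriv g) * plethysm (completeHomog p.2) g := by
  rw [plethysm, derivation_aeval _ _ _ (completeHomog_mem_supported (n + 1)),
    Finset.sum_image fun x _ y _ h => Nat.succPNat_injective h,
    Finset.Nat.sum_antidiagonal_eq_sum_range_succ_mk]
  refine Finset.sum_congr rfl fun i hi => ?_
  have hsplit : n + 1 = (n - i) + (i.succPNat : ℕ) := by
    have hin := Finset.mem_range.mp hi
    rw [Nat.succPNat_coe]
    omega
  have hi0 : ((i.succPNat : ℕ) : ℂ) ≠ 0 := by exact_mod_cast i.succPNat.pos.ne'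
  conv_lhs => rw [hsplit]
  rw [pderiv_completeHomog_add, eulerDeriv_adams, map_smul, smul_mul_smul_comm, inv_mul_cancel₀ hi0,
    one_smul, mul_comm]
  rfl

theorem constantCoeff_plethysm_completeHomog_succ {g : SymmSeries} (hg : g ∈ degreeIdeal 1)
    (n : ℕ) :
    MvPowerSeries.constantCoeff (plethysm (completeHomog (n + 1)) g) = 0 := by
  have hadams (k : ℕ+) : MvPowerSeries.constantCoeff (adams k g) = 0 :=
    mem_degreeIdeal_one.mp (degreeIdeal_mono (Nat.le_mul_of_pos_left 1 k.pos)
      (adams_mem_degreeIdeal k hg))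
  rw [plethysm, MvPolynomial.map_aeval]
  simp only [hadams]
  rw [MvPolynomial.eval₂Hom_zero'_apply, MvPolynomial.constantCoeff_eq, coeff_completeHomog,
    if_neg (by simp), map_zero]

theorem plethysm_completeHomog_mem_degreeIdeal {g : SymmSeries} (hg : g ∈ degreeIdeal 1) (n : ℕ) :
    plethysm (completeHomog n) g ∈ degreeIdeal n := by
  induction n using Nat.strong_induction_on with
  | _ n ih =>
    rcases n with _ | n
    · intro m hm
      omega
    · refine mem_degreeIdeal_of_eulerDeriv ?_
        (mem_degreeIdeal_one.mpr (constantCoeff_plethysm_completeHomog_succ hg n))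
      rw [eulerDeriv_plethysm]
      refine Ideal.sum_mem _ fun p hp => ?_
      have hsum := Finset.HasAntidiagonal.mem_antidiagonal.mp hp
      refine degreeIdeal_mono ?_ (mul_mem_degreeIdeal
        (adams_mem_degreeIdeal p.1.succPNat (eulerDeriv_mem_degreeIdeal hg)) (ih p.2 (by omega)))
      rw [Nat.succPNat_coe]
      omega

theorem sum_antidiagonal_mul_sub_mem_degreeIdeal {a b : ℕ → SymmSeries}
    (ha : ∀ i, a i ∈ degreeIdeal (i + 1)) (hb : ∀ j, b j ∈ degreeIdeal j) (N : ℕ) :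
    ∑ m ∈ Finset.range N, ∑ p ∈ antidiagonal m, a p.1 * b p.2 -
      (∑ i ∈ Finset.range N, a i) * ∑ j ∈ Finset.range (N + 1), b j ∈ degreeIdeal (N + 1) := by
  have hlow : ∑ m ∈ Finset.range N, ∑ p ∈ antidiagonal m, a p.1 * b p.2 =
      ∑ p ∈ Finset.range N ×ˢ Finset.range (N + 1) with p.1 + p.2 < N, a p.1 * b p.2 := by
    rw [← Finset.sum_fiberwise_of_maps_to (t := Finset.range N) (g := fun p : ℕ × ℕ => p.1 + p.2)
      fun p hp => Finset.mem_range.mpr (Finset.mem_filter.mp hp).2]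
    refine Finset.sum_congr rfl fun m hm => Finset.sum_congr ?_ fun _ _ => rfl
    have hmN := Finset.mem_range.mp hm
    ext p
    simp only [Finset.HasAntidiagonal.mem_antidiagonal, Finset.mem_filter, Finset.mem_product,
      Finset.mem_range]
    omega
  rw [hlow, Finset.sum_mul_sum, ← Finset.sum_product',
    ← Finset.sum_filter_add_sum_filter_not (Finset.range N ×ˢ Finset.range (N + 1))
      (fun p => p.1 + p.2 < N), sub_add_cancel_left]
  refine (Ideal.neg_mem_iff _).mpr (Ideal.sum_mem _ fun p hp => ?_)
  have hhigh := (Finset.mem_filter.mp hp).2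
  exact degreeIdeal_mono (by omega) (mul_mem_degreeIdeal (ha p.1) (hb p.2))

/-- The truncation to `m ≤ N` of the series `∑_m ε^m h_m[g]`. -/
def homogSum (ε : ℂ) (g : SymmSeries) (N : ℕ) : SymmSeries :=
  ∑ m ∈ Finset.range (N + 1), ε ^ m • plethysm (completeHomog m) g

/-- The truncation to `k ≤ N` of the series `∑_{k ≥ 1} ε^k p_k[D g]`, the logarithmic derivative of
`∑_m ε^m h_m[g]` with respect to the Euler derivation `D`. -/
def adamsSum (ε : ℂ) (g : SymmSeries) (N : ℕ) : SymmSeries :=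
  ∑ i ∈ Finset.range N, ε ^ (i + 1) • adams i.succPNat (eulerDeriv g)

theorem eulerDeriv_homogSum (ε : ℂ) (g : SymmSeries) (N : ℕ) :
    eulerDeriv (homogSum ε g N) = ∑ m ∈ Finset.range N, ∑ p ∈ antidiagonal m,
      (ε ^ (p.1 + 1) • adams p.1.succPNat (eulerDeriv g)) *
        (ε ^ p.2 • plethysm (completeHomog p.2) g) := by
  rw [homogSum, Finset.sum_range_succ', map_add, map_sum, plethysm_completeHomog_zero]
  simp only [Derivation.map_smul, eulerDeriv_plethysm, Derivation.map_one_eq_zero, smul_zero,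
    add_zero, Finset.smul_sum]
  refine Finset.sum_congr rfl fun m _ => Finset.sum_congr rfl fun p hp => ?_
  rw [smul_mul_smul_comm, ← Finset.HasAntidiagonal.mem_antidiagonal.mp hp, ← pow_add,
    add_right_comm]

theorem eulerDeriv_homogSum_sub_mem_degreeIdeal (ε : ℂ) {g : SymmSeries} (hg : g ∈ degreeIdeal 1)
    (N : ℕ) :
    eulerDeriv (homogSum ε g N) - adamsSum ε g N * homogSum ε g N ∈ degreeIdeal (N + 1) := by
  rw [eulerDeriv_homogSum, adamsSum, homogSum]
  refine sum_antidiagonal_mul_sub_mem_degreeIdeal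
    (a := fun i => ε ^ (i + 1) • adams i.succPNat (eulerDeriv g))
    (b := fun j => ε ^ j • plethysm (completeHomog j) g) (fun i => ?_) (fun j => ?_) N
  · have hadams := adams_mem_degreeIdeal i.succPNat (eulerDeriv_mem_degreeIdeal hg)
    rw [mul_one, Nat.succPNat_coe] at hadams
    exact Submodule.smul_of_tower_mem _ _ hadams
  · exact Submodule.smul_of_tower_mem _ _ (plethysm_completeHomog_mem_degreeIdeal hg j)

end ChainRule

/-! ### Evaluation of `∑_m (± 1)^m h_m[Lie^{(2)}]` -/

section LieTwoSeries

theorem coeff_frobeniusChar_eq_zero {n : ℕ} {W : Type*} [AddCommGroup W] [Module ℂ W]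
    (ρ : Representation ℂ (Equiv.Perm (Fin n)) W) {w : ℕ+ →₀ ℕ} (hw : psDegree w ≠ n) :
    MvPolynomial.coeff w (frobeniusChar ρ) = 0 := by
  rw [frobeniusChar_eq_charSum, charSum, MvPolynomial.coeff_smul, MvPolynomial.coeff_sum,
    Finset.sum_eq_zero, smul_zero]
  intro σ _
  rw [cycleMonomial, powerSumPart_eq_monomial, MvPolynomial.coeff_smul, MvPolynomial.coeff_monomial,
    if_neg, smul_zero]
  rintro rfl
  exact hw ((psDegree_partExp σ.partition).trans (Fintype.card_fin n))

theorem coeff_lieTwoSeries (n : ℕ+) {w : ℕ+ →₀ ℕ} (hw : psDegree w = n) :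
    MvPowerSeries.coeff w lieTwoSeries =
      MvPolynomial.coeff w (frobeniusChar (lieTwoRep (n : ℕ))) := by
  change ∑ᶠ n : ℕ+, MvPolynomial.coeff w (frobeniusChar (lieTwoRep (n : ℕ))) = _
  refine finsum_eq_single _ n fun m hm => coeff_frobeniusChar_eq_zero _ fun hwm => ?_
  exact hm (PNat.coe_injective (hwm.symm.trans hw))

theorem lieTwoSeries_mem_degreeIdeal : lieTwoSeries ∈ degreeIdeal 1 := by
  intro w hw
  change ∑ᶠ n : ℕ+, MvPolynomial.coeff w (frobeniusChar (lieTwoRep (n : ℕ))) = 0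
  rw [finsum_congr fun n : ℕ+ => coeff_frobeniusChar_eq_zero (lieTwoRep (n : ℕ)) (w := w)
    (by have := n.pos; omega)]
  exact finsum_zero

theorem psDegree_single (d : ℕ+) (e : ℕ) : psDegree (Finsupp.single d e) = e * d := by
  rw [psDegree, Finsupp.weight_single, smul_eq_mul]

theorem coeff_eulerDeriv_lieTwoSeries (n : ℕ+) {w : ℕ+ →₀ ℕ} (hw : psDegree w = n) :
    MvPowerSeries.coeff w (eulerDeriv lieTwoSeries) =
      ∑ j : ZMod n, open Classical in
        if w = Finsupp.single (addOrderOf j).toPNat' (n / addOrderOf j) then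
          lieTwoCharacter n (Multiplicative.ofAdd j) else 0 := by
  rw [coeff_eulerDeriv, coeff_lieTwoSeries n hw, hw, coeff_frobeniusChar_lieTwoRep]

theorem coeff_eulerDeriv_lieTwoSeries_single (d : ℕ+) {e : ℕ} (he : e ≠ 0) :
    MvPowerSeries.coeff (Finsupp.single d e) (eulerDeriv lieTwoSeries) = lieCoeff d := by
  classical
  lift e to ℕ+ using Nat.pos_of_ne_zero he
  rw [coeff_eulerDeriv_lieTwoSeries (e * d) (psDegree_single d e),
    ← orderSum_eq_lieCoeff (e * d : ℕ+) d (by rw [PNat.mul_coe]; exact Nat.dvd_mul_left _ _),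
    orderSum, Finset.sum_filter]
  refine Finset.sum_congr rfl fun j _ => ?_
  have hiff : Finsupp.single d (e : ℕ) =
      Finsupp.single (addOrderOf j).toPNat' ((e * d : ℕ+) / addOrderOf j) ↔ addOrderOf j = d := by
    refine ⟨fun h => ?_, fun h => ?_⟩
    · have hd := (Finsupp.single_eq_single_iff ..).mp h |>.resolve_right fun h0 => he h0.1
      rw [congrArg PNat.val hd.1, Nat.toPNat'_coe, if_pos (addOrderOf_pos j)]
    · rw [h, PNat.coe_toPNat', PNat.mul_coe, Nat.mul_div_cancel _ d.pos]
  simp only [hiff]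

theorem coeff_eulerDeriv_lieTwoSeries_eq_zero {w : ℕ+ →₀ ℕ}
    (hw : ∀ d e, e ≠ 0 → w ≠ Finsupp.single d e) :
    MvPowerSeries.coeff w (eulerDeriv lieTwoSeries) = 0 := by
  rcases Nat.eq_zero_or_pos (psDegree w) with h0 | hpos
  · rw [coeff_eulerDeriv, h0, Nat.cast_zero, zero_mul]
  · obtain ⟨n, hn⟩ : ∃ n : ℕ+, psDegree w = n := ⟨⟨_, hpos⟩, rfl⟩
    rw [coeff_eulerDeriv_lieTwoSeries n hn]
    refine Finset.sum_eq_zero fun j _ => if_neg (hw _ _ ?_)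
    have hdvd : addOrderOf j ∣ n := by simpa only [ZMod.card] using addOrderOf_dvd_card (x := j)
    exact (Nat.div_pos (Nat.le_of_dvd n.pos hdvd) (addOrderOf_pos j)).ne'

end LieTwoSeries

section TwistedWeight

/-- The coefficient of every power `p_m^e`, `e ≥ 1`, in `∑_{k ≥ 1} ε^k p_k[D Lie^{(2)}]`, which has
no other terms. -/
def twistedWeight (ε : ℂ) (m : ℕ+) : ℂ :=
  ∑ k ∈ (m : ℕ).divisors, ε ^ k * lieCoeff ((m : ℕ) / k).toPNat'

theorem coeff_adams_eulerDeriv_lieTwoSeries_single (k m : ℕ+) {e : ℕ} (he : e ≠ 0) :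
    MvPowerSeries.coeff (Finsupp.single m e) (adams k (eulerDeriv lieTwoSeries)) =
      if (k : ℕ) ∣ m then lieCoeff ((m : ℕ) / k).toPNat' else 0 := by
  split_ifs with hkm
  · obtain ⟨c, rfl⟩ := PNat.dvd_iff.mpr hkm
    have hsingle : Finsupp.single (k * c) e =
        Finsupp.embDomain (mulEmb k) (Finsupp.single c e) := by
      rw [Finsupp.embDomain_single]
      rfl
    rw [hsingle, coeff_adams, coeff_eulerDeriv_lieTwoSeries_single c he, PNat.mul_coe,
      Nat.mul_div_cancel_left _ k.pos, PNat.coe_toPNat']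
  · refine coeff_adams_eq_zero _ _ _ fun v hv => hkm ?_
    have hm : m ∈ (Finsupp.embDomain (mulEmb k) v).support := by
      rw [hv, Finsupp.support_single _ he, Finset.mem_singleton]
    rw [Finsupp.support_embDomain, Finset.mem_map] at hm
    obtain ⟨c, -, rfl⟩ := hm
    exact PNat.dvd_iff.mp (Dvd.intro c rfl)

theorem coeff_adamsSum_single (ε : ℂ) {N : ℕ} (m : ℕ+) {e : ℕ} (he : e ≠ 0) (hmN : (m : ℕ) ≤ N) :
    MvPowerSeries.coeff (Finsupp.single m e) (adamsSum ε lieTwoSeries N) = twistedWeight ε m := by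
  rw [adamsSum, map_sum, twistedWeight]
  simp_rw [MvPowerSeries.coeff_smul, coeff_adams_eulerDeriv_lieTwoSeries_single _ m he, mul_ite,
    mul_zero]
  rw [← Finset.sum_filter]
  refine Finset.sum_bij (fun i _ => i + 1) (fun i hi => ?_) (fun i _ j _ h => Nat.succ_injective h)
    (fun k hk => ?_) fun i _ => rfl
  · exact Nat.mem_divisors.mpr ⟨(Finset.mem_filter.mp hi).2, m.pos.ne'⟩
  · have hkm := Nat.dvd_of_mem_divisors hk
    have hk0 := Nat.pos_of_mem_divisors hk
    have hkN := (Nat.le_of_dvd m.pos hkm).trans hmN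
    refine ⟨k - 1, ?_, by omega⟩
    rw [Finset.mem_filter, Finset.mem_range, Nat.succPNat_coe, Nat.succ_eq_add_one,
      Nat.sub_add_cancel hk0]
    exact ⟨by omega, hkm⟩

theorem coeff_adamsSum_eq_zero (ε : ℂ) (N : ℕ) {w : ℕ+ →₀ ℕ}
    (hw : ∀ m e, e ≠ 0 → w ≠ Finsupp.single m e) :
    MvPowerSeries.coeff w (adamsSum ε lieTwoSeries N) = 0 := by
  rw [adamsSum, map_sum]
  refine Finset.sum_eq_zero fun i _ => ?_
  rw [MvPowerSeries.coeff_smul]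
  by_cases h : ∃ v, Finsupp.embDomain (mulEmb i.succPNat) v = w
  · obtain ⟨v, rfl⟩ := h
    rw [coeff_adams, coeff_eulerDeriv_lieTwoSeries_eq_zero, mul_zero]
    rintro d e he rfl
    exact hw _ e he (Finsupp.embDomain_single _ _ _)
  · push Not at h
    rw [coeff_adams_eq_zero _ _ _ h, mul_zero]

theorem adamsSum_mem_degreeIdeal (ε : ℂ) (N : ℕ) : adamsSum ε lieTwoSeries N ∈ degreeIdeal 1 := by
  intro w hw
  rw [psDegree_eq_zero_iff.mp (Nat.lt_one_iff.mp hw)]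
  exact coeff_adamsSum_eq_zero ε N fun m e he h => he (Finsupp.single_eq_zero.mp h.symm)

theorem twistedWeight_one (m : ℕ+) : twistedWeight 1 m = powTwoWeight m := by
  rw [← sum_divisors_lieCoeff, twistedWeight]
  simp only [one_pow, one_mul]
  exact Nat.sum_div_divisors (m : ℕ) fun d => lieCoeff d.toPNat'

theorem powTwoWeight_two_mul (m : ℕ) : powTwoWeight (2 * m) = 2 * powTwoWeight m := by
  rcases eq_or_ne m 0 with rfl | -
  · simp [powTwoWeight]
  · have hiff : (∃ a : ℕ, 2 * m = 2 ^ a) ↔ ∃ a : ℕ, m = 2 ^ a := by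
      refine ⟨fun ⟨a, ha⟩ => ?_, fun ⟨a, ha⟩ => ⟨a + 1, by rw [ha, pow_succ']⟩⟩
      rcases a with _ | a
      · omega
      · exact ⟨a, by rw [pow_succ] at ha; omega⟩
    rw [powTwoWeight, powTwoWeight, mul_ite, mul_zero, Nat.cast_mul, Nat.cast_two]
    classical exact if_congr hiff rfl rfl

theorem powTwoWeight_of_odd {m : ℕ} (hm : Odd m) : powTwoWeight m = if m = 1 then 1 else 0 := by
  have hiff : (∃ a : ℕ, m = 2 ^ a) ↔ m = 1 := by
    refine ⟨?_, fun h => ⟨0, h⟩⟩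
    rintro ⟨_ | a, rfl⟩
    · rfl
    · exact absurd hm (Nat.not_odd_iff_even.mpr ((even_two.pow_of_ne_zero a.succ_ne_zero)))
  simp only [powTwoWeight, hiff]
  split_ifs with h
  · rw [h, Nat.cast_one]
  · rfl

theorem filter_even_divisors_two_mul (c : ℕ) :
    ((2 * c).divisors.filter Even) = c.divisors.image (2 * ·) := by
  ext k
  simp only [Finset.mem_filter, Finset.mem_image, Nat.mem_divisors]
  constructor
  · rintro ⟨⟨hk, hc⟩, hk2⟩
    obtain ⟨k, rfl⟩ := hk2.two_dvd
    exact ⟨k, ⟨Nat.dvd_of_mul_dvd_mul_left two_pos hk, by omega⟩, rfl⟩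
  · rintro ⟨k, ⟨hk, hc⟩, rfl⟩
    exact ⟨⟨mul_dvd_mul_left 2 hk, by omega⟩, even_two_mul k⟩

theorem twistedWeight_neg_one_two_mul (c : ℕ+) : twistedWeight (-1) (2 * c) = 0 := by
  have hparity : twistedWeight (-1) (2 * c) + twistedWeight 1 (2 * c) =
      ∑ k ∈ ((2 * c : ℕ+) : ℕ).divisors with Even k,
        2 * lieCoeff (((2 * c : ℕ+) : ℕ) / k).toPNat' := by
    rw [twistedWeight, twistedWeight, ← Finset.sum_add_distrib, Finset.sum_filter]
    refine Finset.sum_congr rfl fun k _ => ?_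
    split_ifs with hk
    · rw [hk.neg_one_pow, one_pow, one_mul, two_mul]
    · rw [(Nat.not_even_iff_odd.mp hk).neg_one_pow, one_pow, neg_one_mul, one_mul, neg_add_cancel]
  have heven : ∑ k ∈ ((2 * c : ℕ+) : ℕ).divisors with Even k,
      2 * lieCoeff (((2 * c : ℕ+) : ℕ) / k).toPNat' = 2 * twistedWeight 1 c := by
    rw [PNat.mul_coe, PNat.val_ofNat, filter_even_divisors_two_mul,
      Finset.sum_image fun i _ j _ h => Nat.eq_of_mul_eq_mul_left two_pos h, twistedWeight,
      Finset.mul_sum]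
    refine Finset.sum_congr rfl fun k _ => ?_
    rw [one_pow, one_mul, Nat.mul_div_mul_left _ _ two_pos]
  rw [heven, twistedWeight_one, twistedWeight_one, PNat.mul_coe, PNat.val_ofNat,
    powTwoWeight_two_mul] at hparity
  exact add_eq_right.mp hparity

theorem twistedWeight_neg_one_of_odd {m : ℕ+} (hm : Odd (m : ℕ)) :
    twistedWeight (-1) m = -powTwoWeight m := by
  rw [← twistedWeight_one, twistedWeight, twistedWeight, ← Finset.sum_neg_distrib]
  refine Finset.sum_congr rfl fun k hk => ?_
  rw [(hm.of_dvd_nat (Nat.dvd_of_mem_divisors hk)).neg_one_pow, one_pow, one_mul, neg_one_mul]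

theorem twistedWeight_neg_one (m : ℕ+) : twistedWeight (-1) m = if m = 1 then -1 else 0 := by
  rcases Nat.even_or_odd (m : ℕ) with hm | hm
  · obtain ⟨c, rfl⟩ : (2 : ℕ+) ∣ m := PNat.dvd_iff.mpr hm.two_dvd
    have hne : 2 * c ≠ 1 := fun h => by
      have hval := congrArg PNat.val h
      rw [PNat.mul_coe, PNat.val_ofNat, PNat.val_ofNat] at hval
      omega
    rw [twistedWeight_neg_one_two_mul, if_neg hne]
  · rw [twistedWeight_neg_one_of_odd hm, powTwoWeight_of_odd hm]
    simp only [PNat.coe_eq_one_iff]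
    split_ifs
    · rfl
    · exact neg_zero

end TwistedWeight

section DifferentialEquation

theorem coeff_mul_eq_sum_single {ι R : Type*} [Semiring R] {S : MvPowerSeries ι R}
    {c : ι → R} {w : ι →₀ ℕ}
    (hsingle : ∀ m e, e ≠ 0 → Finsupp.single m e ≤ w →
      MvPowerSeries.coeff (Finsupp.single m e) S = c m)
    (hzero : ∀ v, (∀ m e, e ≠ 0 → v ≠ Finsupp.single m e) → MvPowerSeries.coeff v S = 0)
    (Q : MvPowerSeries ι R) :
    MvPowerSeries.coeff w (S * Q) = ∑ m ∈ w.support, c m *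
      ∑ e ∈ Finset.range (w m), MvPowerSeries.coeff (w - Finsupp.single m (e + 1)) Q := by
  classical
  have hle {x : Σ _ : ι, ℕ} (hx : x ∈ w.support.sigma fun m => Finset.range (w m)) :
      Finsupp.single x.1 (x.2 + 1) ≤ w :=
    Finsupp.single_le_iff.mpr (Finset.mem_range.mp (Finset.mem_sigma.mp hx).2)
  simp only [Finset.mul_sum]
  rw [MvPowerSeries.coeff_mul, Finset.sum_sigma']
  symm
  refine Finset.sum_of_injOn
    (fun x => (Finsupp.single x.1 (x.2 + 1), w - Finsupp.single x.1 (x.2 + 1)))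
    ?_ (fun x hx => ?_) (fun p hp hnot => ?_) fun x hx => ?_
  · rintro ⟨m, e⟩ - ⟨m', e'⟩ - h
    obtain ⟨hm, he⟩ := ((Finsupp.single_eq_single_iff ..).mp (congrArg Prod.fst h)).resolve_right
      fun h0 => e.succ_ne_zero h0.1
    exact Sigma.ext hm (heq_of_eq (Nat.succ_injective he))
  · exact Finset.HasAntidiagonal.mem_antidiagonal.mpr
      (add_tsub_cancel_of_le (hle (Finset.mem_coe.mp hx)))
  · rw [hzero p.1, zero_mul]
    intro m e he hpe
    have hpw := Finset.HasAntidiagonal.mem_antidiagonal.mp hp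
    have hem : e ≤ w m := Finsupp.single_le_iff.mp (hpe ▸ hpw ▸ le_self_add)
    obtain ⟨e, rfl⟩ := Nat.exists_eq_succ_of_ne_zero he
    refine hnot ⟨⟨m, e⟩, ?_, Prod.ext hpe.symm ?_⟩
    · rw [Finset.mem_coe, Finset.mem_sigma, Finset.mem_range, Finsupp.mem_support_iff]
      exact ⟨Nat.ne_zero_of_lt hem, hem⟩
    · dsimp only
      rw [← hpw, hpe, add_tsub_cancel_left]
  · rw [hsingle x.1 (x.2 + 1) x.2.succ_ne_zero (hle hx)]

theorem coeff_adamsSum_mul (ε : ℂ) {N : ℕ} (Q : SymmSeries) {w : ℕ+ →₀ ℕ} (hw : psDegree w ≤ N) :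
    MvPowerSeries.coeff w (adamsSum ε lieTwoSeries N * Q) = ∑ m ∈ w.support, twistedWeight ε m *
      ∑ e ∈ Finset.range (w m), MvPowerSeries.coeff (w - Finsupp.single m (e + 1)) Q := by
  refine coeff_mul_eq_sum_single (fun m e he hle => ?_) (fun v => coeff_adamsSum_eq_zero ε N) Q
  refine coeff_adamsSum_single ε m he (le_trans ?_ hw)
  rw [← add_tsub_cancel_of_le hle, map_add, psDegree_single]
  exact (Nat.le_mul_of_pos_left _ (Nat.pos_of_ne_zero he)).trans le_self_add

/-- The sum of all monomials in the `p_{2^a}`, that is `∏_a (1 - p_{2^a})⁻¹`. -/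
def powTwoSeries : SymmSeries :=
  fun w => open Classical in if ∀ k ∈ w.support, ∃ a : ℕ, (k : ℕ) = 2 ^ a then 1 else 0

theorem coeff_powTwoSeries (w : ℕ+ →₀ ℕ) : MvPowerSeries.coeff w powTwoSeries =
    open Classical in if ∀ k ∈ w.support, ∃ a : ℕ, (k : ℕ) = 2 ^ a then 1 else 0 := rfl

theorem powTwoWeight_mul_coeff_tsub_powTwoSeries {w : ℕ+ →₀ ℕ} {m : ℕ+} (hm : m ∈ w.support)
    (e : ℕ) :
    powTwoWeight m * MvPowerSeries.coeff (w - Finsupp.single m e) powTwoSeries =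
      m * MvPowerSeries.coeff w powTwoSeries := by
  by_cases hm2 : ∃ a : ℕ, (m : ℕ) = 2 ^ a
  · have hiff : (∀ k ∈ (w - Finsupp.single m e).support, ∃ a : ℕ, (k : ℕ) = 2 ^ a) ↔
        ∀ k ∈ w.support, ∃ a : ℕ, (k : ℕ) = 2 ^ a := by
      refine ⟨fun h k hk => ?_, fun h k hk => h k (Finsupp.support_tsub hk)⟩
      rcases eq_or_ne k m with rfl | hkm
      · exact hm2
      · refine h k ?_
        rwa [Finsupp.mem_support_iff, Finsupp.tsub_apply, Finsupp.single_eq_of_ne hkm, tsub_zero,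
          ← Finsupp.mem_support_iff]
    rw [powTwoWeight, if_pos hm2, coeff_powTwoSeries, coeff_powTwoSeries]
    classical exact congrArg _ (if_congr hiff rfl rfl)
  · rw [powTwoWeight, if_neg hm2, zero_mul, coeff_powTwoSeries w, if_neg fun h => hm2 (h m hm),
      mul_zero]

theorem eulerDeriv_powTwoSeries (N : ℕ) :
    eulerDeriv powTwoSeries - adamsSum 1 lieTwoSeries N * powTwoSeries ∈ degreeIdeal (N + 1) := by
  intro w hw
  rw [map_sub, sub_eq_zero, coeff_eulerDeriv, coeff_adamsSum_mul 1 _ (Nat.lt_succ_iff.mp hw),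
    psDegree, Finsupp.weight_apply, Finsupp.sum, Nat.cast_sum, Finset.sum_mul]
  refine Finset.sum_congr rfl fun m hm => ?_
  rw [twistedWeight_one, Finset.mul_sum,
    Finset.sum_congr rfl fun e _ => powTwoWeight_mul_coeff_tsub_powTwoSeries hm (e + 1),
    Finset.sum_const, Finset.card_range, smul_eq_mul, nsmul_eq_mul, Nat.cast_mul, mul_assoc]

theorem sum_range_coeff_tsub_one_sub_X {ι R : Type*} [Ring R] (i : ι) {w : ι →₀ ℕ} {n : ℕ}
    (hn : n ≤ w i) : ∑ e ∈ Finset.range n,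
      MvPowerSeries.coeff (w - Finsupp.single i (e + 1))
          (1 - MvPowerSeries.X i : MvPowerSeries ι R) =
      MvPowerSeries.coeff w (MvPowerSeries.X i) -
        MvPowerSeries.coeff w (MvPowerSeries.X i ^ (n + 1)) := by
  classical
  have htelescope (e : ℕ) (he : e < n) :
      MvPowerSeries.coeff (w - Finsupp.single i (e + 1)) (1 - MvPowerSeries.X i) =
        MvPowerSeries.coeff w (MvPowerSeries.X i ^ (e + 1) : MvPowerSeries ι R) -
          MvPowerSeries.coeff w (MvPowerSeries.X i ^ (e + 2)) := by
    have hle : Finsupp.single i (e + 1) ≤ w := Finsupp.single_le_iff.mpr (by omega)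
    have hmul := MvPowerSeries.coeff_add_monomial_mul (Finsupp.single i (e + 1))
      (w - Finsupp.single i (e + 1)) (1 - MvPowerSeries.X i) (1 : R)
    rw [add_tsub_cancel_of_le hle, one_mul, ← MvPowerSeries.X_pow_eq, mul_sub, mul_one,
      ← pow_succ, map_sub (MvPowerSeries.coeff w)] at hmul
    exact hmul.symm
  rw [Finset.sum_congr rfl fun e he => htelescope e (Finset.mem_range.mp he),
    Finset.sum_range_sub' fun e => MvPowerSeries.coeff w (MvPowerSeries.X i ^ (e + 1)), zero_add,
    pow_one]

theorem eulerDeriv_one_sub_X (N : ℕ) :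
    eulerDeriv (1 - MvPowerSeries.X 1) - adamsSum (-1) lieTwoSeries N * (1 - MvPowerSeries.X 1) ∈
      degreeIdeal (N + 1) := by
  classical
  intro w hw
  have hX : (psDegree w : ℂ) * MvPowerSeries.coeff w (MvPowerSeries.X 1) =
      MvPowerSeries.coeff w (MvPowerSeries.X 1) := by
    rw [MvPowerSeries.coeff_X]
    split_ifs with h
    · rw [h, psDegree_single, PNat.one_coe, mul_one, Nat.cast_one]
    · rw [mul_zero]
  have hpow : MvPowerSeries.coeff w (MvPowerSeries.X 1 ^ (w 1 + 1) : SymmSeries) = 0 := by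
    rw [MvPowerSeries.coeff_X_pow, if_neg]
    exact fun h => Nat.succ_ne_self (w 1) (by conv_rhs => rw [h, Finsupp.single_eq_same])
  have hderiv : (psDegree w : ℂ) * MvPowerSeries.coeff w (1 : SymmSeries) = 0 := by
    rw [MvPowerSeries.coeff_one, mul_ite, mul_zero, mul_one]
    split_ifs with h
    · rw [h, map_zero, Nat.cast_zero]
    · rfl
  rw [map_sub, sub_eq_zero, coeff_eulerDeriv, map_sub, mul_sub, hX, hderiv,
    coeff_adamsSum_mul _ _ (Nat.lt_succ_iff.mp hw)]
  simp only [twistedWeight_neg_one, ite_mul, zero_mul]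
  rw [Finset.sum_ite_eq', sum_range_coeff_tsub_one_sub_X 1 le_rfl, hpow, sub_zero, neg_one_mul,
    zero_sub]
  split_ifs with h
  · rfl
  · rw [MvPowerSeries.coeff_X, if_neg, neg_zero]
    rintro rfl
    exact h (by simp)

theorem homogSum_sub_mem_degreeIdeal (ε : ℂ) (N : ℕ) {Q : SymmSeries}
    (hQ : eulerDeriv Q - adamsSum ε lieTwoSeries N * Q ∈ degreeIdeal (N + 1))
    (hQ0 : MvPowerSeries.constantCoeff Q = 1) :
    homogSum ε lieTwoSeries N - Q ∈ degreeIdeal (N + 1) := by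
  refine sub_mem_degreeIdeal_of_eulerDeriv (adamsSum_mem_degreeIdeal ε N)
    (eulerDeriv_homogSum_sub_mem_degreeIdeal ε lieTwoSeries_mem_degreeIdeal N) hQ ?_
  rw [mem_degreeIdeal_one, map_sub, hQ0, homogSum, Finset.sum_range_succ', map_add, map_sum,
    plethysm_completeHomog_zero, Finset.sum_eq_zero]
  · simp
  · intro m _
    rw [MvPowerSeries.constantCoeff_smul,
      constantCoeff_plethysm_completeHomog_succ lieTwoSeries_mem_degreeIdeal, smul_zero]

end DifferentialEquation
/-! ### Characteristics and isomorphisms of the modules `Vh` -/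

section Characteristics

theorem card_parts_eq_degree {n : ℕ} (ν : n.Partition) : ν.parts.card = (partExp ν).degree := by
  rw [partExp, Finsupp.degree_apply]
  exact (Multiset.toFinsupp_sum_eq _).trans (Multiset.card_map _ _) |>.symm

theorem coeff_sum_powerSumPart {n : ℕ} (S : Finset n.Partition) (w : ℕ+ →₀ ℕ) :
    MvPolynomial.coeff w (∑ ν ∈ S, powerSumPart ν) =
      open Classical in if ∃ ν ∈ S, partExp ν = w then 1 else 0 := by
  classical
  simp_rw [MvPolynomial.coeff_sum, powerSumPart_eq_monomial, MvPolynomial.coeff_monomial]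
  split_ifs with h
  · obtain ⟨ν, hν, rfl⟩ := h
    rw [Finset.sum_eq_single_of_mem ν hν, if_pos rfl]
    exact fun μ _ hμν => if_neg fun heq => hμν (partExp_injective heq)
  · exact Finset.sum_eq_zero fun ν hν => if_neg fun heq => h ⟨ν, hν, heq⟩

theorem partsPowTwo_iff {n : ℕ} (ν : n.Partition) :
    PartsPowTwo ν ↔ ∀ k ∈ (partExp ν).support, ∃ a : ℕ, (k : ℕ) = 2 ^ a := by
  constructor
  · intro h k hk
    rw [Finsupp.mem_support_iff, partExp_apply, Multiset.count_ne_zero] at hk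
    exact h _ hk
  · intro h i hi
    obtain ⟨k, rfl⟩ : ∃ k : ℕ+, (k : ℕ) = i := ⟨⟨i, ν.parts_pos hi⟩, rfl⟩
    refine h k ?_
    rw [Finsupp.mem_support_iff, partExp_apply]
    exact Multiset.count_ne_zero.mpr hi

theorem coeff_sumPowTwo (n : ℕ) (w : ℕ+ →₀ ℕ) : MvPolynomial.coeff w (sumPowTwo n) =
    if psDegree w = n then MvPowerSeries.coeff w powTwoSeries else 0 := by
  classical
  rw [sumPowTwo, coeff_sum_powerSumPart, coeff_powTwoSeries, ← ite_and]
  refine if_congr ⟨?_, ?_⟩ rfl rfl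
  · rintro ⟨ν, hν, rfl⟩
    exact ⟨psDegree_partExp ν, (partsPowTwo_iff ν).mp (Finset.mem_filter.mp hν).2⟩
  · rintro ⟨hdeg, hpow⟩
    obtain ⟨ν, rfl⟩ := exists_partExp_eq hdeg
    exact ⟨ν, Finset.mem_filter.mpr ⟨Finset.mem_univ _, (partsPowTwo_iff ν).mpr hpow⟩, rfl⟩

theorem card_parts_le {n : ℕ} (ν : n.Partition) : ν.parts.card ≤ n := by
  simpa only [smul_eq_mul, mul_one, ν.parts_sum] using
    Multiset.card_nsmul_le_sum (s := ν.parts) (a := 1) fun _ hi => ν.parts_pos hi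

theorem even_sub_card_parts_iff {n : ℕ} (ν : n.Partition) :
    Even (n - ν.parts.card) ↔ Even (n + (partExp ν).degree) := by
  rw [← card_parts_eq_degree, Nat.even_sub (card_parts_le ν), Nat.even_add]

theorem coeff_sumPowTwoEven (n : ℕ) (w : ℕ+ →₀ ℕ) : MvPolynomial.coeff w (sumPowTwoEven n) =
    if Even (n + w.degree) then MvPolynomial.coeff w (sumPowTwo n) else 0 := by
  classical
  rw [coeff_sumPowTwo, sumPowTwoEven, coeff_sum_powerSumPart, coeff_powTwoSeries, ← ite_and,
    ← ite_and]
  refine if_congr ⟨?_, ?_⟩ rfl rfl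
  · rintro ⟨ν, hν, rfl⟩
    obtain ⟨hpow, heven⟩ := (Finset.mem_filter.mp hν).2
    exact ⟨⟨(even_sub_card_parts_iff ν).mp heven, psDegree_partExp ν⟩, (partsPowTwo_iff ν).mp hpow⟩
  · rintro ⟨⟨heven, hdeg⟩, hpow⟩
    obtain ⟨ν, rfl⟩ := exists_partExp_eq hdeg
    exact ⟨ν, Finset.mem_filter.mpr ⟨Finset.mem_univ _, (partsPowTwo_iff ν).mpr hpow,
      (even_sub_card_parts_iff ν).mpr heven⟩, rfl⟩

theorem cycleMonomial_permSucc (m : ℕ) (σ : Equiv.Perm (Fin m)) :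
    cycleMonomial (permSucc m σ) = MvPolynomial.X 1 * cycleMonomial σ := by
  have hcycleType : (permSucc m σ).cycleType = σ.cycleType :=
    @Equiv.Perm.cycleType_extendDomain _ _ _ _ _ _ _ (fun _ => Classical.propDecidable _) _ _
  have hle := Equiv.Perm.sum_cycleType_le σ
  rw [Fintype.card_fin] at hle
  rw [cycleMonomial_eq_prod_cycleType, cycleMonomial_eq_prod_cycleType, hcycleType,
    Fintype.card_fin, Fintype.card_fin, Nat.succ_sub hle, pow_succ', mul_left_comm]

theorem frobeniusChar_ind_permSucc (m : ℕ) {W : Type*} [AddCommGroup W] [Module ℂ W]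
    [FiniteDimensional ℂ W] (ρ : Representation ℂ (Equiv.Perm (Fin m)) W) :
    frobeniusChar (Representation.ind (permSucc m) ρ) = MvPolynomial.X 1 * frobeniusChar ρ := by
  rw [frobeniusChar_ind, frobeniusChar_eq_charSum, charSum, Fintype.card_perm, Fintype.card_fin,
    mul_smul_comm, Finset.mul_sum]
  simp_rw [cycleMonomial_permSucc, mul_smul_comm]

theorem psDegree_tsub_single_add {w : ℕ+ →₀ ℕ} {m : ℕ+} (hm : m ∈ w.support) :
    psDegree (w - Finsupp.single m 1) + m = psDegree w := by
  have hle : Finsupp.single m 1 ≤ w :=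
    Finsupp.single_le_iff.mpr (Nat.one_le_iff_ne_zero.mpr (Finsupp.mem_support_iff.mp hm))
  conv_rhs => rw [← tsub_add_cancel_of_le hle, map_add, psDegree_single, one_mul]

theorem coeff_tsub_single_one_powTwoSeries {w : ℕ+ →₀ ℕ} (hw : 1 ∈ w.support) :
    MvPowerSeries.coeff (w - Finsupp.single 1 1) powTwoSeries =
      MvPowerSeries.coeff w powTwoSeries := by
  have h := powTwoWeight_mul_coeff_tsub_powTwoSeries hw 1
  rwa [PNat.one_coe, powTwoWeight_of_odd odd_one, if_pos rfl, Nat.cast_one, one_mul, one_mul] at h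

theorem even_psDegree_of_forall_pow_two {w : ℕ+ →₀ ℕ} (hw : 1 ∉ w.support)
    (hpow : ∀ k ∈ w.support, ∃ a : ℕ, (k : ℕ) = 2 ^ a) : Even (psDegree w) := by
  rw [psDegree, Finsupp.weight_apply, even_iff_two_dvd]
  refine Finset.dvd_sum fun k hk => Dvd.dvd.mul_left ?_ _
  obtain ⟨_ | a, ha⟩ := hpow k hk
  · exact absurd (PNat.coe_eq_one_iff.mp ha ▸ hk) hw
  · exact ⟨2 ^ a, by rw [ha, pow_succ']⟩

theorem sumPowTwo_two_mul_add_one (n : ℕ) :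
    sumPowTwo (2 * n + 1) = MvPolynomial.X 1 * sumPowTwo (2 * n) := by
  classical
  ext w
  rw [MvPolynomial.coeff_X_mul', coeff_sumPowTwo]
  by_cases hw : 1 ∈ w.support
  · have hdeg := psDegree_tsub_single_add hw
    rw [if_pos hw, coeff_sumPowTwo, coeff_tsub_single_one_powTwoSeries hw, ← hdeg, PNat.one_coe]
    exact if_congr Nat.succ_inj rfl rfl
  · rw [if_neg hw, ite_eq_right_iff]
    intro hdeg
    rw [coeff_powTwoSeries, if_neg]
    intro hpow
    have heven := even_psDegree_of_forall_pow_two hw hpow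
    rw [hdeg] at heven
    exact Nat.not_even_two_mul_add_one n heven

theorem sign_eq_neg_one_pow_degree_partExp {α : Type*} [Fintype α] [DecidableEq α]
    (σ : Equiv.Perm α) :
    Equiv.Perm.sign σ = (-1) ^ (Fintype.card α + (partExp σ.partition).degree) := by
  have hle := Equiv.Perm.sum_cycleType_le σ
  rw [← card_parts_eq_degree, Equiv.Perm.parts_partition, Equiv.Perm.sign_of_cycleType,
    Multiset.card_add, Multiset.card_replicate, ← Equiv.Perm.sum_cycleType,
    show Fintype.card α + (σ.cycleType.card + (Fintype.card α - σ.cycleType.sum)) =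
      σ.cycleType.sum + σ.cycleType.card + 2 * (Fintype.card α - σ.cycleType.sum) by omega,
    pow_add _ _ (2 * _), (even_two_mul _).neg_one_pow, mul_one]

theorem coeff_charSum_sign_mul {n : ℕ} (φ : Equiv.Perm (Fin n) → ℂ) (w : ℕ+ →₀ ℕ) :
    MvPolynomial.coeff w (charSum fun σ => ((Equiv.Perm.sign σ : ℤ) : ℂ) * φ σ) =
      (-1) ^ (n + w.degree) * MvPolynomial.coeff w (charSum φ) := by
  classical
  rw [charSum, charSum, MvPolynomial.coeff_smul, MvPolynomial.coeff_smul, MvPolynomial.coeff_sum,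
    MvPolynomial.coeff_sum, smul_eq_mul, smul_eq_mul, mul_left_comm, Finset.mul_sum (a := (-1) ^ _)]
  congr 1
  refine Finset.sum_congr rfl fun σ _ => ?_
  rw [MvPolynomial.coeff_smul, MvPolynomial.coeff_smul, cycleMonomial, powerSumPart_eq_monomial,
    MvPolynomial.coeff_monomial]
  split_ifs with h
  · rw [sign_eq_neg_one_pow_degree_partExp, h, Fintype.card_fin]
    push_cast
    rw [smul_eq_mul, smul_eq_mul, mul_assoc]
  · rw [smul_zero, smul_zero, mul_zero]

end Characteristics

section Family

variable {n : ℕ} {W : Fin (n + 1) → Type u} [∀ r, AddCommGroup (W r)] [∀ r, Module ℂ (W r)]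
  {ρ : ∀ r, Representation ℂ (Equiv.Perm (Fin n)) (W r)}

theorem IsVhFamily.coeff_sum (hρ : IsVhFamily ρ) (ε : ℂ) {Q : SymmSeries}
    (hQ : eulerDeriv Q - adamsSum ε lieTwoSeries n * Q ∈ degreeIdeal (n + 1))
    (h0 : MvPowerSeries.constantCoeff Q = 1) (w : ℕ+ →₀ ℕ) :
    ∑ r : Fin (n + 1), ε ^ (n - (r : ℕ)) * MvPolynomial.coeff w (frobeniusChar (ρ r)) =
      if psDegree w = n then MvPowerSeries.coeff w Q else 0 := by
  split_ifs with h
  · have hsum := homogSum_sub_mem_degreeIdeal ε n hQ h0 w (by omega)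
    rw [map_sub, sub_eq_zero, homogSum, map_sum, ← Finset.sum_range_reflect] at hsum
    rw [← hsum, ← Fin.sum_univ_eq_sum_range (fun j => MvPowerSeries.coeff w (ε ^ (n + 1 - 1 - j) •
      plethysm (completeHomog (n + 1 - 1 - j)) lieTwoSeries))]
    refine Finset.sum_congr rfl fun r _ => ?_
    rw [← MvPolynomial.coeff_coe, (hρ r).2, MvPowerSeries.coeff_smul]
    congr 1
    exact if_pos h
  · exact Finset.sum_eq_zero fun r _ => by rw [coeff_frobeniusChar_eq_zero _ h, mul_zero]

theorem IsVhFamily.sum_frobeniusChar (hρ : IsVhFamily ρ) :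
    ∑ r, frobeniusChar (ρ r) = sumPowTwo n := by
  ext w
  rw [coeff_sumPowTwo, ← hρ.coeff_sum 1 (eulerDeriv_powTwoSeries n), MvPolynomial.coeff_sum]
  · simp
  · rw [← MvPowerSeries.coeff_zero_eq_constantCoeff_apply, coeff_powTwoSeries, if_pos (by simp)]

theorem coeff_one_sub_X_one_eq_zero {w : ℕ+ →₀ ℕ} (hw : 2 ≤ psDegree w) :
    MvPowerSeries.coeff w (1 - MvPowerSeries.X 1 : SymmSeries) = 0 := by
  classical
  rw [map_sub, MvPowerSeries.coeff_one, MvPowerSeries.coeff_X, if_neg, if_neg, sub_zero]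
  · rintro rfl
    rw [psDegree_single, PNat.one_coe] at hw
    omega
  · rintro rfl
    rw [map_zero] at hw
    omega

theorem IsVhFamily.sum_neg_one_pow_smul (hρ : IsVhFamily ρ) (hn : 2 ≤ n) :
    ∑ r : Fin (n + 1), ((-1 : ℂ) ^ (r : ℕ)) • frobeniusChar (ρ r) = 0 := by
  ext w
  have hsum := hρ.coeff_sum (-1) (eulerDeriv_one_sub_X n) (by simp) w
  have hsign (r : Fin (n + 1)) : (-1 : ℂ) ^ (r : ℕ) = (-1) ^ n * (-1) ^ (n - (r : ℕ)) := by
    rw [← pow_add, show n + (n - (r : ℕ)) = r + 2 * (n - r) by have := r.2; omega, pow_add,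
      (even_two_mul _).neg_one_pow, mul_one]
  simp_rw [MvPolynomial.coeff_sum, MvPolynomial.coeff_smul, hsign, smul_eq_mul, mul_assoc]
  rw [← Finset.mul_sum, hsum, MvPolynomial.coeff_zero]
  split_ifs with hw
  · rw [coeff_one_sub_X_one_eq_zero (hw ▸ hn), mul_zero]
  · rw [mul_zero]

theorem IsVhFamily.frobeniusChar_directSum (hρ : IsVhFamily ρ) (p : Fin (n + 1) → Prop)
    [DecidablePred p] :
    frobeniusChar (Representation.directSum fun r : {r // p r} => ρ r) =
      ∑ r with p r, frobeniusChar (ρ r) := by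
  have := fun r => (hρ r).1
  rw [frobeniusChar_eq_charSum, character_directSum, charSum_sum, Finset.sum_subtype _ (p := p)]
  · rfl
  · simp

theorem finiteDimensional_directSum {ι : Type*} [Finite ι] (V : ι → Type*)
    [∀ i, AddCommGroup (V i)] [∀ i, Module ℂ (V i)] [∀ i, FiniteDimensional ℂ (V i)] :
    FiniteDimensional ℂ (⨁ i, V i) := by
  classical
  have := Fintype.ofFinite ι
  exact Module.Finite.equiv (DirectSum.linearEquivFunOnFintype ℂ ι V).symm

theorem IsVhFamily.finiteDimensional_odd (hρ : IsVhFamily ρ) :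
    FiniteDimensional ℂ (⨁ r : {r : Fin (n + 1) // Odd (r : ℕ)}, W r) :=
  have := fun r => (hρ r).1
  finiteDimensional_directSum _

theorem IsVhFamily.finiteDimensional_even (hρ : IsVhFamily ρ) :
    FiniteDimensional ℂ (⨁ r : {r : Fin (n + 1) // Even (r : ℕ)}, W r) :=
  have := fun r => (hρ r).1
  finiteDimensional_directSum _

theorem frobeniusChar_prod {V V' : Type*} [AddCommGroup V] [Module ℂ V] [AddCommGroup V']
    [Module ℂ V'] [FiniteDimensional ℂ V] [FiniteDimensional ℂ V'] {n : ℕ}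
    (ρ : Representation ℂ (Equiv.Perm (Fin n)) V) (ρ' : Representation ℂ (Equiv.Perm (Fin n)) V') :
    frobeniusChar (ρ.prod ρ') = frobeniusChar ρ + frobeniusChar ρ' := by
  rw [frobeniusChar_eq_charSum, character_prod, charSum_add]
  rfl

theorem IsVhFamily.frobeniusChar_total (hρ : IsVhFamily ρ) :
    frobeniusChar (vhTotal ρ) = sumPowTwo n := by
  have := hρ.finiteDimensional_odd
  have := hρ.finiteDimensional_even
  rw [vhTotal, frobeniusChar_prod, ← hρ.sum_frobeniusChar, vhOdd, vhEven,
    hρ.frobeniusChar_directSum fun r => Odd (r : ℕ),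
    hρ.frobeniusChar_directSum fun r => Even (r : ℕ), add_comm,
    ← Finset.sum_filter_add_sum_filter_not Finset.univ fun r : Fin (n + 1) => Even (r : ℕ)]
  simp only [Nat.not_even_iff_odd]

theorem IsVhFamily.frobeniusChar_odd_eq_even (hρ : IsVhFamily ρ) (hn : 2 ≤ n) :
    frobeniusChar (vhOdd ρ) = frobeniusChar (vhEven ρ) := by
  have heven : ∑ r ∈ Finset.univ.filter fun r : Fin (n + 1) => Even (r : ℕ),
      ((-1 : ℂ) ^ (r : ℕ)) • frobeniusChar (ρ r) =
        frobeniusChar (vhEven ρ) := by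
    rw [vhEven, hρ.frobeniusChar_directSum fun r => Even (r : ℕ)]
    refine Finset.sum_congr rfl fun r hr => ?_
    rw [(Finset.mem_filter.mp hr).2.neg_one_pow, one_smul]
  have hodd : ∑ r ∈ Finset.univ.filter fun r : Fin (n + 1) => Odd (r : ℕ),
      ((-1 : ℂ) ^ (r : ℕ)) • frobeniusChar (ρ r) =
        -frobeniusChar (vhOdd ρ) := by
    rw [vhOdd, hρ.frobeniusChar_directSum fun r => Odd (r : ℕ), ← Finset.sum_neg_distrib]
    refine Finset.sum_congr rfl fun r hr => ?_
    rw [(Finset.mem_filter.mp hr).2.neg_one_pow, neg_one_smul]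
  have hsum := hρ.sum_neg_one_pow_smul hn
  rw [← Finset.sum_filter_add_sum_filter_not _ fun r : Fin (n + 1) => Even (r : ℕ), heven] at hsum
  simp only [Nat.not_even_iff_odd] at hsum
  rw [hodd, ← sub_eq_add_neg, sub_eq_zero] at hsum
  exact hsum.symm

theorem IsVhFamily.frobeniusChar_odd (hρ : IsVhFamily ρ) (hn : 2 ≤ n) :
    frobeniusChar (vhOdd ρ) = (1 / 2 : ℂ) • sumPowTwo n := by
  have := hρ.finiteDimensional_odd
  have := hρ.finiteDimensional_even
  rw [← hρ.frobeniusChar_total, vhTotal, frobeniusChar_prod, ← hρ.frobeniusChar_odd_eq_even hn,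
    ← two_smul ℂ, smul_smul]
  norm_num

theorem frobeniusChar_signRep_tprod {V : Type*} [AddCommGroup V] [Module ℂ V]
    [FiniteDimensional ℂ V] (ρ : Representation ℂ (Equiv.Perm (Fin n)) V) :
    frobeniusChar ((signRep n).tprod ρ) =
      charSum fun σ => ((Equiv.Perm.sign σ : ℤ) : ℂ) * ρ.character σ := by
  rw [frobeniusChar_eq_charSum, Representation.char_tensor]
  congr 1
  funext σ
  rw [Pi.mul_apply, signRep, character_linearCharRep]
  rfl

theorem IsVhFamily.frobeniusChar_odd_prod_sign (hρ : IsVhFamily ρ) (hn : 2 ≤ n) :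
    frobeniusChar ((vhOdd ρ).prod ((signRep n).tprod (vhOdd ρ))) = sumPowTwoEven n := by
  have := hρ.finiteDimensional_odd
  rw [frobeniusChar_prod, frobeniusChar_signRep_tprod]
  ext w
  rw [MvPolynomial.coeff_add, coeff_charSum_sign_mul, ← frobeniusChar_eq_charSum,
    hρ.frobeniusChar_odd hn, coeff_sumPowTwoEven, MvPolynomial.coeff_smul, smul_eq_mul]
  split_ifs with h
  · rw [h.neg_one_pow]; ring
  · rw [(Nat.not_even_iff_odd.mp h).neg_one_pow]; ring

theorem IsVhFamily.nonempty_equiv_odd_even (hρ : IsVhFamily ρ) (hn : 2 ≤ n) :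
    Nonempty ((vhOdd ρ).Equiv (vhEven ρ)) :=
  have := hρ.finiteDimensional_odd
  have := hρ.finiteDimensional_even
  nonempty_equiv_of_frobeniusChar_eq _ _ (hρ.frobeniusChar_odd_eq_even hn)

theorem nonempty_equiv_ind_permSucc {n : ℕ} {W : Fin (2 * n + 1) → Type u}
    [∀ r, AddCommGroup (W r)] [∀ r, Module ℂ (W r)]
    {ρ : ∀ r, Representation ℂ (Equiv.Perm (Fin (2 * n))) (W r)} {W' : Fin (2 * n + 1 + 1) → Type u}
    [∀ r, AddCommGroup (W' r)] [∀ r, Module ℂ (W' r)]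
    {ρ' : ∀ r, Representation ℂ (Equiv.Perm (Fin (2 * n + 1))) (W' r)} (hρ : IsVhFamily ρ)
    (hρ' : IsVhFamily ρ') :
    Nonempty ((vhTotal ρ').Equiv (Representation.ind (permSucc (2 * n)) (vhTotal ρ))) := by
  have := hρ.finiteDimensional_odd
  have := hρ.finiteDimensional_even
  have := hρ'.finiteDimensional_odd
  have := hρ'.finiteDimensional_even
  have : FiniteDimensional ℂ (MonoidAlgebra ℂ (Equiv.Perm (Fin (2 * n + 1)))) :=
    (MonoidAlgebra.basis _ ℂ).finiteDimensional_of_finite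
  refine nonempty_equiv_of_frobeniusChar_eq _ _ ?_
  rw [hρ'.frobeniusChar_total, frobeniusChar_ind_permSucc, hρ.frobeniusChar_total,
    sumPowTwo_two_mul_add_one]

end Family

open Equiv (Perm)

/-! ### Polynomial functors on matrices -/

section SymmetrizedPower

theorem sum_prod_mul_prod_perm {ι Ω R : Type*} [Fintype ι] [DecidableEq ι] [Fintype Ω]
    [CommSemiring R] (A B : Matrix Ω Ω R) (σ τ : Perm ι) (f g : ι → Ω) :
    ∑ e : ι → Ω, (∏ i, A (f i) (e (σ i))) * ∏ i, B (e i) (g (τ i)) =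
      ∏ i, (A * B) (f i) (g ((τ * σ) i)) := by
  simp_rw [Matrix.mul_apply]
  rw [Fintype.prod_sum, ← Equiv.sum_comp (σ.arrowCongr (Equiv.refl Ω))]
  refine Finset.sum_congr rfl fun e _ => ?_
  rw [← Equiv.prod_comp σ fun i => B _ (g (τ i)), ← Finset.prod_mul_distrib]
  refine Finset.prod_congr rfl fun i _ => ?_
  simp only [Equiv.arrowCongr_apply, Equiv.coe_refl, Function.comp_apply, Equiv.symm_apply_apply,
    id_eq, Perm.mul_apply]

variable {H ι Ω R S : Type*} [Group H] [Fintype H] [Fintype ι] [CommSemiring R]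
  [Algebra ℂ R] [CommSemiring S] [Algebra ℂ S]

/-- The matrix of `B^{⊗ι} ∘ π` on the tensor power indexed by `ι`, where `π = |H|⁻¹ ∑ χ(h) h` is
the projector onto an isotypic subspace of `H`, acting through `φ`. -/
def symmetrizedPower (φ : H →* Perm ι) (χ : H →* ℂ) (B : Matrix Ω Ω R) :
    Matrix (ι → Ω) (ι → Ω) R :=
  Matrix.of fun f g => ∑ h, ((Fintype.card H : ℂ)⁻¹ * χ h) • ∏ i, B (f i) (g (φ h i))

theorem symmetrizedPower_mul [DecidableEq ι] [Fintype Ω] (φ : H →* Perm ι) (χ : H →* ℂ)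
    (A B : Matrix Ω Ω R) :
    symmetrizedPower φ χ (A * B) = symmetrizedPower φ χ A * symmetrizedPower φ χ B := by
  let c := (Fintype.card H : ℂ)⁻¹
  have hc : (Fintype.card H : ℂ) * (c * c) = c :=
    mul_inv_cancel_left₀ (Nat.cast_ne_zero.mpr Fintype.card_ne_zero) c
  ext f g
  symm
  calc (symmetrizedPower φ χ A * symmetrizedPower φ χ B) f g
      = ∑ e : ι → Ω, (∑ h, (c * χ h) • ∏ i, A (f i) (e (φ h i))) *
          ∑ h', (c * χ h') • ∏ i, B (e i) (g (φ h' i)) := rfl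
    _ = ∑ h, ∑ h', (c * χ h * (c * χ h')) •
          ∑ e : ι → Ω, (∏ i, A (f i) (e (φ h i))) * ∏ i, B (e i) (g (φ h' i)) := by
        simp_rw [Finset.sum_mul_sum, smul_mul_smul_comm, Finset.smul_sum]
        rw [Finset.sum_comm]
        exact Finset.sum_congr rfl fun h _ => Finset.sum_comm
    _ = ∑ h, ∑ h', (c * c * χ (h' * h)) • ∏ i, (A * B) (f i) (g (φ (h' * h) i)) := by
        refine Finset.sum_congr rfl fun h _ => Finset.sum_congr rfl fun h' _ => ?_
        rw [sum_prod_mul_prod_perm, mul_mul_mul_comm, mul_comm (χ h), map_mul, map_mul]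
    _ = ∑ _h : H, ∑ k, (c * c * χ k) • ∏ i, (A * B) (f i) (g (φ k i)) :=
        Finset.sum_congr rfl fun h _ => Equiv.sum_comp (Equiv.mulRight h)
          fun k => (c * c * χ k) • ∏ i, (A * B) (f i) (g (φ k i))
    _ = symmetrizedPower φ χ (A * B) f g := by
        rw [Finset.sum_const, Finset.card_univ, ← Nat.cast_smul_eq_nsmul ℂ, Finset.smul_sum]
        simp_rw [smul_smul, ← mul_assoc (Fintype.card H : ℂ) (c * c), hc]
        rfl

theorem trace_symmetrizedPower [DecidableEq ι] [Fintype Ω] [DecidableEq Ω] (φ : H →* Perm ι)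
    (χ : H →* ℂ) (B : Matrix Ω Ω R) :
    (symmetrizedPower φ χ B).trace = MvPolynomial.aeval (fun k : ℕ+ => (B ^ (k : ℕ)).trace)
      ((Fintype.card H : ℂ)⁻¹ • ∑ h, χ h • cycleMonomial (φ h)) := by
  simp_rw [map_smul, map_sum, map_smul, ← twistedTrace_eq_aeval_cycleMonomial B, twistedTrace,
    Finset.smul_sum, smul_smul]
  rw [Finset.sum_comm]
  rfl

theorem map_symmetrizedPower (φ : H →* Perm ι) (χ : H →* ℂ) (B : Matrix Ω Ω R) (F : R →ₐ[ℂ] S) :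
    symmetrizedPower φ χ (B.map F) = (symmetrizedPower φ χ B).map F := by
  ext f g
  simp only [symmetrizedPower, Matrix.of_apply, Matrix.map_apply, map_sum, map_smul, map_prod]

theorem symmetrizedPower_diagonal_mul [DecidableEq ι] [Fintype Ω] [DecidableEq Ω]
    (φ : H →* Perm ι) (χ : H →* ℂ) (d : Ω → R) (B : Matrix Ω Ω R) :
    symmetrizedPower φ χ (Matrix.diagonal d * B) =
      Matrix.diagonal (fun f => ∏ i, d (f i)) * symmetrizedPower φ χ B := by
  ext f g
  rw [Matrix.diagonal_mul]
  simp_rw [symmetrizedPower, Matrix.of_apply, Matrix.diagonal_mul, Finset.prod_mul_distrib,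
    Finset.mul_sum, mul_smul_comm]

theorem symmetrizedPower_mul_diagonal [DecidableEq ι] [Fintype Ω] [DecidableEq Ω]
    (φ : H →* Perm ι) (χ : H →* ℂ) (d : Ω → R) (B : Matrix Ω Ω R) :
    symmetrizedPower φ χ (B * Matrix.diagonal d) =
      symmetrizedPower φ χ B * Matrix.diagonal fun f => ∏ i, d (f i) := by
  ext f g
  rw [Matrix.mul_diagonal]
  simp_rw [symmetrizedPower, Matrix.of_apply, Matrix.mul_diagonal, Finset.prod_mul_distrib,
    Finset.sum_mul, smul_mul_assoc]
  refine Finset.sum_congr rfl fun h _ => ?_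
  rw [Equiv.prod_comp (φ h) fun i => d (g i)]

end SymmetrizedPower

section WordMatrix

variable {Ω R S : Type*} [CommSemiring R] [Algebra ℂ R] [CommSemiring S] [Algebra ℂ S]

/-- The polynomial functor with characteristic `∑_{1 ≤ k ≤ n} Lie^{(2)}_k`, on matrices. Its basis
consists of the words of length between `1` and `n`, the length being `k + 1` for `k : Fin n`. -/
def lieMatrix (n : ℕ) (B : Matrix Ω Ω R) :
    Matrix (Σ k : Fin n, (Fin ((k : ℕ) + 1) → Ω)) (Σ k : Fin n, (Fin ((k : ℕ) + 1) → Ω)) R :=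
  Matrix.blockDiagonal' fun k : Fin n =>
    symmetrizedPower (cyclicToPerm ((k : ℕ) + 1)) (lieTwoCharacter ((k : ℕ) + 1)) B

/-- The partial sum `∑_{1 ≤ k ≤ n} ch(Lie^{(2)}_k)` of `Lie^{(2)}`. -/
def lieTwoPartial (n : ℕ) : SymmFun := ∑ k : Fin n, frobeniusChar (lieTwoRep ((k : ℕ) + 1))

/-- The polynomial functor with characteristic `h_m[∑_{1 ≤ k ≤ n} Lie^{(2)}_k]`, on matrices: the
`m`-th symmetric power of `lieMatrix`. Its basis consists of the `m`-tuples of words. -/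
def wordMatrix (n m : ℕ) (B : Matrix Ω Ω R) :
    Matrix (Fin m → Σ k : Fin n, (Fin ((k : ℕ) + 1) → Ω))
      (Fin m → Σ k : Fin n, (Fin ((k : ℕ) + 1) → Ω)) R :=
  symmetrizedPower (MonoidHom.id (Perm (Fin m))) 1 (lieMatrix n B)

/-- The product of the values of `d` at all letters of an `m`-tuple of words. -/
def wordWeight {n m : ℕ} (d : Ω → R) (f : Fin m → Σ k : Fin n, (Fin ((k : ℕ) + 1) → Ω)) : R :=
  ∏ i, ∏ j, d ((f i).2 j)

theorem lieMatrix_mul [Fintype Ω] (n : ℕ) (A B : Matrix Ω Ω R) :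
    lieMatrix n (A * B) = lieMatrix n A * lieMatrix n B := by
  simp_rw [lieMatrix, symmetrizedPower_mul, Matrix.blockDiagonal'_mul]

theorem lieMatrix_pow [Fintype Ω] [DecidableEq Ω] (n : ℕ) (B : Matrix Ω Ω R) (j : ℕ+) :
    lieMatrix n B ^ (j : ℕ) = lieMatrix n (B ^ (j : ℕ)) := by
  induction j using PNat.recOn with
  | one => rw [PNat.one_coe, pow_one, pow_one]
  | succ j ih => rw [PNat.add_coe, PNat.one_coe, pow_succ, ih, ← lieMatrix_mul, ← pow_succ]

theorem trace_lieMatrix [Fintype Ω] [DecidableEq Ω] (n : ℕ) (B : Matrix Ω Ω R) :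
    (lieMatrix n B).trace =
      MvPolynomial.aeval (fun k : ℕ+ => (B ^ (k : ℕ)).trace) (lieTwoPartial n) := by
  rw [lieMatrix, Matrix.trace_blockDiagonal', lieTwoPartial, map_sum]
  refine Finset.sum_congr rfl fun k _ => ?_
  rw [trace_symmetrizedPower, lieTwoRep, frobeniusChar_ind]
  simp_rw [character_linearCharRep]

theorem map_lieMatrix (n : ℕ) (B : Matrix Ω Ω R) (F : R →ₐ[ℂ] S) :
    lieMatrix n (B.map F) = (lieMatrix n B).map F := by
  simp_rw [lieMatrix, map_symmetrizedPower]
  exact (Matrix.blockDiagonal'_map _ _ (map_zero F)).symm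

theorem lieMatrix_diagonal_mul [Fintype Ω] [DecidableEq Ω] (n : ℕ) (d : Ω → R) (B : Matrix Ω Ω R) :
    lieMatrix n (Matrix.diagonal d * B) =
      Matrix.diagonal (fun f => ∏ j, d (f.2 j)) * lieMatrix n B := by
  simp_rw [lieMatrix, symmetrizedPower_diagonal_mul, Matrix.blockDiagonal'_mul,
    Matrix.blockDiagonal'_diagonal]

theorem lieMatrix_mul_diagonal [Fintype Ω] [DecidableEq Ω] (n : ℕ) (d : Ω → R) (B : Matrix Ω Ω R) :
    lieMatrix n (B * Matrix.diagonal d) =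
      lieMatrix n B * Matrix.diagonal fun f => ∏ j, d (f.2 j) := by
  simp_rw [lieMatrix, symmetrizedPower_mul_diagonal, Matrix.blockDiagonal'_mul,
    Matrix.blockDiagonal'_diagonal]

theorem wordMatrix_mul [Fintype Ω] (n m : ℕ) (A B : Matrix Ω Ω R) :
    wordMatrix n m (A * B) = wordMatrix n m A * wordMatrix n m B := by
  rw [wordMatrix, lieMatrix_mul, symmetrizedPower_mul, wordMatrix, wordMatrix]

theorem map_wordMatrix (n m : ℕ) (B : Matrix Ω Ω R) (F : R →ₐ[ℂ] S) :
    wordMatrix n m (B.map F) = (wordMatrix n m B).map F := by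
  rw [wordMatrix, map_lieMatrix, map_symmetrizedPower, wordMatrix]

theorem wordMatrix_diagonal_mul [Fintype Ω] [DecidableEq Ω] (n m : ℕ) (d : Ω → R)
    (B : Matrix Ω Ω R) :
    wordMatrix n m (Matrix.diagonal d * B) =
      Matrix.diagonal (wordWeight d) * wordMatrix n m B := by
  rw [wordMatrix, lieMatrix_diagonal_mul, symmetrizedPower_diagonal_mul, wordMatrix]
  rfl

theorem wordMatrix_mul_diagonal [Fintype Ω] [DecidableEq Ω] (n m : ℕ) (d : Ω → R)
    (B : Matrix Ω Ω R) :
    wordMatrix n m (B * Matrix.diagonal d) =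
      wordMatrix n m B * Matrix.diagonal (wordWeight d) := by
  rw [wordMatrix, lieMatrix_mul_diagonal, symmetrizedPower_mul_diagonal, wordMatrix]
  rfl

/-- The plethysm `h_m[∑_{1 ≤ k ≤ n} Lie^{(2)}_k]`. -/
def homogLiePartial (n m : ℕ) : SymmFun :=
  MvPolynomial.aeval (fun j : ℕ+ => MvPolynomial.rename (fun i : ℕ+ => j * i) (lieTwoPartial n))
    (completeHomog m)

theorem trace_wordMatrix [Fintype Ω] [DecidableEq Ω] (n m : ℕ) (B : Matrix Ω Ω R) :
    (wordMatrix n m B).trace =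
      MvPolynomial.aeval (fun k : ℕ+ => (B ^ (k : ℕ)).trace) (homogLiePartial n m) := by
  have hchar : ((Fintype.card (Perm (Fin m)) : ℂ)⁻¹ • ∑ σ : Perm (Fin m),
      (1 : Perm (Fin m) →* ℂ) σ • cycleMonomial (MonoidHom.id (Perm (Fin m)) σ)) =
      completeHomog m := by
    rw [completeHomog_eq_charSum, charSum, Fintype.card_perm, Fintype.card_fin]
    rfl
  rw [wordMatrix, trace_symmetrizedPower, hchar, homogLiePartial, MvPolynomial.comp_aeval_apply]
  congr 2
  funext j
  rw [lieMatrix_pow n B j, trace_lieMatrix, MvPolynomial.aeval_rename]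
  congr 2
  funext k
  rw [Function.comp_apply, PNat.mul_coe, pow_mul]

end WordMatrix

section Truncation

theorem lieTwoSeries_sub_lieTwoPartial_mem_degreeIdeal (n : ℕ) :
    lieTwoSeries - (lieTwoPartial n : SymmSeries) ∈ degreeIdeal (n + 1) := by
  intro w hw
  rw [map_sub, sub_eq_zero, MvPolynomial.coeff_coe, lieTwoPartial, MvPolynomial.coeff_sum]
  rcases Nat.eq_zero_or_pos (psDegree w) with h0 | h0
  · rw [Finset.sum_eq_zero]
    · exact lieTwoSeries_mem_degreeIdeal w (by omega)
    · exact fun k _ => coeff_frobeniusChar_eq_zero _ (by omega)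
  · obtain ⟨k, hk⟩ : ∃ k, psDegree w = k + 1 := ⟨psDegree w - 1, by omega⟩
    rw [coeff_lieTwoSeries k.succPNat hk, Finset.sum_eq_single (⟨k, by omega⟩ : Fin n)]
    · rfl
    · exact fun i _ hi => coeff_frobeniusChar_eq_zero _ fun hdeg =>
        hi (Fin.ext (Nat.succ_injective (hdeg.symm.trans hk)))
    · exact fun hmem => absurd (Finset.mem_univ _) hmem

theorem plethysm_sub_plethysm_mem_degreeIdeal {k : ℕ} {g g' : SymmSeries}
    (h : g - g' ∈ degreeIdeal k) (f : SymmFun) :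
    plethysm f g - plethysm f g' ∈ degreeIdeal k := by
  rw [← Ideal.Quotient.eq]
  change Ideal.Quotient.mkₐ ℂ (degreeIdeal k) _ = Ideal.Quotient.mkₐ ℂ (degreeIdeal k) _
  rw [plethysm, plethysm, MvPolynomial.comp_aeval_apply, MvPolynomial.comp_aeval_apply]
  congr 2
  funext j
  refine Ideal.Quotient.eq.mpr ?_
  rw [← map_sub]
  exact degreeIdeal_mono (Nat.le_mul_of_pos_left _ j.pos) (adams_mem_degreeIdeal j h)

theorem coe_homogLiePartial (n m : ℕ) :
    (homogLiePartial n m : SymmSeries) = plethysm (completeHomog m) (lieTwoPartial n) := by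
  have hcoe (p : SymmFun) : (p : SymmSeries) = MvPolynomial.coeToMvPowerSeries.algHom ℂ p := by
    rw [MvPolynomial.coeToMvPowerSeries.algHom_apply, Algebra.algebraMap_self, MvPowerSeries.map_id]
    rfl
  rw [hcoe, homogLiePartial, MvPolynomial.comp_aeval_apply, plethysm]
  congr 2
  funext j
  rw [adams, MvPowerSeries.rename_coe, ← hcoe]

theorem degreeTerm_plethysm (n m : ℕ) :
    degreeTerm n (plethysm (completeHomog m) lieTwoSeries) =
      degreeTerm n (homogLiePartial n m : SymmSeries) := by
  funext w
  refine if_ctx_congr Iff.rfl (fun hw => ?_) fun _ => rfl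
  have hcoeff := plethysm_sub_plethysm_mem_degreeIdeal
    (lieTwoSeries_sub_lieTwoPartial_mem_degreeIdeal n) (completeHomog m) w
    (hw.trans_lt (Nat.lt_succ_self n))
  rw [map_sub, sub_eq_zero] at hcoeff
  rw [hcoeff, coe_homogLiePartial]

end Truncation

/-! ### Existence of the modules `Vh_r(n)` -/

section PermMatrix

variable {α R : Type*} [DecidableEq α]

theorem inv_permMatrix_apply [Zero R] [One R] (σ : Perm α) (a b : α) :
    σ⁻¹.permMatrix R a b = if a = σ b then 1 else 0 := by
  simp only [PEquiv.toMatrix_apply, Equiv.toPEquiv_apply, Option.mem_some_iff, Perm.inv_eq_iff_eq]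

theorem inv_permMatrix_mul [Fintype α] [NonAssocSemiring R] (σ τ : Perm α) :
    (σ * τ)⁻¹.permMatrix R = σ⁻¹.permMatrix R * τ⁻¹.permMatrix R := by
  rw [mul_inv_rev, Matrix.permMatrix_mul]

theorem diagonal_mul_inv_permMatrix [Fintype α] [NonAssocSemiring R] (d : α → R) (σ : Perm α) :
    Matrix.diagonal d * σ⁻¹.permMatrix R = σ⁻¹.permMatrix R * Matrix.diagonal (d ∘ σ) := by
  ext a b
  rw [Matrix.diagonal_mul, Matrix.mul_diagonal, inv_permMatrix_apply]
  split_ifs with hab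
  · rw [hab, mul_one, one_mul, Function.comp_apply]
  · rw [mul_zero, zero_mul]

end PermMatrix

section Multilinear

/-- The exponent vector of `t_1 ⋯ t_n`. -/
def allOnes (n : ℕ) : Fin n →₀ ℕ := Finsupp.equivFunOnFinite.symm fun _ => 1

theorem allOnes_apply {n : ℕ} (a : Fin n) : allOnes n a = 1 := rfl

/-- The coefficient of `t_1 ⋯ t_n` when each `p_k` in `G` is replaced by the trace of the `k`-th
power of the matrix `diag(t_1, …, t_n) σ`. When `G` is the characteristic of a polynomial functor
`F`, this is the trace of `σ` on the part of `F(ℂ^n)` of weight `(1, …, 1)`. -/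
def multilinearTrace {n : ℕ} (σ : Perm (Fin n)) : SymmFun →ₗ[ℂ] ℂ :=
  MvPolynomial.lcoeff ℂ (allOnes n) ∘ₗ (MvPolynomial.aeval fun k : ℕ+ =>
    ((Matrix.diagonal MvPolynomial.X * σ⁻¹.permMatrix (MvPolynomial (Fin n) ℂ)) ^
      (k : ℕ)).trace).toLinearMap

theorem multilinearTrace_apply {n : ℕ} (σ : Perm (Fin n)) (G : SymmFun) :
    multilinearTrace σ G = MvPolynomial.coeff (allOnes n) (MvPolynomial.aeval (fun k : ℕ+ =>
      ((Matrix.diagonal MvPolynomial.X * σ⁻¹.permMatrix (MvPolynomial (Fin n) ℂ)) ^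
        (k : ℕ)).trace) G) :=
  rfl

theorem exists_cycleMonomial_eq (w : ℕ+ →₀ ℕ) :
    ∃ π : Perm (Fin (psDegree w)), cycleMonomial π = MvPolynomial.monomial w 1 := by
  obtain ⟨ν, hν⟩ : ∃ ν : (Fintype.card (Fin (psDegree w))).Partition, partExp ν = w :=
    exists_partExp_eq (Fintype.card_fin _).symm
  have hne : (Finset.univ.filter fun σ : Perm (Fin (psDegree w)) => σ.partition = ν).Nonempty := by
    rw [Finset.nonempty_iff_ne_empty]
    intro hempty
    have hcard := card_partition_eq_mul_zFactor ν
    rw [hempty, Finset.card_empty, zero_mul] at hcard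
    exact Nat.factorial_ne_zero _ hcard.symm
  obtain ⟨π, hπ⟩ := hne
  exact ⟨π, by rw [cycleMonomial, (Finset.mem_filter.mp hπ).2, powerSumPart_eq_monomial, hν]⟩

theorem prod_X_eq_monomial {ι τ R : Type*} [Fintype ι] [CommSemiring R] (f : ι → τ) :
    ∏ i, (MvPolynomial.X (f i) : MvPolynomial τ R) =
      MvPolynomial.monomial (∑ i, Finsupp.single (f i) 1) 1 :=
  (MvPolynomial.monomial_sum_one _ _).symm

theorem sum_single_eq_allOnes_iff {ι : Type*} [Fintype ι] {n : ℕ} (f : ι → Fin n) :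
    ∑ i, Finsupp.single (f i) 1 = allOnes n ↔ Function.Bijective f := by
  have hfiber (a : Fin n) : (∑ i, Finsupp.single (f i) 1 : Fin n →₀ ℕ) a =
      (Finset.univ.filter fun i => f i = a).card := by
    rw [Finsupp.finsetSum_apply, Finset.card_filter]
    exact Finset.sum_congr rfl fun i _ => Finsupp.single_apply
  rw [Function.bijective_iff_existsUnique, Finsupp.ext_iff]
  refine forall_congr' fun a => ?_
  rw [hfiber, allOnes_apply, Finset.card_eq_one]
  simp only [Finset.eq_singleton_iff_unique_mem, Finset.mem_filter, Finset.mem_univ, true_and,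
    ExistsUnique]

theorem multilinearTrace_cycleMonomial {ι : Type*} [Fintype ι] [DecidableEq ι] {n : ℕ}
    (σ : Perm (Fin n)) (π : Perm ι) :
    multilinearTrace σ (cycleMonomial π) = ((Finset.univ.filter fun f : ι → Fin n =>
      Function.Bijective f ∧ ∀ i, f i = σ (f (π i))).card : ℂ) := by
  rw [multilinearTrace_apply, ← twistedTrace_eq_aeval_cycleMonomial, twistedTrace,
    MvPolynomial.coeff_sum, Finset.card_filter, Nat.cast_sum]
  refine Finset.sum_congr rfl fun f _ => ?_
  simp_rw [Matrix.diagonal_mul, inv_permMatrix_apply, Finset.prod_mul_distrib, prod_X_eq_monomial,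
    Finset.prod_ite_zero, Finset.prod_const_one, mul_ite, mul_one, mul_zero]
  rw [apply_ite (MvPolynomial.coeff (allOnes n)), MvPolynomial.coeff_monomial,
    MvPolynomial.coeff_zero, ← ite_and, Nat.cast_ite, Nat.cast_one, Nat.cast_zero]
  refine if_congr ?_ rfl rfl
  rw [sum_single_eq_allOnes_iff, and_comm]
  simp only [Finset.mem_univ, true_imp_iff]

theorem multilinearTrace_cycleMonomial_eq_zero {ι : Type*} [Fintype ι] [DecidableEq ι] {n : ℕ}
    (σ : Perm (Fin n)) (π : Perm ι) (hn : Fintype.card ι ≠ n) :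
    multilinearTrace σ (cycleMonomial π) = 0 := by
  rw [multilinearTrace_cycleMonomial, Nat.cast_eq_zero, Finset.card_eq_zero,
    Finset.filter_eq_empty_iff]
  exact fun f _ hf => hn ((Fintype.card_of_bijective hf.1).trans (Fintype.card_fin n))

theorem card_filter_bijective_and_eq {α : Type*} [Fintype α] [DecidableEq α] (σ π : Perm α) :
    (Finset.univ.filter fun f : α → α => Function.Bijective f ∧ ∀ i, f i = σ (f (π i))).card =
      (Finset.univ.filter fun e : Perm α => e * σ * e⁻¹ = π⁻¹).card := by
  have hconj (e : Perm α) : e * σ * e⁻¹ = π⁻¹ ↔ ∀ i, e⁻¹ i = σ (e⁻¹ (π i)) := by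
    rw [mul_assoc, eq_inv_iff_mul_eq_one, mul_assoc, mul_eq_one_iff_inv_eq, Equiv.ext_iff]
    rfl
  symm
  refine Finset.card_bij (fun e _ => ⇑e⁻¹) (fun e he => ?_)
    (fun e _ e' _ h => inv_injective (Equiv.coe_fn_injective h)) fun f hf => ?_
  · exact Finset.mem_filter.mpr
      ⟨Finset.mem_univ _, e⁻¹.bijective, (hconj e).mp (Finset.mem_filter.mp he).2⟩
  · obtain ⟨hbij, hcomm⟩ := (Finset.mem_filter.mp hf).2
    exact ⟨(Equiv.ofBijective f hbij)⁻¹, Finset.mem_filter.mpr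
      ⟨Finset.mem_univ _, (hconj _).mpr (by rwa [inv_inv])⟩, by rw [inv_inv]; rfl⟩

theorem charSum_multilinearTrace_cycleMonomial {n N : ℕ} (π : Perm (Fin N)) :
    charSum (fun σ : Perm (Fin n) => multilinearTrace σ (cycleMonomial π)) =
      if N = n then cycleMonomial π else 0 := by
  split_ifs with hN
  · subst hN
    simp_rw [charSum, multilinearTrace_cycleMonomial, card_filter_bijective_and_eq]
    rw [sum_card_conj_smul_of_class_function _ fun _ _ => cycleMonomial_of_isConj,
      Fintype.card_perm, Fintype.card_fin,
      inv_smul_smul₀ (Nat.cast_ne_zero.mpr N.factorial_ne_zero)]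
    exact cycleMonomial_of_isConj (Perm.isConj_iff_cycleType_eq.mpr (Perm.cycleType_inv π))
  · rw [← Fintype.card_fin N] at hN
    simp_rw [charSum, multilinearTrace_cycleMonomial_eq_zero _ π hN, zero_smul,
      Finset.sum_const_zero, smul_zero]

theorem coeff_charSum_multilinearTrace {n : ℕ} (G : SymmFun) (w : ℕ+ →₀ ℕ) :
    MvPolynomial.coeff w (charSum fun σ : Perm (Fin n) => multilinearTrace σ G) =
      if psDegree w = n then MvPolynomial.coeff w G else 0 := by
  induction G using MvPolynomial.induction_on' with
  | add p q hp hq =>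
    simp_rw [map_add]
    refine (congrArg _ (charSum_add _ _)).trans ?_
    rw [MvPolynomial.coeff_add, hp, hq, MvPolynomial.coeff_add]
    split_ifs
    · rfl
    · exact add_zero 0
  | monomial v a =>
    obtain ⟨π, hπ⟩ := exists_cycleMonomial_eq v
    have hmonomial : MvPolynomial.monomial v a = a • cycleMonomial π := by
      rw [hπ, MvPolynomial.smul_monomial, smul_eq_mul, mul_one]
    simp_rw [hmonomial, map_smul, smul_eq_mul]
    rw [charSum_smul, charSum_multilinearTrace_cycleMonomial, MvPolynomial.coeff_smul,
      MvPolynomial.coeff_smul, smul_eq_mul, smul_eq_mul, ← mul_ite_zero, hπ]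
    congr 1
    rw [apply_ite (MvPolynomial.coeff w), MvPolynomial.coeff_zero, MvPolynomial.coeff_monomial]
    rcases eq_or_ne v w with rfl | hvw
    · rfl
    · simp only [if_neg hvw, ite_self]

end Multilinear

section MatrixRepresentation

/-- The representation of `G` on the range of the idempotent `N 1` given by a family of matrices
that is multiplicative but need not send `1` to the identity matrix. -/
def matrixRep {G J : Type*} [Group G] [Fintype J] [DecidableEq J] (N : G → Matrix J J ℂ)
    (hN : ∀ g h, N (g * h) = N g * N h) :
    Representation ℂ G (LinearMap.range (Matrix.toLin' (N 1))) where
  toFun g := (Matrix.toLin' (N g)).restrict (p := LinearMap.range (Matrix.toLin' (N 1)))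
    (q := LinearMap.range (Matrix.toLin' (N 1))) fun x _ =>
      ⟨Matrix.toLin' (N g) x, by rw [← LinearMap.comp_apply, ← Matrix.toLin'_mul, ← hN, one_mul]⟩
  map_one' := by
    refine LinearMap.ext ?_
    rintro ⟨-, x, rfl⟩
    refine Subtype.ext ?_
    change Matrix.toLin' (N 1) (Matrix.toLin' (N 1) x) = Matrix.toLin' (N 1) x
    rw [← LinearMap.comp_apply, ← Matrix.toLin'_mul, ← hN, one_mul]
  map_mul' g h := by
    refine LinearMap.ext fun x => Subtype.ext ?_
    change Matrix.toLin' (N (g * h)) x = Matrix.toLin' (N g) (Matrix.toLin' (N h) x)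
    rw [hN, Matrix.toLin'_mul, LinearMap.comp_apply]

theorem character_matrixRep {G J : Type*} [Group G] [Fintype J] [DecidableEq J]
    (N : G → Matrix J J ℂ) (hN : ∀ g h, N (g * h) = N g * N h) (g : G) :
    (matrixRep N hN).character g = (N g).trace := by
  rw [← Matrix.trace_toLin'_eq]
  exact LinearMap.trace_restrict_eq_of_forall_mem (LinearMap.range (Matrix.toLin' (N 1))) _ fun x =>
    ⟨Matrix.toLin' (N g) x, by rw [← LinearMap.comp_apply, ← Matrix.toLin'_mul, ← hN, one_mul]⟩

end MatrixRepresentation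

section MultilinearWords

/-- The number of occurrences of each letter in an `m`-tuple of words. -/
def letterCount {Ω : Type*} {n m : ℕ} (f : Fin m → Σ k : Fin n, (Fin ((k : ℕ) + 1) → Ω)) :
    Ω →₀ ℕ :=
  ∑ i, ∑ j, Finsupp.single ((f i).2 j) 1

theorem wordWeight_X {Ω : Type*} {n m : ℕ} (f : Fin m → Σ k : Fin n, (Fin ((k : ℕ) + 1) → Ω)) :
    wordWeight (R := MvPolynomial Ω ℂ) MvPolynomial.X f =
      MvPolynomial.monomial (letterCount f) 1 := by
  simp_rw [wordWeight, letterCount, prod_X_eq_monomial, MvPolynomial.monomial_sum_one]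

variable {n m : ℕ}

/-- The tuples of words over `Fin n` in which every letter occurs once. They span the part of
weight `(1, …, 1)` of the polynomial functor underlying `wordMatrix`. -/
def IsMultilinear (f : Fin m → Σ k : Fin n, (Fin ((k : ℕ) + 1) → Fin n)) : Prop :=
  letterCount f = allOnes n

theorem inv_permMatrix_eq_map {R : Type*} [CommSemiring R] [Algebra ℂ R] (σ : Perm (Fin n)) :
    σ⁻¹.permMatrix R = (σ⁻¹.permMatrix ℂ).map (Algebra.ofId ℂ R) :=
  (PEquiv.map_toMatrix (algebraMap ℂ R) _).symm

theorem wordMatrix_inv_permMatrix_apply {R : Type*} [CommSemiring R] [Algebra ℂ R]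
    (σ : Perm (Fin n)) (f g : Fin m → Σ k : Fin n, (Fin ((k : ℕ) + 1) → Fin n)) :
    wordMatrix n m (σ⁻¹.permMatrix R) f g =
      algebraMap ℂ R (wordMatrix n m (σ⁻¹.permMatrix ℂ) f g) := by
  rw [inv_permMatrix_eq_map, map_wordMatrix]
  rfl

-- Compare the entries of both sides of `diag(t) σ = σ diag(t ∘ σ)`.
theorem letterCount_eq_mapDomain_of_wordMatrix_ne_zero (σ : Perm (Fin n))
    {f g : Fin m → Σ k : Fin n, (Fin ((k : ℕ) + 1) → Fin n)}
    (hfg : wordMatrix n m (σ⁻¹.permMatrix ℂ) f g ≠ 0) :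
    letterCount f = Finsupp.mapDomain σ (letterCount g) := by
  have hmatrix := (congrArg (wordMatrix n m)
    (diagonal_mul_inv_permMatrix (R := MvPolynomial (Fin n) ℂ) MvPolynomial.X σ))
  rw [wordMatrix_diagonal_mul, wordMatrix_mul_diagonal] at hmatrix
  have hentry := congrFun₂ hmatrix f g
  have hne : wordMatrix n m (σ⁻¹.permMatrix (MvPolynomial (Fin n) ℂ)) f g ≠ 0 := by
    rw [wordMatrix_inv_permMatrix_apply]
    exact (map_ne_zero_iff _ (MvPolynomial.C_injective (Fin n) ℂ)).mpr hfg
  have hrename : wordWeight (MvPolynomial.X ∘ σ) g =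
      MvPolynomial.rename σ (wordWeight (R := MvPolynomial (Fin n) ℂ) MvPolynomial.X g) := by
    simp_rw [wordWeight, map_prod, MvPolynomial.rename_X, Function.comp_apply]
  rw [Matrix.diagonal_mul, Matrix.mul_diagonal, mul_comm, mul_right_inj' hne, hrename,
    wordWeight_X, wordWeight_X, MvPolynomial.rename_monomial] at hentry
  exact (MvPolynomial.monomial_left_inj one_ne_zero).mp hentry

theorem mapDomain_allOnes (σ : Perm (Fin n)) : Finsupp.mapDomain σ (allOnes n) = allOnes n :=
  Finsupp.ext fun a => by
    rw [← σ.apply_symm_apply a, Finsupp.mapDomain_apply σ.injective, allOnes_apply, allOnes_apply]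

theorem isMultilinear_iff_of_wordMatrix_ne_zero (σ : Perm (Fin n))
    {f g : Fin m → Σ k : Fin n, (Fin ((k : ℕ) + 1) → Fin n)}
    (hfg : wordMatrix n m (σ⁻¹.permMatrix ℂ) f g ≠ 0) : IsMultilinear f ↔ IsMultilinear g := by
  rw [IsMultilinear, IsMultilinear, letterCount_eq_mapDomain_of_wordMatrix_ne_zero σ hfg]
  nth_rw 1 [← mapDomain_allOnes σ]
  exact (Finsupp.mapDomain_injective σ.injective).eq_iff

/-- The matrix of `σ ∈ S_n` on the multilinear words. -/
def multilinearMatrix (n m : ℕ) (σ : Perm (Fin n)) : Matrix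
    (ULift.{u} {f : Fin m → Σ k : Fin n, (Fin ((k : ℕ) + 1) → Fin n) // IsMultilinear f})
    (ULift.{u} {f : Fin m → Σ k : Fin n, (Fin ((k : ℕ) + 1) → Fin n) // IsMultilinear f}) ℂ :=
  Matrix.of fun f g => wordMatrix n m (σ⁻¹.permMatrix ℂ) f.down g.down

open Classical in
theorem sum_ulift_isMultilinear
    (F : (Fin m → Σ k : Fin n, (Fin ((k : ℕ) + 1) → Fin n)) → ℂ) :
    ∑ e : ULift.{u} {f : Fin m → Σ k : Fin n, (Fin ((k : ℕ) + 1) → Fin n) // IsMultilinear f},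
      F e.down = ∑ e with IsMultilinear e, F e := by
  rw [← Equiv.sum_comp Equiv.ulift.symm]
  exact (Finset.sum_subtype (Finset.univ.filter IsMultilinear)
    (fun e => by rw [Finset.mem_filter, and_iff_right (Finset.mem_univ e)]) F).symm

open Classical in
theorem multilinearMatrix_mul (n m : ℕ) (σ τ : Perm (Fin n)) :
    multilinearMatrix.{u} n m (σ * τ) =
      multilinearMatrix.{u} n m σ * multilinearMatrix.{u} n m τ := by
  ext f g
  rw [multilinearMatrix, Matrix.of_apply, inv_permMatrix_mul, wordMatrix_mul, Matrix.mul_apply,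
    Matrix.mul_apply]
  refine Eq.trans (Eq.symm (Finset.sum_filter_of_ne fun e _ he => ?_))
    (sum_ulift_isMultilinear.{u} fun e => wordMatrix n m (σ⁻¹.permMatrix ℂ) f.down e *
      wordMatrix n m (τ⁻¹.permMatrix ℂ) e g.down).symm
  exact (isMultilinear_iff_of_wordMatrix_ne_zero σ (left_ne_zero_of_mul he)).mp f.down.2

open Classical in
theorem trace_multilinearMatrix (n m : ℕ) (σ : Perm (Fin n)) :
    (multilinearMatrix.{u} n m σ).trace = multilinearTrace σ (homogLiePartial n m) := by
  rw [multilinearTrace_apply, ← trace_wordMatrix, wordMatrix_diagonal_mul, Matrix.trace,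
    Matrix.trace, MvPolynomial.coeff_sum]
  refine (sum_ulift_isMultilinear.{u} fun e => wordMatrix n m (σ⁻¹.permMatrix ℂ) e e).trans ?_
  rw [Finset.sum_filter]
  refine Finset.sum_congr rfl fun f _ => ?_
  rw [Matrix.diag_apply, Matrix.diagonal_mul,
    wordMatrix_inv_permMatrix_apply (R := MvPolynomial (Fin n) ℂ), mul_comm,
    MvPolynomial.algebraMap_eq, MvPolynomial.coeff_C_mul, wordWeight_X,
    MvPolynomial.coeff_monomial, mul_ite, mul_one, mul_zero]
  exact if_congr Iff.rfl rfl rfl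

open Classical in
theorem exists_isVhFamily (n : ℕ) :
    ∃ (W : Fin (n + 1) → Type u) (_ : ∀ r, AddCommGroup (W r)) (_ : ∀ r, Module ℂ (W r))
      (ρ : ∀ r, Representation ℂ (Perm (Fin n)) (W r)), IsVhFamily ρ := by
  refine ⟨_, _, _, fun r : Fin (n + 1) => matrixRep (multilinearMatrix.{u} n (n - (r : ℕ)))
    (multilinearMatrix_mul n (n - r)), fun r => ⟨inferInstance, ?_⟩⟩
  ext w
  rw [MvPolynomial.coeff_coe, frobeniusChar_eq_charSum, vhChar, degreeTerm_plethysm]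
  simp_rw [funext (character_matrixRep _ _), trace_multilinearMatrix]
  rw [coeff_charSum_multilinearTrace, ← MvPolynomial.coeff_coe]
  rfl

end MultilinearWords
/-! ### Symmetric polynomials and alternants -/

section SymmEval

/-- The symmetric polynomial in `N` variables given by a symmetric function. -/
def symmEval (N : ℕ) : SymmFun →ₐ[ℂ] MvPolynomial (Fin N) ℂ :=
  MvPolynomial.aeval fun k : ℕ+ => ∑ i, MvPolynomial.X i ^ (k : ℕ)

/-- A function on `Fin N`, as an exponent vector. -/
def expVec {N : ℕ} (l : Fin N → ℕ) : Fin N →₀ ℕ := Finsupp.equivFunOnFinite.symm l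

theorem expVec_injective {N : ℕ} : Function.Injective (expVec : (Fin N → ℕ) → Fin N →₀ ℕ) :=
  Finsupp.equivFunOnFinite.symm.injective

theorem prod_X_pow_eq_monomial {N : ℕ} {R : Type*} [CommSemiring R] (l : Fin N → ℕ) :
    ∏ i, (MvPolynomial.X i : MvPolynomial (Fin N) R) ^ l i =
      MvPolynomial.monomial (expVec l) 1 := by
  rw [MvPolynomial.monomial_eq, map_one, one_mul, Finsupp.prod_fintype _ _ fun _ => pow_zero _]
  rfl

/-- The sequence `p_k ⊗ p_k(x)`. Substituting it for the power sums `p_k` in `h_n` gives the degree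
`n` part of the Cauchy kernel, with the coefficients in `SymmFun`. -/
def cauchySeq (N : ℕ) (k : ℕ+) : MvPolynomial (Fin N) SymmFun :=
  MvPolynomial.C (MvPolynomial.X k) * ∑ i, MvPolynomial.X i ^ (k : ℕ)

theorem aeval_cauchySeq_cycleMonomial {n N : ℕ} (σ : Perm (Fin n)) :
    MvPolynomial.aeval (cauchySeq N) (cycleMonomial σ) = MvPolynomial.C (cycleMonomial σ) *
      MvPolynomial.map (algebraMap ℂ SymmFun) (symmEval N (cycleMonomial σ)) := by
  rw [cycleMonomial, powerSumPart_eq_monomial, symmEval, MvPolynomial.aeval_monomial,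
    MvPolynomial.aeval_monomial, (algebraMap ℂ _).map_one, (algebraMap ℂ _).map_one, one_mul,
    one_mul]
  simp_rw [cauchySeq, mul_pow]
  rw [Finsupp.prod_mul]
  congr 1
  · rw [MvPolynomial.monomial_eq, map_one, one_mul, Finsupp.prod, Finsupp.prod, map_prod]
    simp_rw [map_pow]
  · rw [Finsupp.prod, Finsupp.prod, map_prod]
    simp

theorem isNewtonSeq_C_completeHomog (N : ℕ) :
    IsNewtonSeq (fun k : ℕ+ => (MvPolynomial.C (MvPolynomial.X k) : MvPolynomial (Fin N) SymmFun))
      fun m => MvPolynomial.C (completeHomog m) := by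
  convert isNewtonSeq_aeval
    (fun k : ℕ+ => (MvPolynomial.C (MvPolynomial.X k) : MvPolynomial (Fin N) SymmFun)) using 2
      with m
  have haeval := MvPolynomial.comp_aeval_apply (MvPolynomial.X : ℕ+ → SymmFun)
    (Algebra.algHom ℂ SymmFun (MvPolynomial (Fin N) SymmFun)) (completeHomog m)
  rwa [MvPolynomial.aeval_X_left_apply] at haeval

theorem coeff_prod_C_completeHomog_mul_X_pow {N : ℕ} (α l : Fin N →₀ ℕ) :
    MvPolynomial.coeff α (∏ i, (MvPolynomial.C (completeHomog (l i)) * MvPolynomial.X i ^ l i :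
      MvPolynomial (Fin N) SymmFun)) = if l = α then ∏ i, completeHomog (l i) else 0 := by
  rw [Finset.prod_mul_distrib, prod_X_pow_eq_monomial, ← map_prod, MvPolynomial.coeff_C_mul,
    MvPolynomial.coeff_monomial, mul_ite, mul_one, mul_zero,
    show expVec l = l from Finsupp.equivFunOnFinite.symm_apply_apply l]

theorem coeff_aeval_cauchySeq_completeHomog {n N : ℕ} (α : Fin N →₀ ℕ) :
    MvPolynomial.coeff α (MvPolynomial.aeval (cauchySeq N) (completeHomog n)) =
      if ∑ i, α i = n then ∏ i, completeHomog (α i) else 0 := by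
  have hsum : cauchySeq N = ∑ i : Fin N, fun k : ℕ+ =>
      MvPolynomial.C (MvPolynomial.X k : SymmFun) *
        (MvPolynomial.X i : MvPolynomial (Fin N) SymmFun) ^ (k : ℕ) := by
    funext k
    rw [Finset.sum_apply, cauchySeq, Finset.mul_sum]
  rw [hsum, aeval_completeHomog_sum Finset.univ _
    (fun i m => MvPolynomial.C (completeHomog m) * MvPolynomial.X i ^ m)
    fun i _ => isNewtonSeq_mul_pow _ _ (isNewtonSeq_C_completeHomog N) _,
    PowerSeries.coeff_prod, MvPolynomial.coeff_sum]
  simp_rw [PowerSeries.coeff_mk, coeff_prod_C_completeHomog_mul_X_pow]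
  rw [Finset.sum_ite_eq']
  refine if_congr ?_ rfl rfl
  rw [Finset.mem_finsuppAntidiag]
  simp

theorem charSum_coeff_symmEval {n N : ℕ} (α : Fin N →₀ ℕ) :
    charSum (fun σ : Perm (Fin n) => MvPolynomial.coeff α (symmEval N (cycleMonomial σ))) =
      if ∑ i, α i = n then ∏ i, completeHomog (α i) else 0 := by
  rw [← coeff_aeval_cauchySeq_completeHomog, completeHomog_eq_charSum, charSum, charSum, map_smul,
    map_sum, MvPolynomial.coeff_smul, MvPolynomial.coeff_sum]
  congr 1
  refine Finset.sum_congr rfl fun σ _ => ?_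
  rw [one_smul, aeval_cauchySeq_cycleMonomial, MvPolynomial.coeff_C_mul, MvPolynomial.coeff_map,
    Algebra.smul_def, mul_comm]

end SymmEval

section Alternant

variable {N : ℕ}

/-- The alternant `a_l = det (x_j ^ l_i)`, the numerator in the bialternant formula. -/
def alternant (l : Fin N → ℕ) : MvPolynomial (Fin N) ℂ :=
  Matrix.det (Matrix.of fun i j => MvPolynomial.X j ^ l i)

theorem alternant_eq (l : Fin N → ℕ) : alternant l =
    ∑ w : Perm (Fin N), MvPolynomial.monomial (expVec (l ∘ w)) ((Perm.sign w : ℤ) : ℂ) := by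
  rw [alternant, Matrix.det_apply]
  refine Finset.sum_congr rfl fun w _ => ?_
  simp_rw [Matrix.of_apply]
  rw [prod_X_pow_eq_monomial fun i => l (w i), ← zsmul_one, Units.smul_def, ← map_zsmul]
  rfl

theorem coeff_mul_alternant (P : MvPolynomial (Fin N) ℂ) (l m : Fin N → ℕ) :
    MvPolynomial.coeff (expVec m) (P * alternant l) = ∑ w : Perm (Fin N), ((Perm.sign w : ℤ) : ℂ) *
      if ∀ i, l (w i) ≤ m i then MvPolynomial.coeff (expVec fun i => m i - l (w i)) P else 0 := by
  rw [alternant_eq, Finset.mul_sum, MvPolynomial.coeff_sum]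
  refine Finset.sum_congr rfl fun w _ => ?_
  rw [MvPolynomial.coeff_mul_monomial', mul_ite, mul_zero, mul_comm]
  rw [show expVec m - expVec (l ∘ w) = expVec fun i => m i - l (w i) from Finsupp.ext fun _ => rfl]
  exact if_congr Iff.rfl rfl rfl

theorem eq_one_of_strictMono {w : Perm (Fin N)} (hw : StrictMono w) : w = 1 :=
  Equiv.coe_fn_injective ((hw.range_inj strictMono_id).mp
    (w.surjective.range_eq.trans Set.range_id.symm))

theorem comp_perm_eq_iff {l m : Fin N → ℕ} (hl : StrictAnti l) (hm : StrictAnti m)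
    (w : Perm (Fin N)) : l ∘ w = m ↔ w = 1 ∧ l = m := by
  constructor
  · rintro rfl
    have hw : w = 1 := eq_one_of_strictMono fun i j hij => hl.lt_iff_gt.mp (hm hij)
    subst hw
    exact ⟨rfl, rfl⟩
  · rintro ⟨rfl, rfl⟩
    rfl

theorem coeff_alternant {l m : Fin N → ℕ} (hl : StrictAnti l) (hm : StrictAnti m) :
    MvPolynomial.coeff (expVec m) (alternant l) = if l = m then 1 else 0 := by
  classical
  rw [alternant_eq, MvPolynomial.coeff_sum]
  simp_rw [MvPolynomial.coeff_monomial, expVec_injective.eq_iff, comp_perm_eq_iff hl hm]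
  rw [Finset.sum_eq_single 1]
  · simp
  · intro w _ hw
    simp [hw]
  · simp

end Alternant

section JacobiTrudi

theorem completeHomogInt_zero : completeHomogInt 0 = 1 := by
  rw [completeHomogInt, if_neg (lt_irrefl 0), Int.toNat_zero, completeHomog_zero]

theorem completeHomogInt_of_neg {m : ℤ} (hm : m < 0) : completeHomogInt m = 0 := if_pos hm

theorem completeHomogInt_natCast (m : ℕ) : completeHomogInt m = completeHomog m := by
  rw [completeHomogInt, if_neg (by omega), Int.toNat_natCast]

theorem det_completeHomogInt_sub (d : ℕ) :
    (Matrix.of fun i j : Fin d => completeHomogInt ((j : ℤ) - i)).det = 1 := by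
  rw [Matrix.det_of_isUpperTriangular, Finset.prod_eq_one]
  · intro i _
    rw [Matrix.of_apply, sub_self, completeHomogInt_zero]
  · intro i j hij
    have hji : j < i := hij
    rw [Matrix.of_apply, completeHomogInt_of_neg (sub_neg.mpr (Nat.cast_lt.mpr hji))]

/-- The exponents `δ = (N - 1, …, 1, 0)` of the Vandermonde determinant. -/
def staircase (N : ℕ) (i : Fin N) : ℕ := N - 1 - i

theorem strictAnti_staircase (N : ℕ) : StrictAnti (staircase N) := fun i j hij => by
  rw [Fin.lt_def] at hij
  simp only [staircase]
  omega

variable {N : ℕ}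

/-- The matrix `h_{l_i - δ_j}`, whose determinant for `l = λ + δ` is the Jacobi–Trudi determinant
of the Schur function `s_λ`. -/
def homogMatrix (l : Fin N → ℕ) : Matrix (Fin N) (Fin N) SymmFun :=
  Matrix.of fun i j => completeHomogInt ((l i : ℤ) - staircase N j)

theorem mk_symmEval_completeHomog : (PowerSeries.mk fun m => symmEval N (completeHomog m)) =
    ∏ i, PowerSeries.mk fun m => (MvPolynomial.X i : MvPolynomial (Fin N) ℂ) ^ m := by
  have hsum : (fun k : ℕ+ => ∑ i : Fin N, (MvPolynomial.X i : MvPolynomial (Fin N) ℂ) ^ (k : ℕ)) =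
      ∑ i : Fin N, fun k : ℕ+ => (MvPolynomial.X i : MvPolynomial (Fin N) ℂ) ^ (k : ℕ) := by
    funext k
    rw [Finset.sum_apply]
  ext1 m
  rw [PowerSeries.coeff_mk, symmEval, hsum]
  refine aeval_completeHomog_sum _ _ (fun i m => MvPolynomial.X i ^ m) (fun i _ => ?_) m
  simpa only [one_mul] using
    isNewtonSeq_mul_pow (R := MvPolynomial (Fin N) ℂ) _ _ isNewtonSeq_one (MvPolynomial.X i)

theorem mk_pow_mul_one_sub {R : Type*} [CommRing R] (y : R) :
    (PowerSeries.mk fun m => y ^ m) * (1 - PowerSeries.C y * PowerSeries.X) = 1 := by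
  ext m
  rcases m with _ | m
  · simp
  · rw [mul_sub, mul_one, map_sub, mul_left_comm, PowerSeries.coeff_C_mul,
      PowerSeries.coeff_succ_mul_X, PowerSeries.coeff_mk, PowerSeries.coeff_mk, pow_succ',
      sub_self, PowerSeries.coeff_one, if_neg m.succ_ne_zero]

/-- The polynomial `∏_{i ≠ k} (1 - x_i t)` in `t`: multiplying `∑ h_m t ^ m` by it cancels all
factors of `∏ (1 - x_i t)⁻¹` but the `k`-th. -/
def complementPoly (k : Fin N) : Polynomial (MvPolynomial (Fin N) ℂ) :=
  ∏ i ∈ Finset.univ.erase k, (1 - Polynomial.C (MvPolynomial.X i) * Polynomial.X)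

theorem coeff_complementPoly {k : Fin N} {r : ℕ} (hr : N ≤ r) : (complementPoly k).coeff r = 0 := by
  refine Polynomial.coeff_eq_zero_of_natDegree_lt ?_
  have hdeg : (complementPoly k).natDegree ≤ ∑ i ∈ Finset.univ.erase k, 1 :=
    (Polynomial.natDegree_prod_le _ _).trans (Finset.sum_le_sum fun i _ =>
      (Polynomial.natDegree_sub_le _ _).trans (max_le (by simp)
        ((Polynomial.natDegree_C_mul_le _ _).trans Polynomial.natDegree_X_le)))
  rw [Finset.sum_const, Finset.card_erase_of_mem (Finset.mem_univ k), Finset.card_univ,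
    Fintype.card_fin, smul_eq_mul, mul_one] at hdeg
  have hk := k.isLt
  omega

theorem mk_symmEval_mul_complementPoly (k : Fin N) :
    (PowerSeries.mk fun m => symmEval N (completeHomog m)) * (complementPoly k : PowerSeries _) =
      PowerSeries.mk fun m => (MvPolynomial.X k : MvPolynomial (Fin N) ℂ) ^ m := by
  have hcoe : (complementPoly k : PowerSeries (MvPolynomial (Fin N) ℂ)) =
      ∏ i ∈ Finset.univ.erase k, (1 - PowerSeries.C (MvPolynomial.X i) * PowerSeries.X) := by
    rw [complementPoly, ← Polynomial.coeToPowerSeries.ringHom_apply, map_prod]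
    simp
  rw [mk_symmEval_completeHomog, hcoe, ← Finset.mul_prod_erase _ _ (Finset.mem_univ k), mul_assoc,
    ← Finset.prod_mul_distrib, Finset.prod_eq_one, mul_one]
  exact fun i _ => mk_pow_mul_one_sub _

theorem sum_staircase {M : Type*} [AddCommMonoid M] (f : ℕ → M) :
    ∑ j, f (staircase N j) = ∑ r ∈ Finset.range N, f r := by
  rw [← Fin.sum_univ_eq_sum_range, ← Equiv.sum_comp Fin.revPerm]
  refine Finset.sum_congr rfl fun j _ => congrArg f ?_
  rw [staircase, Fin.revPerm_apply, Fin.val_rev]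
  omega

theorem sum_range_symmEval_mul_coeff_complementPoly (m : ℕ) (k : Fin N) :
    ∑ r ∈ Finset.range (m + 1), symmEval N (completeHomogInt ((m : ℤ) - r)) *
      (complementPoly k).coeff r = MvPolynomial.X k ^ m := by
  have hcoeff := congrArg (PowerSeries.coeff m) (mk_symmEval_mul_complementPoly k)
  rw [PowerSeries.coeff_mk, mul_comm, PowerSeries.coeff_mul,
    Finset.Nat.sum_antidiagonal_eq_sum_range_succ_mk] at hcoeff
  rw [← hcoeff]
  refine Finset.sum_congr rfl fun r hr => ?_
  rw [Finset.mem_range] at hr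
  rw [Polynomial.coeff_coe, PowerSeries.coeff_mk, mul_comm,
    show (m : ℤ) - r = (m - r : ℕ) by omega, completeHomogInt_natCast]

theorem sum_symmEval_mul_coeff_complementPoly (m : ℕ) (k : Fin N) :
    ∑ j, symmEval N (completeHomogInt ((m : ℤ) - staircase N j)) *
      (complementPoly k).coeff (staircase N j) = MvPolynomial.X k ^ m := by
  rw [← sum_range_symmEval_mul_coeff_complementPoly, sum_staircase fun r =>
    symmEval N (completeHomogInt ((m : ℤ) - r)) * (complementPoly k).coeff r]
  trans ∑ r ∈ Finset.range (N + (m + 1)),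
    symmEval N (completeHomogInt ((m : ℤ) - r)) * (complementPoly k).coeff r
  · refine Finset.sum_subset (Finset.range_mono (Nat.le_add_right _ _)) fun r _ hr => ?_
    rw [coeff_complementPoly (by simpa using hr), mul_zero]
  · refine (Finset.sum_subset (Finset.range_mono (Nat.le_add_left _ _)) fun r _ hr => ?_).symm
    rw [Finset.mem_range] at hr
    rw [completeHomogInt_of_neg (by omega), map_zero, zero_mul]

theorem det_homogMatrix_staircase : (homogMatrix (staircase N)).det = 1 := by
  rw [← det_completeHomogInt_sub N, homogMatrix]
  congr 1
  ext1 i j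
  have hi := i.isLt
  have hj := j.isLt
  rw [Matrix.of_apply, Matrix.of_apply]
  congr 1
  simp only [staircase]
  omega

theorem bialternant_formula (l : Fin N → ℕ) :
    symmEval N (homogMatrix l).det * alternant (staircase N) = alternant l := by
  have hfactor : ∀ l : Fin N → ℕ, alternant l = symmEval N (homogMatrix l).det *
      (Matrix.of fun j k : Fin N => (complementPoly k).coeff (staircase N j)).det := by
    intro l
    rw [AlgHom.map_det, ← Matrix.det_mul, alternant]
    congr 1
    ext1 i k
    rw [Matrix.of_apply, ← sum_symmEval_mul_coeff_complementPoly, Matrix.mul_apply]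
    rfl
  rw [hfactor l, hfactor (staircase N), det_homogMatrix_staircase, map_one, one_mul]

end JacobiTrudi

/-! ### Schur functions as characteristics -/

section Padding

theorem det_jacobiTrudi_add (f : ℕ → ℕ) (a d : ℕ) (hf : ∀ i, a ≤ i → f i = 0) :
    Matrix.det (Matrix.of fun i j : Fin (a + d) =>
      completeHomogInt ((f i : ℤ) - (i : ℤ) + (j : ℤ))) =
    Matrix.det (Matrix.of fun i j : Fin a =>
      completeHomogInt ((f i : ℤ) - (i : ℤ) + (j : ℤ))) := by
  set M := Matrix.of fun i j : Fin (a + d) => completeHomogInt ((f i : ℤ) - (i : ℤ) + (j : ℤ))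
    with hM
  set B := M.submatrix finSumFinEquiv finSumFinEquiv with hB
  have hlowerLeft : B.toBlocks₂₁ = 0 := by
    ext1 i j
    rw [Matrix.toBlocks₂₁, Matrix.of_apply, hB, Matrix.submatrix_apply, hM, Matrix.of_apply,
      finSumFinEquiv_apply_right, finSumFinEquiv_apply_left, Matrix.zero_apply,
      hf _ (by simp), Fin.val_natAdd, Fin.val_castAdd]
    have hj := j.isLt
    exact completeHomogInt_of_neg (by omega)
  have hlowerRight : B.toBlocks₂₂ = Matrix.of fun i j : Fin d =>
      completeHomogInt ((j : ℤ) - i) := by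
    ext1 i j
    rw [Matrix.toBlocks₂₂, Matrix.of_apply, hB, Matrix.submatrix_apply, hM, Matrix.of_apply,
      finSumFinEquiv_apply_right, finSumFinEquiv_apply_right, hf _ (by simp), Fin.val_natAdd,
      Fin.val_natAdd, Matrix.of_apply]
    congr 1
    push_cast
    ring
  rw [← Matrix.det_submatrix_equiv_self finSumFinEquiv M, ← hB, ← Matrix.fromBlocks_toBlocks B,
    hlowerLeft, Matrix.det_fromBlocks_zero₂₁, hlowerRight, det_completeHomogInt_sub, mul_one]
  rfl

variable {n : ℕ}

/-- The `i`-th largest part of a partition (zero beyond the last part). -/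
def nthPart (ν : n.Partition) (i : ℕ) : ℕ := (sortedParts ν).getD i 0

/-- The exponents `ν + δ`, with `δ = (n - 1, …, 1, 0)`. -/
def shiftedParts (ν : n.Partition) (i : Fin n) : ℕ := nthPart ν i + staircase n i

theorem sum_sortedParts (ν : n.Partition) : (sortedParts ν).sum = n := by
  rw [sortedParts, ← Multiset.sum_coe, Multiset.sort_eq, ν.parts_sum]

theorem length_sortedParts_le (ν : n.Partition) : (sortedParts ν).length ≤ n := by
  rw [sortedParts, Multiset.length_sort]
  conv_rhs => rw [← ν.parts_sum]
  simpa using Multiset.card_nsmul_le_sum (s := ν.parts) (a := 1) fun i hi => ν.parts_pos hi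

theorem nthPart_of_length_le (ν : n.Partition) {i : ℕ} (h : (sortedParts ν).length ≤ i) :
    nthPart ν i = 0 := List.getD_eq_default _ _ h

theorem antitone_nthPart (ν : n.Partition) : Antitone (nthPart ν) := by
  intro i j hij
  by_cases hj : j < (sortedParts ν).length
  · have hi := hij.trans_lt hj
    rw [nthPart, nthPart, List.getD_eq_getElem _ _ hi, List.getD_eq_getElem _ _ hj]
    rcases hij.eq_or_lt with rfl | hij
    · exact le_rfl
    · exact List.pairwise_iff_getElem.mp (Multiset.pairwise_sort ν.parts (· ≥ ·)) i j hi hj hij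
  · rw [nthPart_of_length_le ν (not_lt.mp hj)]
    exact Nat.zero_le _

theorem strictAnti_shiftedParts (ν : n.Partition) : StrictAnti (shiftedParts ν) := fun _ _ hij =>
  add_lt_add_of_le_of_lt (antitone_nthPart ν hij.le) (strictAnti_staircase n hij)

theorem sum_nthPart (ν : n.Partition) : ∑ i : Fin n, nthPart ν i = n := by
  conv_rhs => rw [← sum_sortedParts ν]
  rw [Fin.sum_univ_eq_sum_range (nthPart ν), ← Fin.sum_univ_getElem,
    ← Finset.sum_subset (Finset.range_mono (length_sortedParts_le ν)), ← Fin.sum_univ_eq_sum_range]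
  · exact Finset.sum_congr rfl fun i _ => List.getD_eq_getElem _ _ i.isLt
  · intro i _ hi
    exact nthPart_of_length_le ν (by simpa using hi)

theorem nthPart_pos_iff (ν : n.Partition) (i : ℕ) :
    0 < nthPart ν i ↔ i < (sortedParts ν).length := by
  refine ⟨fun hpos => not_le.mp fun hi => hpos.ne' (nthPart_of_length_le ν hi), fun hi => ?_⟩
  rw [nthPart, List.getD_eq_getElem _ _ hi]
  exact ν.parts_pos ((Multiset.mem_sort _).mp (List.getElem_mem hi))

theorem nthPart_injective : Function.Injective (nthPart : n.Partition → ℕ → ℕ) := by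
  intro ν μ h
  have hlength : (sortedParts ν).length = (sortedParts μ).length :=
    eq_of_forall_lt_iff fun i => by rw [← nthPart_pos_iff, ← nthPart_pos_iff, h]
  have hsorted : sortedParts ν = sortedParts μ := by
    refine List.ext_getElem hlength fun i hi hi' => ?_
    rw [← List.getD_eq_getElem _ 0 hi, ← List.getD_eq_getElem _ 0 hi']
    exact congrFun h i
  refine Nat.Partition.ext ?_
  rw [← Multiset.sort_eq ν.parts (· ≥ ·), ← Multiset.sort_eq μ.parts (· ≥ ·)]
  exact congrArg _ hsorted

theorem shiftedParts_injective : Function.Injective (shiftedParts : n.Partition → Fin n → ℕ) := by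
  intro ν μ h
  refine nthPart_injective (funext fun i => ?_)
  rcases lt_or_ge i n with hi | hi
  · exact Nat.add_right_cancel (congrFun h ⟨i, hi⟩)
  · rw [nthPart_of_length_le ν ((length_sortedParts_le ν).trans hi),
      nthPart_of_length_le μ ((length_sortedParts_le μ).trans hi)]

theorem schurFun_eq_det_of_length_le (ν : n.Partition) {m : ℕ} (hm : (sortedParts ν).length ≤ m) :
    schurFun ν = Matrix.det (Matrix.of fun i j : Fin m =>
      completeHomogInt ((nthPart ν i : ℤ) - (i : ℤ) + (j : ℤ))) := by
  obtain ⟨d, rfl⟩ := Nat.exists_eq_add_of_le hm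
  rw [det_jacobiTrudi_add _ _ _ fun i hi => nthPart_of_length_le ν hi, schurFun]
  congr 1
  ext1 i j
  rw [Matrix.of_apply, Matrix.of_apply, nthPart, List.getD_eq_getElem _ _ i.isLt,
    List.get_eq_getElem]

theorem schurFun_eq_det_homogMatrix (ν : n.Partition) :
    schurFun ν = (homogMatrix (shiftedParts ν)).det := by
  rw [schurFun_eq_det_of_length_le ν (length_sortedParts_le ν), homogMatrix]
  congr 1
  ext1 i j
  have hi := i.isLt
  have hj := j.isLt
  rw [Matrix.of_apply, Matrix.of_apply, shiftedParts]
  congr 1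
  simp only [staircase]
  omega

end Padding

section SchurCharacter

variable {n : ℕ}

/-- The coefficient of `s_ν` in the Schur expansion of `f`, read off by the bialternant formula as
the coefficient of `x ^ (ν + δ)` in `f(x) a_δ(x)`. -/
def schurCoeff (ν : n.Partition) : SymmFun →ₗ[ℂ] ℂ :=
  (MvPolynomial.lcoeff ℂ (expVec (shiftedParts ν))).comp
    ((LinearMap.mulRight ℂ (alternant (staircase n))).comp (symmEval n).toLinearMap)

theorem schurCoeff_apply (ν : n.Partition) (f : SymmFun) : schurCoeff ν f =
    MvPolynomial.coeff (expVec (shiftedParts ν)) (symmEval n f * alternant (staircase n)) := rfl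

theorem symmEval_schurFun_mul_alternant (ν : n.Partition) :
    symmEval n (schurFun ν) * alternant (staircase n) = alternant (shiftedParts ν) := by
  rw [schurFun_eq_det_homogMatrix, bialternant_formula]

theorem schurCoeff_schurFun (ν μ : n.Partition) :
    schurCoeff ν (schurFun μ) = if μ = ν then 1 else 0 := by
  rw [schurCoeff_apply, symmEval_schurFun_mul_alternant,
    coeff_alternant (strictAnti_shiftedParts μ) (strictAnti_shiftedParts ν)]
  simp_rw [shiftedParts_injective.eq_iff]

/-- The irreducible character of `S_n` attached to a partition. -/
def schurCharacter (ν : n.Partition) (σ : Perm (Fin n)) : ℂ := schurCoeff ν (cycleMonomial σ)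

theorem schurCharacter_of_isConj (ν : n.Partition) (σ τ : Perm (Fin n)) (h : IsConj σ τ) :
    schurCharacter ν σ = schurCharacter ν τ := by
  rw [schurCharacter, schurCharacter, cycleMonomial_of_isConj h]

theorem sum_shiftedParts_sub_staircase (ν : n.Partition) {w : Perm (Fin n)}
    (hw : ∀ i, staircase n (w i) ≤ shiftedParts ν i) :
    ∑ i, (shiftedParts ν i - staircase n (w i)) = n := by
  refine Nat.add_right_cancel (m := ∑ i, staircase n i) ?_
  calc ∑ i, (shiftedParts ν i - staircase n (w i)) + ∑ i, staircase n i
      = ∑ i, (shiftedParts ν i - staircase n (w i)) + ∑ i, staircase n (w i) := by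
        rw [Equiv.sum_comp w (staircase n)]
    _ = ∑ i, shiftedParts ν i := by
        rw [← Finset.sum_add_distrib]
        exact Finset.sum_congr rfl fun i _ => Nat.sub_add_cancel (hw i)
    _ = n + ∑ i, staircase n i :=
        Finset.sum_add_distrib.trans (congrArg (· + _) (sum_nthPart ν))

theorem charSum_schurCharacter (ν : n.Partition) : charSum (schurCharacter ν) = schurFun ν := by
  have hexpand : schurCharacter ν = fun σ => ∑ w : Perm (Fin n), ((Perm.sign w : ℤ) : ℂ) *
      if ∀ i, staircase n (w i) ≤ shiftedParts ν i then
        MvPolynomial.coeff (expVec fun i => shiftedParts ν i - staircase n (w i))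
          (symmEval n (cycleMonomial σ))
      else 0 :=
    funext fun σ => coeff_mul_alternant _ _ _
  rw [hexpand, charSum_sum, schurFun_eq_det_homogMatrix, ← Matrix.det_transpose, Matrix.det_apply]
  refine Finset.sum_congr rfl fun w _ => ?_
  rw [charSum_smul, Units.smul_def, Int.cast_smul_eq_zsmul]
  congr 1
  split_ifs with hw
  · rw [charSum_coeff_symmEval]
    refine (if_pos (sum_shiftedParts_sub_staircase ν hw)).trans ?_
    refine Finset.prod_congr rfl fun i _ => ?_
    rw [Matrix.transpose_apply, homogMatrix, Matrix.of_apply, ← Nat.cast_sub (hw i),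
      completeHomogInt_natCast]
    rfl
  · push Not at hw
    obtain ⟨i, hi⟩ := hw
    rw [Finset.prod_eq_zero (Finset.mem_univ i)]
    · simp only [charSum, zero_smul, Finset.sum_const_zero, smul_zero]
    · rw [Matrix.transpose_apply, homogMatrix, Matrix.of_apply,
        completeHomogInt_of_neg (by omega)]

theorem coeff_charSum_of_psDegree_ne (φ : Perm (Fin n) → ℂ) {w : ℕ+ →₀ ℕ} (hw : psDegree w ≠ n) :
    MvPolynomial.coeff w (charSum φ) = 0 := by
  rw [charSum, MvPolynomial.coeff_smul, MvPolynomial.coeff_sum, Finset.sum_eq_zero, smul_zero]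
  intro σ _
  rw [cycleMonomial, powerSumPart_eq_monomial, MvPolynomial.coeff_smul,
    MvPolynomial.coeff_monomial, if_neg, smul_zero]
  rintro rfl
  exact hw ((psDegree_partExp σ.partition).trans (Fintype.card_fin n))

theorem charSum_eq_sum_powerSumPart (φ : Perm (Fin n) → ℂ) : charSum φ =
    ∑ ν : n.Partition, MvPolynomial.coeff (partExp ν) (charSum φ) • powerSumPart ν := by
  classical
  ext w
  simp_rw [MvPolynomial.coeff_sum, MvPolynomial.coeff_smul, powerSumPart_eq_monomial,
    MvPolynomial.coeff_monomial, smul_eq_mul, mul_ite, mul_one, mul_zero]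
  by_cases hw : psDegree w = n
  · obtain ⟨ν, rfl⟩ := exists_partExp_eq hw
    simp_rw [partExp_injective.eq_iff]
    rw [Finset.sum_ite_eq', if_pos (Finset.mem_univ ν)]
  · rw [coeff_charSum_of_psDegree_ne φ hw, Finset.sum_eq_zero]
    intro ν _
    refine if_neg ?_
    rintro rfl
    exact hw (psDegree_partExp ν)

theorem schurFun_eq_sum_powerSumPart (ν : n.Partition) :
    schurFun ν =
      ∑ μ : n.Partition, MvPolynomial.coeff (partExp μ) (schurFun ν) • powerSumPart μ := by
  simpa only [charSum_schurCharacter] using charSum_eq_sum_powerSumPart (schurCharacter ν)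

theorem powerSumPart_eq_sum_schurFun (μ : n.Partition) :
    powerSumPart μ = ∑ ν : n.Partition, schurCoeff ν (powerSumPart μ) • schurFun ν := by
  classical
  let S : Matrix n.Partition n.Partition ℂ :=
    Matrix.of fun ν μ => MvPolynomial.coeff (partExp μ) (schurFun ν)
  let T : Matrix n.Partition n.Partition ℂ := Matrix.of fun μ ν => schurCoeff ν (powerSumPart μ)
  have hST : S * T = 1 := by
    ext ν κ
    have hcoeff := schurCoeff_schurFun κ ν
    rw [schurFun_eq_sum_powerSumPart ν, map_sum] at hcoeff
    simp_rw [map_smul] at hcoeff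
    rw [Matrix.one_apply, ← hcoeff]
    rfl
  have hTS : ∀ κ, ∑ ν, schurCoeff ν (powerSumPart μ) * S ν κ = (1 : Matrix _ _ ℂ) μ κ := fun κ => by
    rw [← mul_eq_one_comm.mp hST]
    rfl
  conv_rhs =>
    enter [2, ν]
    rw [schurFun_eq_sum_powerSumPart ν, Finset.smul_sum]
  rw [Finset.sum_comm]
  simp_rw [smul_smul, ← Finset.sum_smul]
  change _ = ∑ κ, (∑ ν, schurCoeff ν (powerSumPart μ) * S ν κ) • powerSumPart κ
  simp_rw [hTS, Matrix.one_apply, ite_smul, one_smul, zero_smul]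
  rw [Finset.sum_ite_eq, if_pos (Finset.mem_univ _)]

theorem charSum_eq_sum_schurFun (φ : Perm (Fin n) → ℂ) :
    charSum φ = ∑ ν : n.Partition, schurCoeff ν (charSum φ) • schurFun ν := by
  conv_rhs =>
    enter [2, ν]
    rw [charSum_eq_sum_powerSumPart, map_sum]
  simp_rw [map_smul, Finset.sum_smul]
  rw [Finset.sum_comm]
  conv_lhs => rw [charSum_eq_sum_powerSumPart]
  refine Finset.sum_congr rfl fun μ _ => ?_
  conv_lhs => rw [powerSumPart_eq_sum_schurFun μ, Finset.smul_sum]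
  simp_rw [smul_smul]
  rfl

end SchurCharacter
/-! ### Schur positivity of characteristics -/

section WordRepresentation

/-- Words of length `n` and content `α`, that is, in which the letter `j` occurs `α j` times. -/
abbrev ContentWord (n : ℕ) {N : ℕ} (α : Fin N →₀ ℕ) : Type :=
  {f : Fin n → Fin N // ∑ i, Finsupp.single (f i) 1 = α}

/-- The matrix of the permutation module on the words of content `α`, on which `σ` acts by
`f ↦ f ∘ σ⁻¹`. Its character extracts the coefficient of `x ^ α`. -/
def contentMatrix {n N : ℕ} (α : Fin N →₀ ℕ) (σ : Perm (Fin n)) :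
    Matrix (ContentWord n α) (ContentWord n α) ℂ :=
  Matrix.of fun f g => if f.1 ∘ σ = g.1 then 1 else 0

theorem contentMatrix_mul {n N : ℕ} (α : Fin N →₀ ℕ) (σ τ : Perm (Fin n)) :
    contentMatrix α (σ * τ) = contentMatrix α σ * contentMatrix α τ := by
  ext f h
  have hf : ∑ i, Finsupp.single (f.1 (σ i)) 1 = α :=
    (Equiv.sum_comp σ fun i => Finsupp.single (f.1 i) 1).trans f.2
  rw [Matrix.mul_apply, Finset.sum_eq_single ⟨f.1 ∘ σ, hf⟩]
  · simp only [contentMatrix, Matrix.of_apply, if_true, one_mul]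
    rfl
  · intro g _ hg
    rw [contentMatrix, Matrix.of_apply, if_neg fun hfg => hg (Subtype.ext hfg.symm), zero_mul]
  · simp

theorem symmEval_eq_aeval_trace_diagonal (N : ℕ) : symmEval N = MvPolynomial.aeval fun k : ℕ+ =>
    (Matrix.diagonal (MvPolynomial.X : Fin N → MvPolynomial (Fin N) ℂ) ^ (k : ℕ)).trace := by
  rw [symmEval]
  congr 1
  funext k
  rw [Matrix.diagonal_pow, Matrix.trace_diagonal]
  rfl

theorem coeff_prod_diagonal_X {n N : ℕ} (α : Fin N →₀ ℕ) (σ : Perm (Fin n)) (f : Fin n → Fin N) :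
    MvPolynomial.coeff α (∏ i, Matrix.diagonal
      (MvPolynomial.X : Fin N → MvPolynomial (Fin N) ℂ) (f i) (f (σ i))) =
      if ∑ i, Finsupp.single (f i) 1 = α then (if f ∘ σ = f then 1 else 0) else 0 := by
  simp_rw [Matrix.diagonal_apply]
  rw [Finset.prod_ite_zero, prod_X_eq_monomial, apply_ite (MvPolynomial.coeff α),
    MvPolynomial.coeff_monomial, MvPolynomial.coeff_zero, ← ite_and, ← ite_and]
  have hiff : ((∀ i ∈ Finset.univ, f i = f (σ i)) ∧ ∑ i, Finsupp.single (f i) 1 = α) ↔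
      ∑ i, Finsupp.single (f i) 1 = α ∧ f ∘ σ = f := by
    rw [and_comm, funext_iff]
    simp only [Finset.mem_univ, true_imp_iff, Function.comp_apply, eq_comm]
  simp only [hiff]

theorem coeff_symmEval_cycleMonomial {n N : ℕ} (α : Fin N →₀ ℕ) (σ : Perm (Fin n)) :
    MvPolynomial.coeff α (symmEval N (cycleMonomial σ)) = (contentMatrix α σ).trace := by
  rw [symmEval_eq_aeval_trace_diagonal, ← twistedTrace_eq_aeval_cycleMonomial, twistedTrace,
    MvPolynomial.coeff_sum, Matrix.trace]
  simp_rw [coeff_prod_diagonal_X]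
  rw [← Finset.sum_filter, Finset.sum_subtype _ (p := fun f : Fin n → Fin N =>
    ∑ i, Finsupp.single (f i) 1 = α) fun f => by rw [Finset.mem_filter_univ]]
  rfl

theorem exists_coeff_symmEval_frobeniusChar_eq {n N : ℕ} {V : Type*} [AddCommGroup V] [Module ℂ V]
    [FiniteDimensional ℂ V] (ρ : Representation ℂ (Perm (Fin n)) V) (α : Fin N →₀ ℕ) :
    ∃ m : ℕ, MvPolynomial.coeff α (symmEval N (frobeniusChar ρ)) = m := by
  have : Invertible (Nat.card (Perm (Fin n)) : ℂ) :=
    invertibleOfNonzero (Nat.cast_ne_zero.mpr Nat.card_pos.ne')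
  refine ⟨_, Eq.trans ?_ (Representation.card_inv_mul_sum_char_mul_char_eq_finrank
    (matrixRep (contentMatrix α) (contentMatrix_mul α)) ρ)⟩
  rw [frobeniusChar_eq_charSum, charSum, map_smul, map_sum, MvPolynomial.coeff_smul,
    MvPolynomial.coeff_sum, Nat.card_eq_fintype_card, Fintype.card_perm, Fintype.card_fin,
    smul_eq_mul]
  congr 1
  refine Finset.sum_congr rfl fun σ _ => ?_
  rw [map_smul, MvPolynomial.coeff_smul, character_perm_inv, character_matrixRep,
    coeff_symmEval_cycleMonomial, smul_eq_mul]

end WordRepresentation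

section LeadingCoefficient

variable {N : ℕ} {l : Fin N → ℕ}

theorem toSyn_expVec_comp_perm_le (hl : StrictAnti l) (w : Perm (Fin N)) :
    MonomialOrder.lex.toSyn (expVec (l ∘ w)) ≤ MonomialOrder.lex.toSyn (expVec l) := by
  classical
  rcases eq_or_ne w 1 with rfl | hw
  · exact le_rfl
  have hmoved : (Finset.univ.filter fun k => w k ≠ k).Nonempty := by
    rw [Finset.filter_nonempty_iff]
    by_contra! hfix
    exact hw (Equiv.ext fun k => hfix k (Finset.mem_univ k))
  obtain ⟨k, hk, hmin⟩ := Finset.exists_min_image _ id hmoved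
  replace hk := Finset.mem_filter_univ k |>.mp hk
  have hfix : ∀ j < k, w j = j := fun j hj => by
    by_contra hne
    exact hj.not_ge (hmin j ((Finset.mem_filter_univ j).mpr hne))
  refine le_of_lt (MonomialOrder.lex_lt_iff.mpr (Finsupp.Lex.lt_iff.mpr
    ⟨k, fun j hj => congrArg l (hfix j hj), hl ?_⟩))
  exact lt_of_le_of_ne (not_lt.mp fun hlt => hk (w.injective (hfix _ hlt))) hk.symm

theorem degree_alternant (hl : StrictAnti l) :
    MonomialOrder.lex.degree (alternant l) = expVec l := by
  apply MonomialOrder.lex.toSyn.injective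
  refine le_antisymm ?_ ?_
  · rw [MonomialOrder.degree_le_iff]
    intro b hb
    rw [alternant_eq] at hb
    obtain ⟨w, -, hw⟩ := Finset.mem_biUnion.mp (MvPolynomial.support_sum hb)
    rw [Finset.mem_singleton.mp (MvPolynomial.support_monomial_subset hw)]
    exact toSyn_expVec_comp_perm_le hl w
  · refine MonomialOrder.le_degree (MvPolynomial.mem_support_iff.mpr ?_)
    rw [coeff_alternant hl hl, if_pos rfl]
    exact one_ne_zero

theorem leadingCoeff_alternant (hl : StrictAnti l) :
    MonomialOrder.lex.leadingCoeff (alternant l) = 1 := by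
  rw [MonomialOrder.leadingCoeff, degree_alternant hl, coeff_alternant hl hl, if_pos rfl]

theorem leadingCoeff_symmEval_smul_schurFun {n : ℕ} (ν : n.Partition) (c : ℂ) :
    MonomialOrder.lex.leadingCoeff (symmEval n (c • schurFun ν)) = c := by
  have hlead : MonomialOrder.lex.leadingCoeff
      (symmEval n (c • schurFun ν) * alternant (staircase n)) =
      MonomialOrder.lex.leadingCoeff (c • alternant (shiftedParts ν)) := by
    rw [map_smul, smul_mul_assoc, symmEval_schurFun_mul_alternant]
  rwa [MonomialOrder.leadingCoeff_mul, leadingCoeff_alternant (strictAnti_staircase n), mul_one,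
    MvPolynomial.smul_eq_C_mul (alternant _), MonomialOrder.leadingCoeff_mul,
    MonomialOrder.leadingCoeff_C, leadingCoeff_alternant (strictAnti_shiftedParts ν),
    mul_one] at hlead

end LeadingCoefficient

section Positivity

variable {n : ℕ}

theorem schurCoeff_charSum (ν : n.Partition) (φ : Perm (Fin n) → ℂ) :
    schurCoeff ν (charSum φ) = (n.factorial : ℂ)⁻¹ * ∑ σ, φ σ * schurCharacter ν σ := by
  rw [charSum, map_smul, map_sum, smul_eq_mul]
  simp_rw [map_smul, smul_eq_mul]
  rfl

theorem exists_schurCoeff_frobeniusChar_eq {V : Type*} [AddCommGroup V] [Module ℂ V]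
    [FiniteDimensional ℂ V] (ρ : Representation ℂ (Perm (Fin n)) V) (ν : n.Partition) :
    ∃ z : ℤ, schurCoeff ν (frobeniusChar ρ) = z := by
  rw [schurCoeff_apply, coeff_mul_alternant]
  choose m hm using fun α : Fin n →₀ ℕ => exists_coeff_symmEval_frobeniusChar_eq ρ α
  refine ⟨∑ w : Perm (Fin n), (Perm.sign w : ℤ) * if ∀ i, staircase n (w i) ≤ shiftedParts ν i then
    m (expVec fun i => shiftedParts ν i - staircase n (w i)) else 0, ?_⟩
  push_cast
  simp_rw [hm]

theorem character_eq_sum_schurCharacter {V : Type*} [AddCommGroup V] [Module ℂ V]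
    (ρ : Representation ℂ (Perm (Fin n)) V) :
    ρ.character = fun σ => ∑ ν, schurCoeff ν (frobeniusChar ρ) * schurCharacter ν σ := by
  refine charSum_injective (character_eq_of_isConj ρ) ?_ ?_
  · intro σ τ hστ
    simp_rw [schurCharacter_of_isConj _ σ τ hστ]
  · rw [charSum_sum, charSum_eq_sum_schurFun]
    refine Finset.sum_congr rfl fun ν _ => ?_
    rw [charSum_smul, charSum_schurCharacter]
    rfl

theorem inv_factorial_mul_sum_character_sq {V : Type*} [AddCommGroup V] [Module ℂ V]
    [FiniteDimensional ℂ V] (ρ : Representation ℂ (Perm (Fin n)) V) [ρ.IsIrreducible] :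
    (n.factorial : ℂ)⁻¹ * ∑ σ, ρ.character σ * ρ.character σ = 1 := by
  have : Invertible (Nat.card (Perm (Fin n)) : ℂ) :=
    invertibleOfNonzero (Nat.cast_ne_zero.mpr Nat.card_pos.ne')
  have horthonormal := Representation.char_orthonormal ρ ρ
  rw [if_pos ⟨Representation.Equiv.refl ρ⟩, Nat.card_eq_fintype_card, Fintype.card_perm,
    Fintype.card_fin] at horthonormal
  simpa only [character_perm_inv] using horthonormal

theorem sum_schurCoeff_sq {V : Type*} [AddCommGroup V] [Module ℂ V] [FiniteDimensional ℂ V]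
    (ρ : Representation ℂ (Perm (Fin n)) V) [ρ.IsIrreducible] :
    ∑ ν : n.Partition, schurCoeff ν (frobeniusChar ρ) * schurCoeff ν (frobeniusChar ρ) = 1 := by
  have hcoeff : ∀ ν : n.Partition, schurCoeff ν (frobeniusChar ρ) =
      (n.factorial : ℂ)⁻¹ * ∑ σ, ρ.character σ * schurCharacter ν σ := fun ν =>
    schurCoeff_charSum ν ρ.character
  calc ∑ ν : n.Partition, schurCoeff ν (frobeniusChar ρ) * schurCoeff ν (frobeniusChar ρ)
      = ∑ ν : n.Partition, schurCoeff ν (frobeniusChar ρ) *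
          ((n.factorial : ℂ)⁻¹ * ∑ σ, ρ.character σ * schurCharacter ν σ) :=
        Finset.sum_congr rfl fun ν _ => congrArg _ (hcoeff ν)
    _ = (n.factorial : ℂ)⁻¹ * ∑ σ, ρ.character σ *
          ∑ ν, schurCoeff ν (frobeniusChar ρ) * schurCharacter ν σ := by
        simp_rw [Finset.mul_sum]
        rw [Finset.sum_comm]
        refine Finset.sum_congr rfl fun σ _ => Finset.sum_congr rfl fun ν _ => ?_
        ring
    _ = (n.factorial : ℂ)⁻¹ * ∑ σ, ρ.character σ * ρ.character σ := by
        congr 1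
        exact Finset.sum_congr rfl fun σ _ =>
          congrArg _ (congrFun (character_eq_sum_schurCharacter ρ) σ).symm
    _ = 1 := inv_factorial_mul_sum_character_sq ρ

theorem exists_eq_one_or_neg_one_of_sum_mul_self_eq_one {ι : Type*} [Fintype ι] {z : ι → ℤ}
    (hz : ∑ i, z i * z i = 1) : ∃ i, (z i = 1 ∨ z i = -1) ∧ ∀ j, j ≠ i → z j = 0 := by
  classical
  obtain ⟨i, hi⟩ : ∃ i, z i ≠ 0 := by
    by_contra! hzero
    simp [hzero] at hz
  have hpos : 0 < z i * z i := mul_self_pos.mpr hi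
  have hsplit := Finset.add_sum_erase Finset.univ (fun j => z j * z j) (Finset.mem_univ i)
  have hnonneg : ∀ j ∈ Finset.univ.erase i, 0 ≤ z j * z j := fun j _ => mul_self_nonneg _
  have hrest_nonneg := Finset.sum_nonneg hnonneg
  have hrest : ∑ j ∈ Finset.univ.erase i, z j * z j = 0 := by omega
  refine ⟨i, mul_self_eq_one_iff.mp (by omega), fun j hj => mul_self_eq_zero.mp ?_⟩
  exact (Finset.sum_eq_zero_iff_of_nonneg hnonneg).mp hrest j
    (Finset.mem_erase.mpr ⟨hj, Finset.mem_univ _⟩)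

theorem exists_frobeniusChar_eq_schurFun {V : Type*} [AddCommGroup V] [Module ℂ V]
    [FiniteDimensional ℂ V] (ρ : Representation ℂ (Perm (Fin n)) V) [ρ.IsIrreducible] :
    ∃ ν : n.Partition, frobeniusChar ρ = schurFun ν := by
  choose z hz using exists_schurCoeff_frobeniusChar_eq ρ
  have hsq : ∑ ν : n.Partition, z ν * z ν = 1 := by
    have hsq_complex := sum_schurCoeff_sq ρ
    simp_rw [hz] at hsq_complex
    exact_mod_cast hsq_complex
  obtain ⟨ν, hν, hzero⟩ := exists_eq_one_or_neg_one_of_sum_mul_self_eq_one hsq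
  have hchar : frobeniusChar ρ = (z ν : ℂ) • schurFun ν := by
    rw [frobeniusChar_eq_charSum, charSum_eq_sum_schurFun, ← frobeniusChar_eq_charSum]
    simp_rw [hz]
    exact Finset.sum_eq_single ν (fun μ _ hμ => by rw [hzero μ hμ, Int.cast_zero, zero_smul])
      fun hmem => absurd (Finset.mem_univ _) hmem
  obtain ⟨m, hm⟩ := exists_coeff_symmEval_frobeniusChar_eq ρ
    (MonomialOrder.lex.degree (symmEval n (frobeniusChar ρ)))
  have hzm : z ν = m := by
    rw [← MonomialOrder.leadingCoeff, hchar, leadingCoeff_symmEval_smul_schurFun] at hm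
    exact_mod_cast hm
  rcases hν with hν | hν
  · exact ⟨ν, by rw [hchar, hν, Int.cast_one, one_smul]⟩
  · omega

theorem IsSchurPositive.add {f g : SymmFun} (hf : IsSchurPositive n f) (hg : IsSchurPositive n g) :
    IsSchurPositive n (f + g) := by
  obtain ⟨c, rfl⟩ := hf
  obtain ⟨d, rfl⟩ := hg
  refine ⟨c + d, ?_⟩
  simp only [Pi.add_apply, Nat.cast_add, add_smul, Finset.sum_add_distrib]

theorem isSchurPositive_schurFun (ν : n.Partition) : IsSchurPositive n (schurFun ν) := by
  classical
  exact ⟨fun μ => if μ = ν then 1 else 0, by simp⟩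

theorem isSchurPositive_frobeniusChar {V : Type*} [AddCommGroup V] [Module ℂ V]
    [FiniteDimensional ℂ V] (ρ : Representation ℂ (Perm (Fin n)) V) :
    IsSchurPositive n (frobeniusChar ρ) := by
  induction hd : Module.finrank ℂ V using Nat.strong_induction_on generalizing V with
  | _ d ih =>
    rcases subsingleton_or_nontrivial V with hV | hV
    · refine ⟨0, ?_⟩
      have hchar : ∀ σ, ρ.character σ = 0 := fun σ => by
        rw [Representation.character, Subsingleton.elim (ρ σ) 0, map_zero]
      simp [frobeniusChar_eq_charSum, charSum, hchar]
    · obtain ⟨U, U', hU, hUU'⟩ := exists_isIrreducible_isCompl ρ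
      obtain ⟨e⟩ := nonempty_prod_equiv_of_isCompl hUU'
      have hadd : frobeniusChar ρ =
          frobeniusChar U.toRepresentation + frobeniusChar U'.toRepresentation := by
        rw [← frobeniusChar_prod, frobeniusChar_eq_charSum, frobeniusChar_eq_charSum,
          Representation.char_iso e]
      have hlt : Module.finrank ℂ U'.toSubmodule < d := by
        have := nontrivial_of_isIrreducible hU
        have hfinrank := e.toLinearEquiv.finrank_eq
        rw [Module.finrank_prod] at hfinrank
        have hpos : 0 < Module.finrank ℂ U.toSubmodule := Module.finrank_pos
        omega
      obtain ⟨ν, hν⟩ := exists_frobeniusChar_eq_schurFun U.toRepresentation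
      rw [hadd, hν]
      exact (isSchurPositive_schurFun ν).add (ih _ hlt U'.toRepresentation rfl)

end Positivity

section Main

variable {n : ℕ} {W : Fin (n + 1) → Type u} [∀ r, AddCommGroup (W r)] [∀ r, Module ℂ (W r)]
  {ρ : ∀ r, Representation ℂ (Equiv.Perm (Fin n)) (W r)}

theorem IsVhFamily.isSchurPositive_odd (hρ : IsVhFamily ρ) (hn : 2 ≤ n) :
    IsSchurPositive n ((1 / 2 : ℂ) • sumPowTwo n) := by
  have := hρ.finiteDimensional_odd
  rw [← hρ.frobeniusChar_odd hn]
  exact isSchurPositive_frobeniusChar _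

theorem IsVhFamily.isSchurPositive_total (hρ : IsVhFamily ρ) : IsSchurPositive n (sumPowTwo n) := by
  have := hρ.finiteDimensional_odd
  have := hρ.finiteDimensional_even
  rw [← hρ.frobeniusChar_total, vhTotal]
  exact isSchurPositive_frobeniusChar _

theorem IsVhFamily.isSchurPositive_odd_prod_sign (hρ : IsVhFamily ρ) (hn : 2 ≤ n) :
    IsSchurPositive n (sumPowTwoEven n) := by
  have := hρ.finiteDimensional_odd
  rw [← hρ.frobeniusChar_odd_prod_sign hn]
  exact isSchurPositive_frobeniusChar _

end Main

end

theorem mainTheorem4 :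
    (∀ n : ℕ, ∃ (W : Fin (n + 1) → Type u) (_ : ∀ r, AddCommGroup (W r))
        (_ : ∀ r, Module ℂ (W r)) (ρ : ∀ r, Representation ℂ (Equiv.Perm (Fin n)) (W r)),
        IsVhFamily ρ) ∧
    (∀ (W : (n : ℕ) → Fin (n + 1) → Type u) [∀ n r, AddCommGroup (W n r)]
        [∀ n r, Module ℂ (W n r)]
        (Vh : ∀ n r, Representation ℂ (Equiv.Perm (Fin n)) (W n r)),
        (∀ n, IsVhFamily (Vh n)) →
        (∀ n : ℕ, 2 ≤ n →
          Nonempty ((vhOdd (Vh n)).Equiv (vhEven (Vh n))) ∧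
          frobeniusChar (vhOdd (Vh n)) = (1 / 2 : ℂ) • sumPowTwo n ∧
          frobeniusChar (vhEven (Vh n)) = (1 / 2 : ℂ) • sumPowTwo n) ∧
        (∀ n : ℕ, frobeniusChar (vhTotal (Vh n)) = sumPowTwo n) ∧
        (∀ n : ℕ, 2 ≤ n →
          frobeniusChar ((vhOdd (Vh n)).prod ((signRep n).tprod (vhOdd (Vh n)))) =
            sumPowTwoEven n) ∧
        (∀ n : ℕ, Nonempty ((vhTotal (Vh (2 * n + 1))).Equiv
          (Representation.ind (permSucc (2 * n)) (vhTotal (Vh (2 * n))))))) ∧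
    (∀ n : ℕ, 2 ≤ n → IsSchurPositive n ((1 / 2 : ℂ) • sumPowTwo n)) ∧
    (∀ n : ℕ, IsSchurPositive n (sumPowTwo n)) ∧
    (∀ n : ℕ, 2 ≤ n → IsSchurPositive n (sumPowTwoEven n)) := by
  refine ⟨exists_isVhFamily, ?_, ?_, ?_, ?_⟩
  · intro W _ _ Vh h
    refine ⟨fun n hn => ⟨(h n).nonempty_equiv_odd_even hn, (h n).frobeniusChar_odd hn, ?_⟩,
      fun n => (h n).frobeniusChar_total, fun n hn => (h n).frobeniusChar_odd_prod_sign hn,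
      fun n => nonempty_equiv_ind_permSucc (h (2 * n)) (h (2 * n + 1))⟩
    rw [← (h n).frobeniusChar_odd_eq_even hn, (h n).frobeniusChar_odd hn]
  · intro n hn
    obtain ⟨W, _, _, ρ, hρ⟩ := exists_isVhFamily.{0} n
    exact hρ.isSchurPositive_odd hn
  · intro n
    obtain ⟨W, _, _, ρ, hρ⟩ := exists_isVhFamily.{0} n
    exact hρ.isSchurPositive_total
  · intro n hn
    obtain ⟨W, _, _, ρ, hρ⟩ := exists_isVhFamily.{0} n
    exact hρ.isSchurPositive_odd_prod_sign hn
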